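/- \textbf{Theorem.} Consider the line-constrained weighted disk coverage problem in the Euclidean ($L_2$) plane: given a set $P$ of $n\ge 1$ points in the plane and a set $S$ of $m$ closed disks with centres on the $x$-axis $L$, arbitrary positive radii and positive real weights, such that the union of the disks contains $P$, compute a subset of $S$ of minimum total weight whose union contains $P$. Let $\kappa$ be the number of unordered pairs of disks of $S$ that intersect each other. Then on a real RAM (unit cost for each random memory access, for addition, subtraction and comparison of integer indices, and for addition, subtraction, multiplication, division and comparison of real numbers) the problem can be solved in \[ O\bigl(nm\log(m+n)\bigr) \] time, and it can also be solved in \[ O\bigl((n+m)\log(n+m)+\kappa\log m\bigr) \] time. That is, for each of the two bounds there are one program and one constant $C$ such that on every such input the program halts after at most $C$ times the stated bound many steps and outputs an optimal subset. -/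

import Mathlib

/-! ## A real RAM

Structured programs over finitely many arrays of natural numbers (used for indices, pointers and
counters) and finitely many arrays of real numbers, with random access.  Every operation on an
index or on a real, every memory access and every test costs one unit.  A scalar variable is cell
`0` of an array.  The only operations on indices are addition, truncated subtraction and
comparison; the only operations on reals are the four field operations and comparison.  There is
no rounding and no conversion between reals and indices, and the literals in a program are natural
numbers. -/

namespace RealRAM

/-- The memory: cell `i` of the `a`-th array of naturals is `nat a i`, cell `i` of the `a`-th
array of reals is `real a i`. -/
structure State where
  nat : ℕ → ℕ → ℕ
  real : ℕ → ℕ → ℝ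

/-- Index expressions. -/
inductive NExp : Type
  | lit (k : ℕ)
  | read (a : ℕ) (i : NExp)
  | add (e f : NExp)
  | sub (e f : NExp)

/-- Real expressions. -/
inductive RExp : Type
  | lit (k : ℕ)
  | read (a : ℕ) (i : NExp)
  | add (e f : RExp)
  | sub (e f : RExp)
  | mul (e f : RExp)
  | div (e f : RExp)

/-- Tests. -/
inductive BExp : Type
  | nle (e f : NExp)
  | rle (e f : RExp)
  | not (b : BExp)
  | and (b c : BExp)

/-- Programs. -/
inductive Prog : Type
  | skip
  | nset (a : ℕ) (i e : NExp)
  | rset (a : ℕ) (i : NExp) (e : RExp)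
  | seq (p q : Prog)
  | ite (b : BExp) (p q : Prog)
  | while (b : BExp) (p : Prog)

/-- The value of an index expression. -/
def NExp.eval (s : State) : NExp → ℕ
  | .lit k => k
  | .read a i => s.nat a (i.eval s)
  | .add e f => e.eval s + f.eval s
  | .sub e f => e.eval s - f.eval s

/-- The cost of evaluating an index expression: its number of literals, operations and memory
accesses. -/
def NExp.cost : NExp → ℕ
  | .lit _ => 1
  | .read _ i => i.cost + 1
  | .add e f => e.cost + f.cost + 1
  | .sub e f => e.cost + f.cost + 1

/-- The value of a real expression (dividing by zero gives zero). -/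
noncomputable def RExp.eval (s : State) : RExp → ℝ
  | .lit k => (k : ℝ)
  | .read a i => s.real a (i.eval s)
  | .add e f => e.eval s + f.eval s
  | .sub e f => e.eval s - f.eval s
  | .mul e f => e.eval s * f.eval s
  | .div e f => e.eval s / f.eval s

/-- The cost of evaluating a real expression. -/
def RExp.cost : RExp → ℕ
  | .lit _ => 1
  | .read _ i => i.cost + 1
  | .add e f => e.cost + f.cost + 1
  | .sub e f => e.cost + f.cost + 1
  | .mul e f => e.cost + f.cost + 1
  | .div e f => e.cost + f.cost + 1

/-- The truth of a test. -/
def BExp.Holds (s : State) : BExp → Prop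
  | .nle e f => e.eval s ≤ f.eval s
  | .rle e f => e.eval s ≤ f.eval s
  | .not b => ¬ b.Holds s
  | .and b c => b.Holds s ∧ c.Holds s

/-- The cost of evaluating a test. -/
def BExp.cost : BExp → ℕ
  | .nle e f => e.cost + f.cost + 1
  | .rle e f => e.cost + f.cost + 1
  | .not b => b.cost + 1
  | .and b c => b.cost + c.cost + 1

/-- Write `v` into cell `i` of the `a`-th array of naturals. -/
def State.setNat (s : State) (a i v : ℕ) : State where
  nat := Function.update s.nat a (Function.update (s.nat a) i v)
  real := s.real

/-- Write `v` into cell `i` of the `a`-th array of reals. -/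
def State.setReal (s : State) (a i : ℕ) (v : ℝ) : State where
  nat := s.nat
  real := Function.update s.real a (Function.update (s.real a) i v)

/-- `Exec p s s' t`: started in the memory `s`, the program `p` halts after exactly `t` units of
time, with memory `s'`. -/
inductive Exec : Prog → State → State → ℕ → Prop
  | skip (s : State) : Exec .skip s s 1
  | nset (s : State) (a : ℕ) (i e : NExp) :
      Exec (.nset a i e) s (s.setNat a (i.eval s) (e.eval s)) (i.cost + e.cost + 1)
  | rset (s : State) (a : ℕ) (i : NExp) (e : RExp) :
      Exec (.rset a i e) s (s.setReal a (i.eval s) (e.eval s)) (i.cost + e.cost + 1)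
  | seq {p q : Prog} {s s' s'' : State} {t u : ℕ} :
      Exec p s s' t → Exec q s' s'' u → Exec (.seq p q) s s'' (t + u)
  | iteTrue {b : BExp} {p q : Prog} {s s' : State} {t : ℕ} :
      b.Holds s → Exec p s s' t → Exec (.ite b p q) s s' (b.cost + t + 1)
  | iteFalse {b : BExp} {p q : Prog} {s s' : State} {t : ℕ} :
      ¬ b.Holds s → Exec q s s' t → Exec (.ite b p q) s s' (b.cost + t + 1)
  | whileFalse {b : BExp} {p : Prog} {s : State} :
      ¬ b.Holds s → Exec (.while b p) s s (b.cost + 1)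
  | whileTrue {b : BExp} {p : Prog} {s s' s'' : State} {t u : ℕ} :
      b.Holds s → Exec p s s' t → Exec (.while b p) s' s'' u →
      Exec (.while b p) s s'' (b.cost + t + u + 1)

/-- The machine is deterministic: a program that halts has one final memory and one running
time. -/
theorem Exec.deterministic {p : Prog} {s s₁ s₂ : State} {t₁ t₂ : ℕ}
    (h₁ : Exec p s s₁ t₁) (h₂ : Exec p s s₂ t₂) : s₁ = s₂ ∧ t₁ = t₂ := by
  induction h₁ generalizing s₂ t₂ with
  | skip => cases h₂; exact ⟨rfl, rfl⟩
  | nset => cases h₂; exact ⟨rfl, rfl⟩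
  | rset => cases h₂; exact ⟨rfl, rfl⟩
  | seq _ _ ih₁ ih₂ =>
    cases h₂ with
    | seq k₁ k₂ =>
      obtain ⟨rfl, rfl⟩ := ih₁ k₁
      obtain ⟨rfl, rfl⟩ := ih₂ k₂
      exact ⟨rfl, rfl⟩
  | iteTrue hb _ ih =>
    cases h₂ with
    | iteTrue _ k => obtain ⟨rfl, rfl⟩ := ih k; exact ⟨rfl, rfl⟩
    | iteFalse hb' _ => exact absurd hb hb'
  | iteFalse hb _ ih =>
    cases h₂ with
    | iteTrue hb' _ => exact absurd hb' hb
    | iteFalse _ k => obtain ⟨rfl, rfl⟩ := ih k; exact ⟨rfl, rfl⟩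
  | whileFalse hb =>
    cases h₂ with
    | whileFalse _ => exact ⟨rfl, rfl⟩
    | whileTrue hb' _ _ => exact absurd hb' hb
  | whileTrue hb _ _ ih₁ ih₂ =>
    cases h₂ with
    | whileFalse hb' => exact absurd hb hb'
    | whileTrue _ k₁ k₂ =>
      obtain ⟨rfl, rfl⟩ := ih₁ k₁
      obtain ⟨rfl, rfl⟩ := ih₂ k₂
      exact ⟨rfl, rfl⟩

end RealRAM

/-! ## Line-constrained weighted disk coverage in the Euclidean plane -/

/-- `n` points in the plane and `m` disks of positive radius and positive weight whose centres
lie on the `x`-axis. -/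
structure LineDiskInstance (n m : ℕ) where
  point : Fin n → EuclideanSpace ℝ (Fin 2)
  /-- The abscissa of the centre of each disk. -/
  center : Fin m → ℝ
  radius : Fin m → ℝ
  weight : Fin m → ℝ
  radius_pos : ∀ k, 0 < radius k
  weight_pos : ∀ k, 0 < weight k

namespace LineDiskInstance

variable {n m : ℕ}

/-- The `k`-th disk, a closed Euclidean disk centred on the `x`-axis. -/
def disk (I : LineDiskInstance n m) (k : Fin m) : Set (EuclideanSpace ℝ (Fin 2)) :=
  Metric.closedBall !₂[I.center k, 0] (I.radius k)

/-- The disks with index in `T` cover all points. -/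
def Covers (I : LineDiskInstance n m) (T : Finset (Fin m)) : Prop :=
  ∀ i, ∃ k ∈ T, I.point i ∈ I.disk k

/-- `T` is a cover of minimum total weight. -/
def IsOptimal (I : LineDiskInstance n m) (T : Finset (Fin m)) : Prop :=
  I.Covers T ∧ ∀ T', I.Covers T' → ∑ k ∈ T, I.weight k ≤ ∑ k ∈ T', I.weight k

open Classical in
/-- The number of unordered pairs of disks that intersect. -/
noncomputable def kappa (I : LineDiskInstance n m) : ℕ :=
  (Finset.univ.filter fun q : Fin m × Fin m =>
    q.1 < q.2 ∧ (I.disk q.1 ∩ I.disk q.2).Nonempty).card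

/-- A finite sequence as the contents of an array, padded with zeros. -/
def toArray {N : ℕ} (f : Fin N → ℝ) (i : ℕ) : ℝ :=
  if h : i < N then f ⟨i, h⟩ else 0

/-- The initial memory.  Natural array `0` holds `n` and `m`; real arrays `0` to `4` hold the
abscissas and the ordinates of the points, and the centres, radii and weights of the disks, in
the given order.  All other cells are zero. -/
noncomputable def input (I : LineDiskInstance n m) : RealRAM.State where
  nat := fun a i =>
    match a, i with
    | 0, 0 => n
    | 0, 1 => m
    | _, _ => 0
  real := fun a =>
    match a with
    | 0 => toArray fun i => I.point i 0
    | 1 => toArray fun i => I.point i 1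
    | 2 => toArray I.center
    | 3 => toArray I.radius
    | 4 => toArray I.weight
    | _ => fun _ => 0

/-- The set of disks that a final memory describes: disk `k` is chosen if and only if cell `k` of
natural array `1` is `1`. -/
def output (m : ℕ) (s : RealRAM.State) : Finset (Fin m) :=
  Finset.univ.filter fun k => s.nat 1 k = 1

/-- On the instance `I`, the program `p` halts within time `B` and outputs an optimal cover. -/
def SolvedWithin (I : LineDiskInstance n m) (p : RealRAM.Prog) (B : ℝ) : Prop :=
  ∃ (s : RealRAM.State) (t : ℕ),
    RealRAM.Exec p I.input s t ∧ (t : ℝ) ≤ B ∧ I.IsOptimal (output m s)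

end LineDiskInstance

/-! A disk with centre `(c, 0)` and radius `r` contains `(x, y)` exactly when `y² ≤ r² - (x - c)²`,
so a disk matters only through its height function. The difference of two height functions is
affine, with slope proportional to the difference of the centres. Hence two disks with different
centres exchange their order once, and the one with the larger centre wins on the right
(`center_lt_of_discHeight`, `Scene.h_sub`). In any cover `T`, the disks that are successively
highest from left to right therefore have increasing centres. Both algorithms build chains of disks
and are compared with `T` along these highest disks, so that each disk of `T` is charged at most
once.

First bound. With the points sorted by abscissa, let `f j` be the minimum of `f (s - 1) + w k` over
the disks `k` that contain point `j`, where `s` begins the maximal run of consecutive points in `k`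
that ends at `j`. Tracing the minimizers back yields a cover of weight at most `f n`. Conversely,
`chain_le_sum` shows that `f j` is at most the weight of the disk of `T` that is highest at `j` plus
the weights of the disks of `T` with smaller centres. The table takes `O(nm)` steps, since the
starts of the runs are updated in constant time per disk and point.

Second bound. A vertical line sweeps over four kinds of events: a disk begins, a disk overtakes
another, a point is passed, a disk ends. A token is a set of disks with a cost, given by a disk and
an older token; the current token of an active disk `b` covers all points passed so far. When `b`
overtakes `a`, it may continue the token of `a`; when a disk begins, it may continue the best token
of a disk that has ended. The tokens form a list in which the current ones are ordered by height, so
a point invalidates a lower part of the list, which is popped from the front. Superseded tokens stay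
in the list until they are popped; each event adds at most one token, so all pops are paid for by
insertions.

Optimality is the invariant `Scene.Opt`: for every cover `T`, the highest active disk of `T` has a
token that costs at most its weight plus the weights of the disks of `T` with smaller centres; if no
disk of `T` is active, a finished token costs at most the weight of the ended disks of `T`. After
the last event this bounds the output by every cover (`Scene.Inv.final`). Coincident events are
ordered by kind and then by centres. This makes a disk begin and end at the bottom of the order and
lets only neighbours exchange places (`Scene.At.ins_below`, `Scene.At.rem_below`,
`Scene.At.below_crs_iff`). Identical disks would defeat these tie-breaks, so only a lightest copy of
each is kept. Crossings are generated for intersecting disks only, so there are at most `n + 2m + κ`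
events, and sorting them dominates. Finally `log (n + m)` is reduced to `log m` in the term with `κ`
by distinguishing `n < m²` from `n ≥ m²`. -/

/-! ## A weakest-precondition calculus with time credits -/

namespace RealRAM

attribute [simp] NExp.eval NExp.cost RExp.eval RExp.cost BExp.Holds BExp.cost

@[simp] theorem State.setNat_real (s : State) (a i v : ℕ) : (s.setNat a i v).real = s.real := rfl

@[simp] theorem State.setReal_nat (s : State) (a i : ℕ) (v : ℝ) :
    (s.setReal a i v).nat = s.nat := rfl

@[simp] theorem State.setNat_nat_same (s : State) (a i v : ℕ) :
    (s.setNat a i v).nat a = Function.update (s.nat a) i v := by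
  simp [State.setNat]

@[simp] theorem State.setNat_nat_ne (s : State) {a b : ℕ} (i v : ℕ) (h : b ≠ a) :
    (s.setNat a i v).nat b = s.nat b := by
  simp [State.setNat, h]

@[simp] theorem State.setReal_real_same (s : State) (a i : ℕ) (v : ℝ) :
    (s.setReal a i v).real a = Function.update (s.real a) i v := by
  simp [State.setReal]

@[simp] theorem State.setReal_real_ne (s : State) {a b : ℕ} (i : ℕ) (v : ℝ) (h : b ≠ a) :
    (s.setReal a i v).real b = s.real b := by
  simp [State.setReal, h]

/-- Strict comparison of indices. -/
abbrev BExp.nlt (e f : NExp) : BExp := .not (.nle f e)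

/-- Strict comparison of reals. -/
abbrev BExp.rlt (e f : RExp) : BExp := .not (.rle f e)

/-- Equality of indices. -/
abbrev BExp.neq (e f : NExp) : BExp := .and (.nle e f) (.nle f e)

/-- Equality of reals. -/
abbrev BExp.req (e f : RExp) : BExp := .and (.rle e f) (.rle f e)

/-- Disjunction of tests. -/
abbrev BExp.or (b c : BExp) : BExp := .not (.and (.not b) (.not c))

infixr:30 " ;; " => Prog.seq

/-- `wp p Q s c`: started in `s` with `c` units of time at its disposal, `p` halts in time, and
`Q` holds of the final memory and of the time left over. -/
def wp (p : Prog) (Q : State → ℕ → Prop) (s : State) (c : ℕ) : Prop :=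
  ∃ s' t, Exec p s s' t ∧ t ≤ c ∧ Q s' (c - t)

section
variable {p q : Prog} {Q Q' : State → ℕ → Prop} {s : State} {c d : ℕ}

@[simp] theorem wp_skip : wp .skip Q s c ↔ 1 ≤ c ∧ Q s (c - 1) := by
  constructor
  · rintro ⟨s', t, h, ht, hq⟩
    cases h
    exact ⟨ht, hq⟩
  · rintro ⟨h, hq⟩
    exact ⟨_, _, .skip s, h, hq⟩

@[simp] theorem wp_nset {a : ℕ} {i e : NExp} : wp (.nset a i e) Q s c ↔
    i.cost + e.cost + 1 ≤ c ∧ Q (s.setNat a (i.eval s) (e.eval s)) (c - (i.cost + e.cost + 1)) := by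
  constructor
  · rintro ⟨s', t, h, ht, hq⟩
    cases h
    exact ⟨ht, hq⟩
  · rintro ⟨h, hq⟩
    exact ⟨_, _, .nset s a i e, h, hq⟩

@[simp] theorem wp_rset {a : ℕ} {i : NExp} {e : RExp} : wp (.rset a i e) Q s c ↔
    i.cost + e.cost + 1 ≤ c ∧
      Q (s.setReal a (i.eval s) (e.eval s)) (c - (i.cost + e.cost + 1)) := by
  constructor
  · rintro ⟨s', t, h, ht, hq⟩
    cases h
    exact ⟨ht, hq⟩
  · rintro ⟨h, hq⟩
    exact ⟨_, _, .rset s a i e, h, hq⟩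

@[simp] theorem wp_seq : wp (p ;; q) Q s c ↔ wp p (wp q Q) s c := by
  constructor
  · rintro ⟨s', t, h, ht, hq⟩
    cases h with
    | seq h₁ h₂ => exact ⟨_, _, h₁, by omega, _, _, h₂, by omega, by rwa [Nat.sub_sub]⟩
  · rintro ⟨s₁, t₁, h₁, ht₁, s₂, t₂, h₂, ht₂, hq⟩
    exact ⟨_, _, .seq h₁ h₂, by omega, by rwa [Nat.sub_sub] at hq⟩

@[simp] theorem wp_ite {b : BExp} : wp (.ite b p q) Q s c ↔ b.cost + 1 ≤ c ∧
    (b.Holds s → wp p Q s (c - (b.cost + 1))) ∧ (¬ b.Holds s → wp q Q s (c - (b.cost + 1))) := by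
  constructor
  · rintro ⟨s', t, h, ht, hq⟩
    cases h with
    | iteTrue hb h =>
      refine ⟨by omega, fun _ => ⟨_, _, h, by omega, ?_⟩, fun hb' => absurd hb hb'⟩
      convert hq using 1; omega
    | iteFalse hb h =>
      refine ⟨by omega, fun hb' => absurd hb' hb, fun _ => ⟨_, _, h, by omega, ?_⟩⟩
      convert hq using 1; omega
  · rintro ⟨h, h₁, h₂⟩
    by_cases hb : b.Holds s
    · obtain ⟨s', t, he, ht, hq⟩ := h₁ hb
      refine ⟨s', _, .iteTrue hb he, by omega, ?_⟩
      convert hq using 1; omega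
    · obtain ⟨s', t, he, ht, hq⟩ := h₂ hb
      refine ⟨s', _, .iteFalse hb he, by omega, ?_⟩
      convert hq using 1; omega

end

/-- The program writes into the `a`-th array of naturals. -/
@[simp] def Prog.WritesNat (a : ℕ) : Prog → Prop
  | .skip => False
  | .nset b _ _ => b = a
  | .rset _ _ _ => False
  | .seq p q => p.WritesNat a ∨ q.WritesNat a
  | .ite _ p q => p.WritesNat a ∨ q.WritesNat a
  | .while _ p => p.WritesNat a

/-- The program writes into the `a`-th array of reals. -/
@[simp] def Prog.WritesReal (a : ℕ) : Prog → Prop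
  | .skip => False
  | .nset _ _ _ => False
  | .rset b _ _ => b = a
  | .seq p q => p.WritesReal a ∨ q.WritesReal a
  | .ite _ p q => p.WritesReal a ∨ q.WritesReal a
  | .while _ p => p.WritesReal a

/-- `s` and `s'` agree outside the arrays that `p` writes. -/
structure Same (p : Prog) (s s' : State) : Prop where
  nat : ∀ a, ¬ p.WritesNat a → s'.nat a = s.nat a
  real : ∀ a, ¬ p.WritesReal a → s'.real a = s.real a

theorem Same.refl (p : Prog) (s : State) : Same p s s := ⟨fun _ _ => rfl, fun _ _ => rfl⟩

theorem Same.trans {p : Prog} {s s' s'' : State} (h : Same p s s') (h' : Same p s' s'') :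
    Same p s s'' :=
  ⟨fun a ha => (h'.nat a ha).trans (h.nat a ha), fun a ha => (h'.real a ha).trans (h.real a ha)⟩

/-- The frame rule. The set of written arrays is read off the program text, so a specification need
only describe the arrays that change. -/
theorem Exec.same {p : Prog} {s s' : State} {t : ℕ} (h : Exec p s s' t) : Same p s s' := by
  induction h with
  | skip s => exact .refl _ _
  | nset s a i e => exact ⟨fun b hb => by simp at hb; simp [Ne.symm hb], fun b _ => by simp⟩
  | rset s a i e => exact ⟨fun b _ => by simp, fun b hb => by simp at hb; simp [Ne.symm hb]⟩
  | seq _ _ h₁ h₂ =>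
    refine ⟨fun b hb => ?_, fun b hb => ?_⟩ <;> simp only [Prog.WritesNat, Prog.WritesReal, not_or] at hb
    · rw [h₂.nat b hb.2, h₁.nat b hb.1]
    · rw [h₂.real b hb.2, h₁.real b hb.1]
  | iteTrue _ _ h =>
    refine ⟨fun b hb => ?_, fun b hb => ?_⟩ <;> simp only [Prog.WritesNat, Prog.WritesReal, not_or] at hb
    · exact h.nat b hb.1
    · exact h.real b hb.1
  | iteFalse _ _ h =>
    refine ⟨fun b hb => ?_, fun b hb => ?_⟩ <;> simp only [Prog.WritesNat, Prog.WritesReal, not_or] at hb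
    · exact h.nat b hb.2
    · exact h.real b hb.2
  | whileFalse _ => exact .refl _ _
  | whileTrue _ _ _ h₁ h₂ => exact .trans ⟨h₁.nat, h₁.real⟩ h₂

/-- The rule for loops.  Since every test costs time, the credits bound the number of rounds. -/
theorem wp_while {b : BExp} {p : Prog} {Q : State → ℕ → Prop} {s₀ : State} {c₀ : ℕ}
    (Inv : State → ℕ → Prop) (h₀ : Inv s₀ c₀)
    (h : ∀ s c, Same p s₀ s → Inv s c → b.cost + 1 ≤ c ∧
      (b.Holds s → wp p Inv s (c - (b.cost + 1))) ∧ (¬ b.Holds s → Q s (c - (b.cost + 1)))) :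
    wp (.while b p) Q s₀ c₀ := by
  have key : ∀ c s, Same p s₀ s → Inv s c → wp (.while b p) Q s c := by
    intro c
    induction c using Nat.strong_induction_on with
    | _ c ih =>
      intro s hs hi
      obtain ⟨hc, h₁, h₂⟩ := h s c hs hi
      by_cases hb : b.Holds s
      · obtain ⟨s', t, he, ht, hi'⟩ := h₁ hb
        obtain ⟨s'', u, hu, htu, hq⟩ := ih _ (by omega) s' (hs.trans he.same) hi'
        refine ⟨s'', _, .whileTrue hb he hu, by omega, ?_⟩
        convert hq using 1; omega
      · exact ⟨s, _, .whileFalse hb, hc, h₂ hb⟩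
  exact key c₀ s₀ (.refl _ _) h₀

/-- Started in `s`, the program `p` halts within `k` steps in a memory satisfying `R`. -/
def Runs (p : Prog) (s : State) (k : ℕ) (R : State → Prop) : Prop :=
  wp p (fun s' _ => R s') s k

/-- The rule for calling a verified subprogram: the caller receives the postcondition, the frame,
and all credits beyond the bound. -/
theorem Runs.wp {p : Prog} {s : State} {k c : ℕ} {R : State → Prop} {Q : State → ℕ → Prop}
    (h : Runs p s k R) (hk : k ≤ c)
    (hQ : ∀ s' c', Same p s s' → R s' → c - k ≤ c' → Q s' c') : wp p Q s c := by
  obtain ⟨s', t, he, ht, hq⟩ := h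
  exact ⟨s', t, he, by omega, hQ _ _ he.same hq (by omega)⟩

theorem Runs.mono {p : Prog} {s : State} {k k' : ℕ} {R R' : State → Prop}
    (h : Runs p s k R) (hk : k ≤ k') (hR : ∀ s', Same p s s' → R s' → R' s') :
    Runs p s k' R' :=
  h.wp hk fun s' _ hs hr _ => hR s' hs hr

end RealRAM

/-! ## Segments of arrays -/

/-- The list of the values `f a, …, f (b - 1)`. -/
def seg {α : Type*} (f : ℕ → α) (a b : ℕ) : List α := (List.range' a (b - a)).map f

section seg
variable {α : Type*} {f g : ℕ → α} {a b c : ℕ}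

theorem seg_eq_nil (h : b ≤ a) : seg f a b = [] := by
  simp [seg, Nat.sub_eq_zero_of_le h]

theorem seg_cons (h : a < b) : seg f a b = f a :: seg f (a + 1) b := by
  obtain ⟨k, rfl⟩ : ∃ k, b = a + (k + 1) := ⟨b - a - 1, by omega⟩
  have : a + (k + 1) - (a + 1) = k := by omega
  simp [seg, List.range'_succ, this]

theorem seg_append (h : a ≤ b) (h' : b ≤ c) : seg f a b ++ seg f b c = seg f a c := by
  obtain ⟨k, rfl⟩ := Nat.exists_eq_add_of_le h
  obtain ⟨l, rfl⟩ := Nat.exists_eq_add_of_le h'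
  have h1 : a + k + l - a = k + l := by omega
  have h2 : a + k - a = k := by omega
  have h3 : a + k + l - (a + k) = l := by omega
  simp only [seg, h1, h2, h3, ← List.map_append]
  rw [List.range'_append_1]

theorem seg_succ (h : a ≤ b) : seg f a (b + 1) = seg f a b ++ [f b] := by
  rw [← seg_append h (Nat.le_succ b), seg_cons (Nat.lt_succ_self b), seg_eq_nil le_rfl]

theorem seg_congr (h : ∀ i, a ≤ i → i < b → f i = g i) : seg f a b = seg g a b := by
  refine List.map_congr_left fun i hi => ?_
  rw [List.mem_range'_1] at hi
  exact h i hi.1 (by omega)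

theorem mem_seg {x : α} : x ∈ seg f a b ↔ ∃ i, a ≤ i ∧ i < b ∧ f i = x := by
  simp only [seg, List.mem_map, List.mem_range'_1]
  constructor
  · rintro ⟨i, ⟨h1, h2⟩, rfl⟩; exact ⟨i, h1, by omega, rfl⟩
  · rintro ⟨i, h1, h2, rfl⟩; exact ⟨i, ⟨h1, by omega⟩, rfl⟩

@[simp] theorem length_seg : (seg f a b).length = b - a := by simp [seg]

theorem getElem_seg {i : ℕ} (h : i < (seg f a b).length) : (seg f a b)[i] = f (a + i) := by
  simp [seg]

theorem pairwise_seg {r : α → α → Prop} :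
    (seg f a b).Pairwise r ↔ ∀ i j, a ≤ i → i < j → j < b → r (f i) (f j) := by
  rw [List.pairwise_iff_getElem]
  simp only [getElem_seg, length_seg]
  constructor
  · intro h i j hi hij hj
    have := h (i - a) (j - a) (by omega) (by omega) (by omega)
    rwa [Nat.add_sub_cancel' hi, Nat.add_sub_cancel' (hi.trans hij.le)] at this
  · intro h i j _ hj hij
    exact h _ _ (by omega) (by omega) (by omega)

theorem seg_update_of_le {v : α} {i : ℕ} (h : b ≤ i) :
    seg (Function.update f i v) a b = seg f a b :=
  seg_congr fun j _ hj => Function.update_of_ne (by omega) _ _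

theorem seg_update_succ {v : α} (h : a ≤ b) :
    seg (Function.update f b v) a (b + 1) = seg f a b ++ [v] := by
  rw [seg_succ h, seg_update_of_le le_rfl, Function.update_self]

end seg

namespace RealRAM

/-! ## Merge sort -/

section sort

/-- Cell `k` of the third array of naturals, which holds the variables of the sorting program. -/
abbrev sv (k : ℕ) : NExp := .read 3 (.lit k)

/-- Assignment to a variable of the sorting program. -/
abbrev sset (k : ℕ) (e : NExp) : Prog := .nset 3 (.lit k) e

/-- Move one element to the output of a merge. -/
def mergeStep (cmp : BExp) : Prog :=
  sset 0 (.read 4 (sv 7)) ;; sset 1 (.read 4 (sv 8)) ;;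
  .ite (.and (.nlt (sv 7) (sv 5)) (.or (.nle (sv 6) (sv 8)) cmp))
    (.nset 5 (sv 9) (.read 4 (sv 7)) ;; sset 7 (.add (sv 7) (.lit 1)))
    (.nset 5 (sv 9) (.read 4 (sv 8)) ;; sset 8 (.add (sv 8) (.lit 1))) ;;
  sset 9 (.add (sv 9) (.lit 1))

/-- Merge two adjacent blocks. -/
def mergeLoop (cmp : BExp) : Prog := .while (.nlt (sv 9) (sv 6)) (mergeStep cmp)

variable {le : ℕ → ℕ → Prop} {cmp : BExp}

open Classical in
/-- Two sorted lists merged. -/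
noncomputable def mergeBy (le : ℕ → ℕ → Prop) (l l' : List ℕ) : List ℕ :=
  List.merge l l' fun a b => decide (le a b)

theorem mergeBy_nil_right (l : List ℕ) : mergeBy le l [] = l := by simp [mergeBy]

theorem mergeBy_nil_left (l : List ℕ) : mergeBy le [] l = l := by simp [mergeBy]

theorem mergeBy_cons_of_le {a b : ℕ} {l l' : List ℕ} (h : le a b) :
    mergeBy le (a :: l) (b :: l') = a :: mergeBy le l (b :: l') := by
  simp [mergeBy, h]

theorem mergeBy_cons_of_not_le {a b : ℕ} {l l' : List ℕ} (h : ¬ le a b) :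
    mergeBy le (a :: l) (b :: l') = b :: mergeBy le (a :: l) l' := by
  simp [mergeBy, h]

theorem mergeBy_perm (l l' : List ℕ) : (mergeBy le l l').Perm (l ++ l') :=
  List.merge_perm_append _

theorem pairwise_mergeBy (tr : ∀ a b c, le a b → le b c → le a c) (tot : ∀ a b, le a b ∨ le b a)
    {l l' : List ℕ} (h : l.Pairwise le) (h' : l'.Pairwise le) : (mergeBy le l l').Pairwise le := by
  classical
  have := List.pairwise_merge (le := fun a b => decide (le a b)) (l₁ := l) (l₂ := l')
    (by simpa using tr) (by simpa using tot) (by simpa using h) (by simpa using h')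
  unfold mergeBy
  convert this.imp (S := le) (by simp)

/-- The test `cmp` decides `le` of variables `0` and `1` in all memories that agree with `s₀`
outside the arrays of the sorting program. -/
def Decides (cmp : BExp) (le : ℕ → ℕ → Prop) (s₀ : State) : Prop :=
  ∀ s : State, (∀ a, a ≠ 3 → a ≠ 4 → a ≠ 5 → s.nat a = s₀.nat a) → s.real = s₀.real →
    (cmp.Holds s ↔ le (s.nat 3 0) (s.nat 3 1))

theorem Decides.congr {s₀ s₁ : State} (h : Decides cmp le s₀)
    (h₁ : ∀ a, a ≠ 3 → a ≠ 4 → a ≠ 5 → s₁.nat a = s₀.nat a) (h₂ : s₁.real = s₀.real) :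
    Decides cmp le s₁ := fun s hs hr =>
  h s (fun a h3 h4 h5 => (hs a h3 h4 h5).trans (h₁ a h3 h4 h5)) (hr.trans h₂)

theorem Decides.same {p : Prog} {s₀ s₁ : State} (h : Decides cmp le s₀) (h₁ : Same p s₀ s₁)
    (hw : ∀ a, p.WritesNat a → a = 3 ∨ a = 4 ∨ a = 5) (hr : ∀ a, ¬ p.WritesReal a) :
    Decides cmp le s₁ :=
  h.congr (fun a h3 h4 h5 => h₁.nat a fun hh => by have := hw a hh; omega)
    (funext fun a => h₁.real a (hr a))

theorem mergeStep_writes {a : ℕ} : (mergeStep cmp).WritesNat a ↔ a = 3 ∨ a = 5 := by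
  simp [mergeStep]; omega

theorem mergeStep_writesReal {a : ℕ} : ¬ (mergeStep cmp).WritesReal a := by
  simp [mergeStep]

theorem mergeLoop_runs {s : State} (hd : Decides cmp le s)
    (h1 : s.nat 3 4 ≤ s.nat 3 5) (h2 : s.nat 3 5 ≤ s.nat 3 6)
    (h7 : s.nat 3 7 = s.nat 3 4) (h8 : s.nat 3 8 = s.nat 3 5) (h9 : s.nat 3 9 = s.nat 3 4) :
    Runs (mergeLoop cmp) s ((cmp.cost + 100) * (s.nat 3 6 - s.nat 3 4) + 10) fun s' =>
      (∀ k, k < 7 → 2 ≤ k → s'.nat 3 k = s.nat 3 k) ∧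
      (∀ k, k < s.nat 3 4 → s'.nat 5 k = s.nat 5 k) ∧
      seg (s'.nat 5) (s.nat 3 4) (s.nat 3 6) =
        mergeBy le (seg (s.nat 4) (s.nat 3 4) (s.nat 3 5)) (seg (s.nat 4) (s.nat 3 5) (s.nat 3 6)) := by
  unfold Runs mergeLoop
  set A := s.nat 4 with hA
  set lo := s.nat 3 4 with hlo
  set mid := s.nat 3 5 with hmid
  set hi := s.nat 3 6 with hhi
  clear_value A lo mid hi
  -- The output so far, followed by the merge of the two remainders, is always the full merge. The
  -- equation `t + mid = i + j` says that the output position counts the elements taken from both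
  -- blocks.
  refine wp_while (fun s' c => ∃ i j t, s'.nat 3 7 = i ∧ s'.nat 3 8 = j ∧ s'.nat 3 9 = t ∧
    lo ≤ t ∧ i ≤ mid ∧ mid ≤ j ∧ j ≤ hi ∧ t + mid = i + j ∧
    (∀ k, k < 7 → 2 ≤ k → s'.nat 3 k = s.nat 3 k) ∧
    (∀ k, k < lo → s'.nat 5 k = s.nat 5 k) ∧
    seg (s'.nat 5) lo t ++ mergeBy le (seg A i mid) (seg A j hi) =
      mergeBy le (seg A lo mid) (seg A mid hi) ∧
    (cmp.cost + 100) * (hi - t) + 10 ≤ c) ?_ ?_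
  · refine ⟨lo, mid, lo, h7, h8, h9, le_rfl, h1, le_rfl, h2, by omega, fun _ _ _ => rfl,
      fun _ _ => rfl, ?_, le_rfl⟩
    rw [seg_eq_nil le_rfl, List.nil_append]
  · rintro s' c hs ⟨i, j, t, hi', hj', ht', hlt, him, hmj, hjh, htij, hk, hb, hseg, hc⟩
    have h6 : s'.nat 3 6 = hi := (hk 6 (by omega) (by omega)).trans hhi.symm
    have h5 : s'.nat 3 5 = mid := (hk 5 (by omega) (by omega)).trans hmid.symm
    have h4 : s'.nat 4 = A := (hs.nat 4 (by rw [mergeStep_writes]; omega)).trans hA.symm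
    refine ⟨by simp; omega, fun hg => ?_, fun hg => ?_⟩
    · have ht : t < hi := by simpa [h6, ht'] using hg
      obtain ⟨q, hq⟩ : ∃ q, hi - t = q + 1 := ⟨hi - t - 1, by omega⟩
      rw [hq] at hc
      have hq' : hi - (t + 1) = q := by omega
      have hcc : (cmp.cost + 100) * (q + 1) = (cmp.cost + 100) * q + cmp.cost + 100 := by ring
      -- Both front elements are loaded before the test, even if a block is exhausted. The value of
      -- `cmp` is then irrelevant, because the index tests decide.
      have hdd := hd ((s'.setNat 3 0 (A i)).setNat 3 1 (A j))
        (fun a h3 h4 h5 => by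
          simp only [ne_eq, h3, not_false_eq_true, State.setNat_nat_ne]
          exact hs.nat a (by rw [mergeStep_writes]; omega))
        (by simpa using funext fun a => hs.real a mergeStep_writesReal)
      simp at hdd
      simp [mergeStep, h4, hi', hj', ht', h5, h6, Function.update_apply, hdd, hq']
      refine ⟨by omega, by omega, by omega, ?_, ?_⟩
      · intro hlt' hor
        refine ⟨by omega, by omega, by omega, by omega, by omega, by omega, by omega, by omega, ?_, ?_, ?_, by omega⟩
        · intro k h7k h2k
          simpa [show k ≠ 9 by omega, show k ≠ 7 by omega, show k ≠ 1 by omega, show k ≠ 0 by omega]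
            using hk k h7k h2k
        · intro k hklo
          rw [if_neg (by omega)]
          exact hb k hklo
        · rw [seg_update_succ hlt, ← hseg, List.append_assoc]
          congr 1
          rw [seg_cons hlt']
          rcases Nat.lt_or_ge j hi with hjlt | hjge
          · rw [seg_cons hjlt, mergeBy_cons_of_le (hor hjlt)]; rfl
          · rw [seg_eq_nil hjge, mergeBy_nil_right, mergeBy_nil_right]; rfl
      · intro hor
        have hj : j < hi := by
          by_contra hcon
          have h1 := (hor (by omega)).1
          omega
        refine ⟨by omega, by omega, by omega, by omega, by omega, by omega, by omega, by omega, ?_, ?_, ?_, by omega⟩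
        · intro k h7k h2k
          simpa [show k ≠ 9 by omega, show k ≠ 8 by omega, show k ≠ 1 by omega, show k ≠ 0 by omega]
            using hk k h7k h2k
        · intro k hklo
          rw [if_neg (by omega)]
          exact hb k hklo
        · rw [seg_update_succ hlt, ← hseg, List.append_assoc]
          congr 1
          rw [seg_cons hj]
          rcases Nat.lt_or_ge i mid with hilt | hige
          · rw [seg_cons hilt, mergeBy_cons_of_not_le (hor hilt).2]; rfl
          · rw [seg_eq_nil hige, mergeBy_nil_left, mergeBy_nil_left]; rfl
    · have ht : hi ≤ t := by simpa [h6, ht'] using hg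
      have e1 : t = hi := by omega
      have e2 : i = mid := by omega
      have e3 : j = hi := by omega
      rw [e1, e2, e3] at hseg
      refine ⟨hk, hb, ?_⟩
      rwa [seg_eq_nil (f := A) le_rfl, seg_eq_nil (f := A) le_rfl, mergeBy_nil_left, List.append_nil] at hseg

end sort
end RealRAM

namespace RealRAM
section sort
variable {le : ℕ → ℕ → Prop} {cmp : BExp}

/-- Determine the next two adjacent blocks and merge them. -/
def passStep (cmp : BExp) : Prog :=
  sset 5 (.add (sv 4) (sv 3)) ;;
  .ite (.nle (sv 2) (sv 5)) (sset 5 (sv 2)) .skip ;;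
  sset 6 (.add (sv 5) (sv 3)) ;;
  .ite (.nle (sv 2) (sv 6)) (sset 6 (sv 2)) .skip ;;
  sset 7 (sv 4) ;; sset 8 (sv 5) ;; sset 9 (sv 4) ;;
  mergeLoop cmp ;; sset 4 (sv 6)

/-- Merge all pairs of adjacent blocks. -/
def passLoop (cmp : BExp) : Prog := .while (.nlt (sv 4) (sv 2)) (passStep cmp)

/-- Copy the merged blocks back. -/
def copyLoop : Prog :=
  .while (.nlt (sv 9) (sv 2)) (.nset 4 (sv 9) (.read 5 (sv 9)) ;; sset 9 (.add (sv 9) (.lit 1)))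

/-- Initialize the permutation. -/
def initLoop : Prog :=
  .while (.nlt (sv 9) (sv 2)) (.nset 4 (sv 9) (sv 9) ;; sset 9 (.add (sv 9) (.lit 1)))

/-- One round of bottom-up merge sort. -/
def sortStep (cmp : BExp) : Prog :=
  sset 4 (.lit 0) ;; passLoop cmp ;; sset 9 (.lit 0) ;; copyLoop ;; sset 3 (.add (sv 3) (sv 3))

/-- Bottom-up merge sort of `0, …, N - 1`, where `N` is variable `2`, by the order that `cmp`
decides.  The result is the fourth array of naturals. -/
def sortProg (cmp : BExp) : Prog :=
  sset 9 (.lit 0) ;; initLoop ;; sset 3 (.lit 1) ;; .while (.nlt (sv 3) (sv 2)) (sortStep cmp)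

theorem mergeLoop_writes {a : ℕ} : (mergeLoop cmp).WritesNat a ↔ a = 3 ∨ a = 5 :=
  mergeStep_writes

theorem passStep_writes {a : ℕ} : (passStep cmp).WritesNat a ↔ a = 3 ∨ a = 5 := by
  simp [passStep, mergeLoop_writes]; omega

theorem passStep_writesReal {a : ℕ} : ¬ (passStep cmp).WritesReal a := by
  simp [passStep, mergeLoop, mergeStep_writesReal]

theorem sortStep_writes {a : ℕ} : (sortStep cmp).WritesNat a ↔ a = 3 ∨ a = 4 ∨ a = 5 := by
  simp [sortStep, passLoop, passStep_writes, copyLoop]; omega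

theorem sortStep_writesReal {a : ℕ} : ¬ (sortStep cmp).WritesReal a := by
  simp [sortStep, passLoop, passStep_writesReal, copyLoop]

theorem sortProg_writes {a : ℕ} : (sortProg cmp).WritesNat a ↔ a = 3 ∨ a = 4 ∨ a = 5 := by
  simp [sortProg, sortStep_writes, initLoop]; omega

theorem sortProg_writesReal {a : ℕ} : ¬ (sortProg cmp).WritesReal a := by
  simp [sortProg, sortStep_writesReal, initLoop]

/-- The blocks of length `w` of the first `n` cells of an array are sorted. -/
def BlocksSorted (le : ℕ → ℕ → Prop) (A : ℕ → ℕ) (w n : ℕ) : Prop :=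
  ∀ k i j, k * w ≤ i → i < j → j < k * w + w → j < n → le (A i) (A j)

/-- Pairs of indices below `lo` are settled by `hB`. Any other pair inside one doubled block lies in
the block just merged, which consists of the old blocks `2k` and `2k + 1`, truncated at `N`. -/
theorem BlocksSorted.merge (tr : ∀ a b c, le a b → le b c → le a c)
    (tot : ∀ a b, le a b ∨ le b a) {A B B' : ℕ → ℕ} {w N k lo mid hi : ℕ}
    (hA : BlocksSorted le A w N) (hB : BlocksSorted le B (w + w) lo)
    (hlo : lo = k * (w + w)) (hmid : mid = min (lo + w) N) (hhi : hi = min (mid + w) N)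
    (hB' : ∀ i, i < lo → B' i = B i)
    (hm : seg B' lo hi = mergeBy le (seg A lo mid) (seg A mid hi)) :
    BlocksSorted le B' (w + w) hi := by
  intro k' i j h1 h2 h3 h4
  rcases Nat.lt_or_ge j lo with hj | hj
  · rw [hB' i (by omega), hB' j hj]
    exact hB k' i j h1 h2 h3 hj
  · have e1 : k ≤ k' := by
      by_contra hc
      have : (k' + 1) * (w + w) ≤ k * (w + w) := Nat.mul_le_mul_right _ (by omega)
      rw [Nat.succ_mul] at this
      omega
    have h5 : k * (w + w) ≤ k' * (w + w) := Nat.mul_le_mul_right _ e1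
    have h6 : (seg B' lo hi).Pairwise le := by
      rw [hm]
      refine pairwise_mergeBy tr tot ?_ ?_
      · rw [pairwise_seg]
        intro a b ha hab hb
        refine hA (2 * k) a b ?_ hab ?_ (by omega)
        · rw [show 2 * k * w = k * (w + w) by ring]; omega
        · rw [show 2 * k * w = k * (w + w) by ring]; omega
      · rw [pairwise_seg]
        intro a b ha hab hb
        refine hA (2 * k + 1) a b ?_ hab ?_ (by omega)
        · rw [show (2 * k + 1) * w = k * (w + w) + w by ring]; omega
        · rw [show (2 * k + 1) * w = k * (w + w) + w by ring]; omega
    rw [pairwise_seg] at h6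
    exact h6 i j (by omega) h2 h4

theorem passLoop_runs (tr : ∀ a b c, le a b → le b c → le a c)
    (tot : ∀ a b, le a b ∨ le b a) {s : State} (hd : Decides cmp le s)
    {N w : ℕ} (hN : s.nat 3 2 = N) (hw : s.nat 3 3 = w) (hw0 : 0 < w) (hlo : s.nat 3 4 = 0)
    (hA : BlocksSorted le (s.nat 4) w N) :
    Runs (passLoop cmp) s ((cmp.cost + 200) * N + 10) fun s' =>
      s'.nat 3 2 = N ∧ s'.nat 3 3 = w ∧ BlocksSorted le (s'.nat 5) (w + w) N ∧
      (seg (s'.nat 5) 0 N).Perm (seg (s.nat 4) 0 N) := by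
  unfold Runs passLoop
  -- The position `lo` is a multiple of `2w` except after a truncated last block, where it is `N`.
  obtain ⟨Inv, hInv⟩ : ∃ Inv : State → ℕ → Prop, ∀ s' c, Inv s' c ↔
    ∃ lo k, s'.nat 3 2 = N ∧ s'.nat 3 3 = w ∧ s'.nat 3 4 = lo ∧
    (lo = k * (w + w) ∨ lo = N) ∧ lo ≤ N ∧
    BlocksSorted le (s'.nat 5) (w + w) lo ∧ (seg (s'.nat 5) 0 lo).Perm (seg (s.nat 4) 0 lo) ∧
    (cmp.cost + 200) * (N - lo) + 10 ≤ c := ⟨_, fun _ _ => Iff.rfl⟩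
  refine wp_while Inv ?_ ?_
  · rw [hInv]
    refine ⟨0, 0, hN, hw, hlo, by simp, by simp, ?_, ?_, le_rfl⟩
    · intro k i j _ _ _ h; omega
    · simp [seg]
  · intro s' c hs hI
    obtain ⟨lo, k, h2, h3, h4, hk, hloN, hB, hP, hc⟩ := (hInv _ _).1 hI
    have hA4 : s'.nat 4 = s.nat 4 := hs.nat 4 (by rw [passStep_writes]; omega)
    refine ⟨by simp; omega, fun hg => ?_, fun hg => ?_⟩
    · have hlt : lo < N := by simpa [h2, h4] using hg
      have hk' : lo = k * (w + w) := by omega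
      obtain ⟨mid, hmid⟩ : ∃ mid, mid = min (lo + w) N := ⟨_, rfl⟩
      obtain ⟨hi, hhi⟩ : ∃ hi, hi = min (mid + w) N := ⟨_, rfl⟩
      -- The two truncations of block ends at `N` produce four branches; this common continuation
      -- serves all of them.
      have hrun : ∀ s₁ : State, ∀ c₁, (∀ a, a ≠ 3 → s₁.nat a = s'.nat a) → s₁.real = s'.real →
          s₁.nat 3 2 = N → s₁.nat 3 3 = w → s₁.nat 3 4 = lo → s₁.nat 3 5 = mid →
          s₁.nat 3 6 = hi → s₁.nat 3 7 = lo → s₁.nat 3 8 = mid → s₁.nat 3 9 = lo →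
          (cmp.cost + 100) * (hi - lo) + 20 + ((cmp.cost + 200) * (N - hi) + 10) ≤ c₁ →
          wp (mergeLoop cmp) (wp (sset 4 (sv 6)) Inv) s₁ c₁ := by
        intro s₁ c₁ ha hr h2 h3 h4 h5 h6 h7 h8 h9 hc₁
        have hd₁ : Decides cmp le s₁ := by
          refine (hd.same hs ?_ ?_).congr (fun a h3 _ _ => ha a h3) hr
          · intro a; rw [passStep_writes]; omega
          · intro a; exact passStep_writesReal
        have hR := mergeLoop_runs hd₁ (by omega) (by omega) (by omega) (by omega) (by omega)
        rw [h4, h6] at hR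
        refine hR.wp (by omega) ?_
        rintro s₂ c₂ - ⟨r1, r2, r3⟩ hc₂
        rw [h5] at r3
        rw [ha 5 (by omega)] at r2
        rw [ha 4 (by omega), hA4] at r3
        simp [hInv, r1 2, r1 3, r1 6, h2, h3, h6]
        refine ⟨by omega, ?_, by omega, ?_, ?_, by omega⟩
        · rcases Nat.lt_or_ge hi N with h | h
          · exact ⟨k + 1, .inl (by rw [Nat.succ_mul]; omega)⟩
          · exact ⟨0, .inr (by omega)⟩
        · exact hA.merge tr tot hB hk' hmid hhi r2 r3
        · rw [← seg_append (Nat.zero_le lo) (show lo ≤ hi by omega),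
            ← seg_append (f := s.nat 4) (Nat.zero_le lo) (show lo ≤ hi by omega)]
          refine List.Perm.append ?_ ?_
          · rwa [seg_congr fun i _ hi => r2 i hi]
          · rw [r3, ← seg_append (f := s.nat 4) (show lo ≤ mid by omega) (show mid ≤ hi by omega)]
            exact mergeBy_perm _ _
      -- Each element carries 100 credits beyond the cost of merging it. As `lo < hi`, this surplus
      -- pays for the bookkeeping of the pass.
      have hcc : (cmp.cost + 200) * (N - lo) =
          (cmp.cost + 200) * (N - hi) + (cmp.cost + 100) * (hi - lo) + 100 * (hi - lo) := by
        rw [show N - lo = N - hi + (hi - lo) by omega]; ring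
      have hpos : 1 ≤ hi - lo := by omega
      simp [passStep, h2, h3, h4]
      repeat' first | apply And.intro | intro
      any_goals omega
      all_goals apply hrun <;> (try simp +contextual [h2, h3, h4]) <;> omega
    · have hge : N ≤ lo := by simpa [h2, h4] using hg
      obtain rfl : lo = N := by omega
      exact ⟨h2, h3, hB, hP⟩

theorem initLoop_runs {s : State} {N : ℕ} (hN : s.nat 3 2 = N) (h9 : s.nat 3 9 = 0) :
    Runs initLoop s (50 * N + 10) fun s' =>
      s'.nat 3 2 = N ∧ ∀ k, k < N → s'.nat 4 k = k := by
  unfold Runs initLoop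
  refine wp_while (fun s' c => ∃ t, s'.nat 3 2 = N ∧ s'.nat 3 9 = t ∧ t ≤ N ∧
    (∀ k, k < t → s'.nat 4 k = k) ∧ 50 * (N - t) + 10 ≤ c) ?_ ?_
  · exact ⟨0, hN, h9, by omega, by omega, by omega⟩
  · rintro s' c - ⟨t, h2, h9, ht, hk, hc⟩
    refine ⟨by simp; omega, fun hg => ?_, fun hg => ?_⟩ <;> simp [h2, h9] at hg
    · simp [h2, h9, Function.update_apply]
      refine ⟨by omega, by omega, by omega, fun k hk' => ?_, by omega⟩
      by_cases h : k = t
      · simp [h]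
      · simpa [h] using hk k (by omega)
    · obtain rfl : t = N := by omega
      exact ⟨h2, hk⟩

theorem copyLoop_runs {s : State} {N : ℕ} (hN : s.nat 3 2 = N) (h9 : s.nat 3 9 = 0) :
    Runs copyLoop s (50 * N + 10) fun s' =>
      s'.nat 3 2 = N ∧ s'.nat 3 3 = s.nat 3 3 ∧ ∀ k, k < N → s'.nat 4 k = s.nat 5 k := by
  unfold Runs copyLoop
  refine wp_while (fun s' c => ∃ t, s'.nat 3 2 = N ∧ s'.nat 3 3 = s.nat 3 3 ∧ s'.nat 3 9 = t ∧
    t ≤ N ∧ (∀ k, k < t → s'.nat 4 k = s.nat 5 k) ∧ 50 * (N - t) + 10 ≤ c) ?_ ?_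
  · exact ⟨0, hN, rfl, h9, by omega, by omega, by omega⟩
  · rintro s' c hs ⟨t, h2, h3, h9, ht, hk, hc⟩
    have h5 : s'.nat 5 = s.nat 5 := hs.nat 5 (by simp)
    refine ⟨by simp; omega, fun hg => ?_, fun hg => ?_⟩ <;> simp [h2, h9] at hg
    · simp [h2, h9, h3, h5, Function.update_apply]
      refine ⟨by omega, by omega, by omega, fun k hk' => ?_, by omega⟩
      by_cases h : k = t
      · simp [h]
      · simpa [h] using hk k (by omega)
    · obtain rfl : t = N := by omega
      exact ⟨h2, h3, hk⟩

/-- Merge sort is correct and takes time `O(N log N)`. -/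
theorem sortProg_runs (tr : ∀ a b c, le a b → le b c → le a c)
    (tot : ∀ a b, le a b ∨ le b a) {s : State} (hd : Decides cmp le s)
    {N : ℕ} (hN : s.nat 3 2 = N) :
    Runs (sortProg cmp) s ((cmp.cost + 400) * (N + 1) * (Nat.clog 2 N + 1)) fun s' =>
      (seg (s'.nat 4) 0 N).Pairwise le ∧ (seg (s'.nat 4) 0 N).Perm (List.range N) := by
  -- `K` pays for one round. The width doubles, so `clog 2 N` rounds suffice; one further `K` covers
  -- the initialization and the last test.
  obtain ⟨K, hK⟩ : ∃ K, K = (cmp.cost + 400) * (N + 1) := ⟨_, rfl⟩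
  have hK' : (cmp.cost + 200) * N + 10 + 50 * N + 100 ≤ K := by rw [hK]; nlinarith
  have hK2 : 50 * N + 100 ≤ K := by omega
  rw [← hK, Nat.mul_add, Nat.mul_one]
  unfold Runs sortProg
  simp only [wp_seq, wp_nset]
  refine ⟨by simp; omega, ?_⟩
  refine (initLoop_runs (N := N) (by simpa using hN) (by simp)).wp (by simp; omega) ?_
  rintro s₁ c₁ hs₁ ⟨h2, hk⟩ hc₁
  simp at hc₁
  simp only [wp_seq, wp_nset]
  refine ⟨by simp; omega, ?_⟩
  refine wp_while (fun s' c => ∃ p, s'.nat 3 2 = N ∧ s'.nat 3 3 = 2 ^ p ∧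
    BlocksSorted le (s'.nat 4) (2 ^ p) N ∧ (seg (s'.nat 4) 0 N).Perm (List.range N) ∧
    K * (Nat.clog 2 N - p) + 10 ≤ c) ?_ ?_
  · refine ⟨0, by simpa using h2, by simp, ?_, ?_, by simp; omega⟩
    · intro k i j h1 h2 h3 _; omega
    · simp only [ne_eq, Nat.reduceEqDiff, not_false_eq_true, State.setNat_nat_ne]
      rw [seg_congr (g := fun k => k) fun i _ hi => hk i hi]
      simp [seg, List.range_eq_range']
  · rintro s₂ c₂ hs₂ ⟨p, h2, h3, hB, hP, hc⟩
    refine ⟨by simp; omega, fun hg => ?_, fun hg => ?_⟩ <;> simp [h2, h3] at hg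
    · have hp : p < Nat.clog 2 N := (Nat.lt_clog_iff_pow_lt (by norm_num)).2 hg
      have hcc : K * (Nat.clog 2 N - p) = K * (Nat.clog 2 N - (p + 1)) + K := by
        rw [show Nat.clog 2 N - p = Nat.clog 2 N - (p + 1) + 1 by omega]; ring
      have hd₂ : Decides cmp le s₂ := by
        refine ((hd.congr (fun a h3 h4 h5 => ?_) ?_).same hs₂ ?_ ?_)
        · simp only [ne_eq, h3, not_false_eq_true, State.setNat_nat_ne]
          rw [hs₁.nat a (by simp [initLoop]; omega)]
          simp [h3]
        · simp only [State.setNat_real]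
          funext a
          rw [hs₁.real a (by simp [initLoop])]
          simp
        · intro a; rw [sortStep_writes]; exact id
        · intro a; exact sortStep_writesReal
      unfold sortStep
      simp only [wp_seq, wp_nset]
      refine ⟨by simp; omega, ?_⟩
      refine (passLoop_runs tr tot (N := N) (w := 2 ^ p) (hd₂.congr (by simp +contextual) (by simp))
        (by simpa using h2) (by simpa using h3) (by positivity) (by simp) (by simpa using hB)).wp
        (by simp; omega) ?_
      rintro s₃ c₃ - ⟨r2, r3, rB, rP⟩ hc₃
      simp at hc₃ rP
      simp only [wp_seq, wp_nset]
      refine ⟨by simp; omega, ?_⟩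
      refine (copyLoop_runs (N := N) (by simpa using r2) (by simp)).wp (by simp; omega) ?_
      rintro s₄ c₄ - ⟨q2, q3, q4⟩ hc₄
      simp at hc₄ q3 q4
      simp only [wp_nset]
      refine ⟨by simp; omega, p + 1, by simpa using q2, ?_, ?_, ?_, by simp; omega⟩
      · simp [q3, r3]; ring
      · simp only [ne_eq, Nat.reduceEqDiff, not_false_eq_true, State.setNat_nat_ne]
        intro k i j h1 h2 h3 h4
        rw [q4 i (by omega), q4 j h4]
        rw [pow_succ, mul_two] at h1 h3
        exact rB k i j h1 h2 h3 h4
      · simp only [ne_eq, Nat.reduceEqDiff, not_false_eq_true, State.setNat_nat_ne]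
        rw [seg_congr fun i _ hi => q4 i hi]
        exact rP.trans hP
    · refine ⟨?_, hP⟩
      rw [pairwise_seg]
      intro i j _ hij hj
      exact hB 0 i j (by omega) hij (by omega) hj

end sort
end RealRAM

/-! ## Disks as functions on the axis -/

section geometry

/-- The power of the point of abscissa `x` on the axis, up to sign: the square of the height at
which the vertical line at `x` leaves the disk with centre `c` and radius `r`. -/
def discHeight (c r x : ℝ) : ℝ := r * r - (x - c) * (x - c)

namespace LineDiskInstance
variable {n m : ℕ} (I : LineDiskInstance n m)

theorem mem_disk_iff (i : Fin n) (k : Fin m) :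
    I.point i ∈ I.disk k ↔
      I.point i 1 * I.point i 1 ≤ discHeight (I.center k) (I.radius k) (I.point i 0) := by
  have hr := (I.radius_pos k).le
  rw [disk, Metric.mem_closedBall, EuclideanSpace.dist_eq, Real.sqrt_le_left hr]
  simp [Fin.sum_univ_two, Real.dist_eq, sq_abs, discHeight]
  constructor <;> intro h <;> nlinarith

theorem toArray_coe {N : ℕ} (f : Fin N → ℝ) (i : Fin N) : toArray f i = f i := by
  simp [toArray]

/-- Point `i` lies in disk `k`, in terms of the input arrays. -/
def CoversAt (k i : ℕ) : Prop :=
  I.input.real 1 i * I.input.real 1 i ≤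
    discHeight (I.input.real 2 k) (I.input.real 3 k) (I.input.real 0 i)

theorem coversAt_iff (i : Fin n) (k : Fin m) : I.CoversAt k i ↔ I.point i ∈ I.disk k := by
  rw [mem_disk_iff]
  simp [CoversAt, input, toArray_coe]

/-- The indices in `T` describe a cover. -/
def CoversIdx (T : Finset ℕ) : Prop := ∀ i < n, ∃ k ∈ T, I.CoversAt k i

theorem coversIdx_map {T : Finset (Fin m)} :
    I.CoversIdx (T.map Fin.valEmbedding) ↔ I.Covers T := by
  constructor
  · intro h i
    obtain ⟨k, hk, hc⟩ := h i i.2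
    obtain ⟨k, hk', rfl⟩ := Finset.mem_map.1 hk
    exact ⟨k, hk', (I.coversAt_iff i k).1 hc⟩
  · intro h i hi
    obtain ⟨k, hk, hc⟩ := h ⟨i, hi⟩
    exact ⟨k, Finset.mem_map_of_mem _ hk, (I.coversAt_iff ⟨i, hi⟩ k).2 hc⟩

theorem sum_map_weight (T : Finset (Fin m)) :
    ∑ k ∈ T.map Fin.valEmbedding, I.input.real 4 k = ∑ k ∈ T, I.weight k := by
  rw [Finset.sum_map]
  refine Finset.sum_congr rfl fun k _ => ?_
  simp [input, toArray_coe]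

theorem map_subset_range (T : Finset (Fin m)) : T.map Fin.valEmbedding ⊆ Finset.range m := by
  intro k hk
  obtain ⟨k, _, rfl⟩ := Finset.mem_map.1 hk
  simp

theorem coversIdx_range (h : I.Covers Finset.univ) : I.CoversIdx (Finset.range m) := by
  intro i hi
  obtain ⟨k, hk, hc⟩ := I.coversIdx_map.2 h i hi
  exact ⟨k, map_subset_range _ hk, hc⟩

theorem weight_nonneg_idx (k : ℕ) : 0 ≤ I.input.real 4 k := by
  simp only [input, toArray]
  split_ifs with h
  · exact (I.weight_pos _).le
  · exact le_rfl

/-- The programs handle bare natural numbers as indices; this is the passage back to sets of disks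
indexed by `Fin m`. -/
theorem isOptimal_output {s : RealRAM.State} {D : Finset ℕ} (hD : D ⊆ Finset.range m)
    (hs : ∀ k < m, (s.nat 1 k = 1 ↔ k ∈ D)) (hc : I.CoversIdx D)
    (ho : ∀ T ⊆ Finset.range m, I.CoversIdx T →
      ∑ k ∈ D, I.input.real 4 k ≤ ∑ k ∈ T, I.input.real 4 k) :
    I.IsOptimal (output m s) := by
  have e : (output m s).map Fin.valEmbedding = D := by
    ext k
    simp only [output, Finset.mem_map, Finset.mem_filter, Finset.mem_univ, true_and,
      Fin.valEmbedding_apply]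
    constructor
    · rintro ⟨a, ha, rfl⟩; exact (hs a a.2).1 ha
    · intro hk
      have := Finset.mem_range.1 (hD hk)
      exact ⟨⟨k, this⟩, (hs k this).2 hk, rfl⟩
  refine ⟨I.coversIdx_map.1 (e ▸ hc), fun T' hT' => ?_⟩
  rw [← sum_map_weight, ← sum_map_weight, e]
  exact ho _ (map_subset_range _) (I.coversIdx_map.2 hT')

end LineDiskInstance

/-- If a disk is at least as high as another one at `x` but strictly lower at some `x' ≤ x`, then
its centre lies strictly to the right. -/
theorem center_lt_of_discHeight {c r c' r' x x' : ℝ} (hx : x' ≤ x)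
    (h : discHeight c' r' x ≤ discHeight c r x) (h' : discHeight c r x' < discHeight c' r' x') :
    c' < c := by
  unfold discHeight at h h'
  by_contra hc
  -- The difference of the heights of the two disks changes by `2 (c - c') (x - x')` from `x'` to
  -- `x`, and it rises from a negative to a nonnegative value.
  nlinarith [mul_nonneg (sub_nonneg.2 hx) (sub_nonneg.2 (not_lt.1 hc))]

end geometry

/-! ## Chains of disks by runs of consecutive points -/

section runs

/-- `s` is the beginning of the maximal run of indices `i ≤ j` with `cov k i` that ends in `j`,
where indices start from `1`, and `s = 0` if there is no such run. -/
def RunStart (cov : ℕ → ℕ → Prop) (k j s : ℕ) : Prop :=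
  (s = 0 ∧ (j = 0 ∨ ¬ cov k j)) ∨
    (1 ≤ s ∧ s ≤ j ∧ (∀ i, s ≤ i → i ≤ j → cov k i) ∧ (s = 1 ∨ ¬ cov k (s - 1)))

variable {cov : ℕ → ℕ → Prop} {k j s : ℕ}

theorem RunStart.unique {s' : ℕ} (h : RunStart cov k j s) (h' : RunStart cov k j s') : s = s' := by
  rcases h with ⟨h1, h2⟩ | ⟨h1, h2, h3, h4⟩ <;> rcases h' with ⟨g1, g2⟩ | ⟨g1, g2, g3, g4⟩
  · omega
  · rcases h2 with h2 | h2
    · omega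
    · exact absurd (g3 j g2 le_rfl) h2
  · rcases g2 with g2 | g2
    · omega
    · exact absurd (h3 j h2 le_rfl) g2
  · rcases Nat.lt_trichotomy s s' with h | h | h
    · rcases g4 with g4 | g4
      · omega
      · exact absurd (h3 _ (by omega) (by omega)) g4
    · exact h
    · rcases h4 with h4 | h4
      · omega
      · exact absurd (g3 _ (by omega) (by omega)) h4

theorem RunStart.succ (h : RunStart cov k j s) (hc : cov k (j + 1)) :
    RunStart cov k (j + 1) (if s = 0 then j + 1 else s) := by
  right
  rcases h with ⟨h1, h2⟩ | ⟨h1, h2, h3, h4⟩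
  · rw [if_pos h1]
    refine ⟨by omega, le_rfl, fun i h h' => ?_, ?_⟩
    · obtain rfl : i = j + 1 := by omega
      exact hc
    · rcases h2 with h2 | h2
      · exact .inl (by omega)
      · exact .inr h2
  · rw [if_neg (by omega)]
    refine ⟨h1, by omega, fun i h h' => ?_, h4⟩
    rcases Nat.lt_or_ge j i with hi | hi
    · obtain rfl : i = j + 1 := by omega
      exact hc
    · exact h3 i h hi

theorem RunStart.succ_not (hc : ¬ cov k (j + 1)) : RunStart cov k (j + 1) 0 :=
  .inl ⟨rfl, .inr hc⟩

theorem RunStart.exists (j : ℕ) : ∃ s, RunStart cov k j s := by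
  induction j with
  | zero => exact ⟨0, .inl ⟨rfl, .inl rfl⟩⟩
  | succ j ih =>
    obtain ⟨s, hs⟩ := ih
    by_cases h : cov k (j + 1)
    · exact ⟨_, hs.succ h⟩
    · exact ⟨0, .succ_not h⟩

/-- `f j` is the least cost of a chain of runs for the first `j` indices; the last run of an
optimal chain belongs to `ch j - 1` and begins after `pr j`. -/
structure IsChainOpt (cov : ℕ → ℕ → Prop) (W : ℕ → ℝ) (m : ℕ) (f : ℕ → ℝ) (ch pr : ℕ → ℕ)
    (k j : ℕ) : Prop where
  ch_pos : 0 < ch j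
  ch_le : ch j ≤ m
  pr_lt : pr j < j
  run : ∀ i, pr j < i → i ≤ j → cov (ch j - 1) i
  eq : f j = f (pr j) + W (ch j - 1)
  le : ∀ k' < k, ∀ s, RunStart cov k' j s → 0 < s → f j ≤ f (s - 1) + W k'

theorem IsChainOpt.congr {W : ℕ → ℝ} {m : ℕ} {f f' : ℕ → ℝ} {ch ch' pr pr' : ℕ → ℕ}
    (h : IsChainOpt cov W m f ch pr k j) (hf : ∀ i ≤ j, f' i = f i) (hch : ch' j = ch j)
    (hpr : pr' j = pr j) : IsChainOpt cov W m f' ch' pr' k j where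
  ch_pos := hch ▸ h.ch_pos
  ch_le := hch ▸ h.ch_le
  pr_lt := hpr ▸ h.pr_lt
  run := by rw [hch, hpr]; exact h.run
  eq := by rw [hch, hpr, hf j le_rfl, hf _ h.pr_lt.le]; exact h.eq
  le k' hk s hs h0 := by
    have : s ≤ j := by
      rcases hs with hs | hs <;> omega
    rw [hf j le_rfl, hf _ (by omega)]
    exact h.le k' hk s hs h0

/-- Every cover costs at least as much as the best chain of runs. -/
theorem chain_le_sum {W f C R X Y : ℕ → ℝ} {m n : ℕ} {ch pr : ℕ → ℕ} (hW : ∀ k, 0 ≤ W k)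
    (hX : ∀ i j, 1 ≤ i → i < j → j ≤ n → X i ≤ X j) (hn : 0 < n) (hf0 : f 0 = 0)
    (hcov : ∀ k i, cov k i ↔ Y i * Y i ≤ discHeight (C k) (R k) (X i))
    (hf : ∀ j, 1 ≤ j → j ≤ n → IsChainOpt cov W m f ch pr m j)
    {T : Finset ℕ} (hT : T ⊆ Finset.range m) (hTc : ∀ i, 1 ≤ i → i ≤ n → ∃ k ∈ T, cov k i) :
    f n ≤ ∑ k ∈ T, W k := by
  have top : ∀ i, 1 ≤ i → i ≤ n → ∃ k ∈ T, cov k i ∧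
      ∀ l ∈ T, discHeight (C l) (R l) (X i) ≤ discHeight (C k) (R k) (X i) := by
    intro i h1 h2
    obtain ⟨l, hl, hc⟩ := hTc i h1 h2
    obtain ⟨k, hk, hmax⟩ := T.exists_max_image (fun k => discHeight (C k) (R k) (X i)) ⟨l, hl⟩
    exact ⟨k, hk, (hcov _ _).2 (((hcov _ _).1 hc).trans (hmax l hl)), hmax⟩
  -- Only the highest disk of `T` at point `j` is considered. Charging it together with all disks of
  -- `T` of smaller centre makes the induction close.
  have key : ∀ j, 1 ≤ j → j ≤ n → ∀ k ∈ T, cov k j →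
      (∀ l ∈ T, discHeight (C l) (R l) (X j) ≤ discHeight (C k) (R k) (X j)) →
      f j ≤ W k + ∑ l ∈ T with C l < C k, W l := by
    intro j
    induction j using Nat.strong_induction_on with
    | _ j ih =>
      intro h1 h2 k hk hc hmax
      obtain ⟨s, hs⟩ := RunStart.exists (cov := cov) (k := k) j
      have hs' := hs
      rcases hs with ⟨-, h | h⟩ | ⟨g1, g2, g3, g4⟩
      · omega
      · exact absurd hc h
      · have hle := (hf j h1 h2).le k (Finset.mem_range.1 (hT hk)) s hs' g1
        have : f (s - 1) ≤ ∑ l ∈ T with C l < C k, W l := by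
          by_cases hs1' : s = 1
          · simpa [hs1', hf0] using Finset.sum_nonneg fun l _ => hW l
          · have hs1 : 1 ≤ s - 1 := by omega
            replace g4 := g4.resolve_left hs1'
            obtain ⟨l, hl, hlc, hlmax⟩ := top (s - 1) hs1 (by omega)
            -- The run of `k` begins at `s`, so `k` misses point `s - 1`, while `l` contains it and
            -- is higher there. At `j` the disk `k` is at least as high as `l`. Hence `l` has the
            -- smaller centre, and everything charged to `l` is charged to disks strictly left of
            -- `k`.
            have hlt : discHeight (C k) (R k) (X (s - 1)) < discHeight (C l) (R l) (X (s - 1)) := by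
              rw [hcov] at g4 hlc
              linarith
            have hcc := center_lt_of_discHeight (hX (s - 1) j hs1 (by omega) h2) (hmax l hl) hlt
            refine (ih (s - 1) (by omega) hs1 (by omega) l hl hlc hlmax).trans ?_
            have hnot : l ∉ T.filter fun a => C a < C l := by simp
            rw [← Finset.sum_insert hnot]
            refine Finset.sum_le_sum_of_subset_of_nonneg ?_ fun i _ _ => hW i
            intro a ha
            rw [Finset.mem_insert, Finset.mem_filter] at ha
            rw [Finset.mem_filter]
            rcases ha with rfl | ⟨ha, hac⟩
            · exact ⟨hl, hcc⟩
            · exact ⟨ha, hac.trans hcc⟩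
        linarith
  obtain ⟨k, hk, hc, hmax⟩ := top n hn le_rfl
  refine (key n hn le_rfl k hk hc hmax).trans ?_
  have hnot : k ∉ T.filter fun a => C a < C k := by simp
  rw [← Finset.sum_insert hnot]
  refine Finset.sum_le_sum_of_subset_of_nonneg ?_ fun i _ _ => hW i
  intro a ha
  rw [Finset.mem_insert, Finset.mem_filter] at ha
  rcases ha with rfl | ⟨ha, -⟩ <;> assumption

end runs

section runs
variable {cov : ℕ → ℕ → Prop} {k j s m : ℕ} {W f : ℕ → ℝ} {ch pr : ℕ → ℕ}

theorem IsChainOpt.extend (h : IsChainOpt cov W m f ch pr k j)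
    (hk : ∀ s, RunStart cov k j s → 0 < s → f j ≤ f (s - 1) + W k) :
    IsChainOpt cov W m f ch pr (k + 1) j :=
  { h with
    le := fun k' hk' s hs h0 => by
      rcases Nat.lt_succ_iff_lt_or_eq.1 hk' with h' | rfl
      · exact h.le k' h' s hs h0
      · exact hk s hs h0 }

/-- The new candidate is assumed to be no worse than those of all earlier disks. Overwriting cell
`j` does not disturb any candidate, since these read `f` only at indices below `j`. -/
theorem IsChainOpt.update (hrs : RunStart cov k j s) (hs : 0 < s) (hk : k < m)
    (hle : ∀ k' < k, ∀ s', RunStart cov k' j s' → 0 < s' → f (s - 1) + W k ≤ f (s' - 1) + W k') :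
    IsChainOpt cov W m (Function.update f j (f (s - 1) + W k)) (Function.update ch j (k + 1))
      (Function.update pr j (s - 1)) (k + 1) j := by
  have hrs' := hrs
  obtain ⟨h0, -⟩ | ⟨-, h1, h2, -⟩ := hrs
  · omega
  refine ⟨by simp, by simpa using hk, by simp; omega, fun i hi hij => ?_, ?_,
    fun k' hk' s' hs' h0 => ?_⟩
  · simp at hi ⊢
    exact h2 i (by omega) hij
  · simp [show s - 1 ≠ j by omega]
  · have hs'j : s' ≤ j := by rcases hs' with h | h <;> omega
    simp only [Function.update_self, Function.update_of_ne (show s' - 1 ≠ j by omega)]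
    rcases Nat.lt_succ_iff_lt_or_eq.1 hk' with h' | rfl
    · exact hle k' h' s' hs' h0
    · rcases hs' with h | ⟨-, -, h3, h4⟩
      · omega
      · rw [RunStart.unique (.inr ⟨h0, hs'j, h3, h4⟩) hrs']

end runs

namespace RealRAM

/-! ## The quadratic-time program -/

/-- Cell `k` of the sixth array of naturals, which holds scalar variables. -/
abbrev av (k : ℕ) : NExp := .read 6 (.lit k)

/-- Assignment to a scalar variable. -/
abbrev aset (k : ℕ) (e : NExp) : Prog := .nset 6 (.lit k) e

/-- Point `p` lies in disk `k`. -/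
def coverTest (p k : NExp) : BExp :=
  .rle (.mul (.read 1 p) (.read 1 p))
    (.sub (.mul (.read 3 k) (.read 3 k))
      (.mul (.sub (.read 0 p) (.read 2 k)) (.sub (.read 0 p) (.read 2 k))))

/-- The cost of a chain that ends with the current run of disk `k`. -/
abbrev candidate : RExp := .add (.read 5 (.sub (.read 9 (av 1)) (.lit 1))) (.read 4 (av 1))

/-- Treat disk `k` at the `j`-th point. -/
def dpStep : Prog :=
  .ite (coverTest (av 2) (av 1))
    (.ite (.nle (.read 9 (av 1)) (.lit 0)) (.nset 9 (av 1) (av 0)) .skip ;;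
      .ite (.or (.nle (.read 7 (av 0)) (.lit 0)) (.rlt candidate (.read 5 (av 0))))
        (.rset 5 (av 0) candidate ;; .nset 7 (av 0) (.add (av 1) (.lit 1)) ;;
          .nset 8 (av 0) (.sub (.read 9 (av 1)) (.lit 1)))
        .skip)
    (.nset 9 (av 1) (.lit 0)) ;;
  aset 1 (.add (av 1) (.lit 1))

/-- Treat all disks at the `j`-th point. -/
def dpInner : Prog := .while (.nlt (av 1) (.read 0 (.lit 1))) dpStep

/-- One row of the table. The ninth array passes from the run starts at `j` to those at `j + 1`,
disk by disk. A chosen disk is stored as its index plus one, so that `0` in array `7` means that no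
candidate has been found yet; the cost cell is meaningful only when this entry is nonzero. -/
theorem dpInner_runs {cov : ℕ → ℕ → Prop} {s : State} {j m : ℕ} (hj : s.nat 6 0 = j + 1)
    (hk : s.nat 6 1 = 0) (hm : s.nat 0 1 = m)
    (hcov : ∀ k, cov k (j + 1) ↔ s.real 1 (s.nat 6 2) * s.real 1 (s.nat 6 2) ≤
      discHeight (s.real 2 k) (s.real 3 k) (s.real 0 (s.nat 6 2)))
    (h9 : ∀ k < m, RunStart cov k j (s.nat 9 k)) (h7 : s.nat 7 (j + 1) = 0) :
    Runs dpInner s (300 * m + 20) fun s' =>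
      s'.nat 6 0 = j + 1 ∧ (∀ k < m, RunStart cov k (j + 1) (s'.nat 9 k)) ∧
      (∀ i, i ≠ j + 1 → s'.nat 7 i = s.nat 7 i ∧ s'.nat 8 i = s.nat 8 i ∧
        s'.real 5 i = s.real 5 i) ∧
      ((∀ k < m, ¬ cov k (j + 1)) ∨
        IsChainOpt cov (s.real 4) m (s'.real 5) (s'.nat 7) (s'.nat 8) m (j + 1)) := by
  unfold Runs dpInner
  set p := s.nat 6 2 with hp
  clear_value p
  obtain ⟨Inv, hInv⟩ : ∃ Inv : State → ℕ → Prop, ∀ s' c, Inv s' c ↔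
    ∃ k, s'.nat 6 0 = j + 1 ∧ s'.nat 6 1 = k ∧ s'.nat 6 2 = p ∧ k ≤ m ∧
      (∀ k' < k, RunStart cov k' (j + 1) (s'.nat 9 k')) ∧
      (∀ k' < m, k ≤ k' → RunStart cov k' j (s'.nat 9 k')) ∧
      (∀ i, i ≠ j + 1 → s'.nat 7 i = s.nat 7 i ∧ s'.nat 8 i = s.nat 8 i ∧
        s'.real 5 i = s.real 5 i) ∧
      ((s'.nat 7 (j + 1) = 0 ∧ ∀ k' < k, ¬ cov k' (j + 1)) ∨
        IsChainOpt cov (s.real 4) m (s'.real 5) (s'.nat 7) (s'.nat 8) k (j + 1)) ∧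
      300 * (m - k) + 20 ≤ c := ⟨_, fun _ _ => Iff.rfl⟩
  refine wp_while Inv ((hInv _ _).2 ⟨0, hj, hk, hp.symm, by omega, by omega, fun k hk _ => h9 k hk,
    fun _ _ => ⟨rfl, rfl, rfl⟩, .inl ⟨h7, by omega⟩, by omega⟩) ?_
  intro s' c hs hI
  obtain ⟨k, g0, g1, g2, hkm, ha, hb, hi, hopt, hc⟩ := (hInv _ _).1 hI
  have e0 : s'.nat 0 1 = m := by rw [hs.nat 0 (by simp [dpStep]), hm]
  have r0 : s'.real 0 = s.real 0 := hs.real 0 (by simp [dpStep])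
  have r1 : s'.real 1 = s.real 1 := hs.real 1 (by simp [dpStep])
  have r2 : s'.real 2 = s.real 2 := hs.real 2 (by simp [dpStep])
  have r3 : s'.real 3 = s.real 3 := hs.real 3 (by simp [dpStep])
  have r4 : s'.real 4 = s.real 4 := hs.real 4 (by simp [dpStep])
  refine ⟨by simp; omega, fun hg => ?_, fun hg => ?_⟩ <;> simp [g1, e0] at hg
  swap
  · obtain rfl : k = m := by omega
    refine ⟨g0, ha, hi, ?_⟩
    rcases hopt with h | h
    · exact .inl h.2
    · exact .inr h
  have hct : (coverTest (av 2) (av 1)).Holds s' ↔ cov k (j + 1) := by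
    rw [hcov]
    simp [coverTest, g1, g2, r0, r1, r2, r3, discHeight]
  have hcc : (coverTest (av 2) (av 1)).cost = 31 := rfl
  rw [dpStep, wp_seq, wp_ite, hct, hcc]
  have hcc : 300 * (m - k) = 300 * (m - (k + 1)) + 300 := by omega
  refine ⟨by simp; omega, fun hcv => ?_, fun hcv => ?_⟩
  · have hrs := (hb k hg le_rfl).succ hcv
    set s1 := if s'.nat 9 k = 0 then j + 1 else s'.nat 9 k with hs1
    have hs1p : 0 < s1 := by rw [hs1]; split_ifs <;> omega
    -- The continuation after the run start `s1` is in place, shared by the branch where a new run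
    -- begins and the branch where the old one goes on.
    have key : ∀ (s₂ : State) (c₂ : ℕ), s₂.nat 6 = s'.nat 6 → s₂.nat 7 = s'.nat 7 →
        s₂.nat 8 = s'.nat 8 → s₂.real = s'.real → s₂.nat 9 = Function.update (s'.nat 9) k s1 →
        300 * (m - (k + 1)) + 150 ≤ c₂ →
        wp (.ite (.or (.nle (.read 7 (av 0)) (.lit 0)) (.rlt candidate (.read 5 (av 0))))
          (.rset 5 (av 0) candidate ;; .nset 7 (av 0) (.add (av 1) (.lit 1)) ;;
            .nset 8 (av 0) (.sub (.read 9 (av 1)) (.lit 1)))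
          .skip) (wp (aset 1 (.add (av 1) (.lit 1))) Inv) s₂ c₂ := by
      intro s₂ c₂ h6 h7 h8 hr h9 hc₂
      have hs1j : s1 ≤ j + 1 := by rcases hrs with h | h <;> omega
      have hA : ∀ k' < k + 1, RunStart cov k' (j + 1) (Function.update (s'.nat 9) k s1 k') := by
        intro k' hk'
        rcases Nat.lt_succ_iff_lt_or_eq.1 hk' with h' | rfl
        · rw [Function.update_of_ne (by omega)]
          exact ha k' h'
        · rw [Function.update_self]; exact hrs
      have hB : ∀ k' < m, k + 1 ≤ k' → RunStart cov k' j (Function.update (s'.nat 9) k s1 k') := by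
        intro k' hk' hkk
        rw [Function.update_of_ne (by omega)]
        exact hb k' hk' (by omega)
      simp [h6, h7, hr, h9, g0, g1, r4]
      refine ⟨by omega, fun hor => ⟨by omega, by omega, by omega, by omega, ?_⟩, fun hz hle => ?_⟩
      · rw [hInv]
        refine ⟨k + 1, by simp [h6, g0], by simp, by simp [h6, g2], by omega, by simpa [h9] using hA,
          by simpa [h9] using hB, fun i hi' => ?_, .inr ?_, by omega⟩
        · simpa [h7, h8, hr, hi'] using hi i hi'
        · simp only [ne_eq, Nat.reduceEqDiff, not_false_eq_true, State.setNat_nat_ne,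
            State.setNat_nat_same, State.setReal_nat, h8, h7, State.setNat_real, State.setReal_real_same, hr]
          refine IsChainOpt.update hrs hs1p hg fun k' hk' t ht ht0 => ?_
          rcases hopt with ⟨hch, hno⟩ | hopt
          · rcases ht with ⟨h1, -⟩ | ⟨-, h2, h3, -⟩
            · omega
            · exact absurd (h3 _ h2 le_rfl) (hno k' hk')
          · exact (hor (by have := hopt.ch_pos; omega)).le.trans (hopt.le k' hk' t ht ht0)
      · refine ⟨by omega, by omega, ?_⟩
        rw [hInv]
        refine ⟨k + 1, by simp [h6, g0], by simp, by simp [h6, g2], by omega, by simpa [h9] using hA,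
          by simpa [h9] using hB, by simpa [h7, h8, hr] using hi, .inr ?_, by omega⟩
        rcases hopt with ⟨hch, hno⟩ | hopt
        · omega
        · simp only [ne_eq, Nat.reduceEqDiff, not_false_eq_true, State.setNat_nat_ne, h8, h7, State.setNat_real, hr]
          refine hopt.extend fun t ht ht0 => ?_
          rwa [ht.unique hrs]
    rw [wp_seq]
    rw [wp_ite]
    refine ⟨by simp; omega, fun h0 => ?_, fun h0 => ?_⟩ <;> simp [g1] at h0
    · simp only [wp_nset]
      refine ⟨by simp; omega, key _ _ (by simp) (by simp) (by simp) (by simp) ?_ (by simp; omega)⟩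
      simp [g1, g0, hs1, h0]
    · simp only [wp_skip]
      refine ⟨by simp; omega, key _ _ rfl rfl rfl rfl ?_ (by simp; omega)⟩
      rw [hs1, if_neg (by omega), Function.update_eq_self]
  · simp [g1]
    refine ⟨by omega, by omega, ?_⟩
    rw [hInv]
    refine ⟨k + 1, by simp [g0], by simp, by simp [g2], by omega, ?_, ?_, by simpa using hi, ?_, by omega⟩
    · intro k' hk'
      rcases Nat.lt_succ_iff_lt_or_eq.1 hk' with h' | rfl
      · simpa [show k' ≠ k by omega] using ha k' h'
      · simpa using RunStart.succ_not hcv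
    · intro k' hk' hkk
      simpa [show k' ≠ k by omega] using hb k' hk' (by omega)
    · rcases hopt with ⟨hch, hno⟩ | hopt
      · left
        refine ⟨by simpa using hch, fun k' hk' => ?_⟩
        rcases Nat.lt_succ_iff_lt_or_eq.1 hk' with h' | rfl
        · exact hno k' h'
        · exact hcv
      · right
        simp only [ne_eq, Nat.reduceEqDiff, not_false_eq_true, State.setNat_nat_ne, State.setNat_real]
        exact hopt.extend fun t ht ht0 => by
          rw [ht.unique (RunStart.succ_not hcv)] at ht0; omega

end RealRAM

/-! ### The complete table and the recovery of a cover from it -/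

namespace RealRAM

/-- Treat all points. -/
def dpOuter : Prog :=
  .while (.nle (av 0) (.read 0 (.lit 0)))
    (aset 2 (.read 4 (.sub (av 0) (.lit 1))) ;; aset 1 (.lit 0) ;; dpInner ;;
      aset 0 (.add (av 0) (.lit 1)))

/-- Output the chain of runs. -/
def dpTrace : Prog :=
  .while (.nlt (.lit 0) (av 3))
    (.nset 1 (.sub (.read 7 (av 3)) (.lit 1)) (.lit 1) ;; aset 3 (.read 8 (av 3)))

theorem dpInner_writes {a : ℕ} : dpInner.WritesNat a ↔ 6 ≤ a ∧ a ≤ 9 := by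
  simp [dpInner, dpStep]; omega

theorem dpInner_writesReal {a : ℕ} : dpInner.WritesReal a ↔ a = 5 := by
  simp [dpInner, dpStep]; omega

theorem dpOuter_runs {cov : ℕ → ℕ → Prop} {s : State} {n m : ℕ} (hn : s.nat 0 0 = n)
    (hm : s.nat 0 1 = m) (hj : s.nat 6 0 = 1)
    (hcov : ∀ k j, cov k (j + 1) ↔ s.real 1 (s.nat 4 j) * s.real 1 (s.nat 4 j) ≤
      discHeight (s.real 2 k) (s.real 3 k) (s.real 0 (s.nat 4 j)))
    (h7 : ∀ i, s.nat 7 i = 0) (h9 : ∀ k < m, s.nat 9 k = 0)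
    (hex : ∀ j < n, ∃ k < m, cov k (j + 1)) :
    Runs dpOuter s ((300 * m + 100) * n + 20) fun s' =>
      s'.real 5 0 = s.real 5 0 ∧
        ∀ j, 1 ≤ j → j ≤ n → IsChainOpt cov (s.real 4) m (s'.real 5) (s'.nat 7) (s'.nat 8) m j := by
  unfold Runs dpOuter
  obtain ⟨Inv, hInv⟩ : ∃ Inv : State → ℕ → Prop, ∀ s' c, Inv s' c ↔
    ∃ j, s'.nat 6 0 = j + 1 ∧ j ≤ n ∧ (∀ k < m, RunStart cov k j (s'.nat 9 k)) ∧
      (∀ i, j < i → s'.nat 7 i = 0) ∧ s'.real 5 0 = s.real 5 0 ∧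
      (∀ i, 1 ≤ i → i ≤ j → IsChainOpt cov (s.real 4) m (s'.real 5) (s'.nat 7) (s'.nat 8) m i) ∧
      (300 * m + 100) * (n - j) + 20 ≤ c := ⟨_, fun _ _ => Iff.rfl⟩
  refine wp_while Inv ((hInv _ _).2 ⟨0, hj, by omega, fun k hk => .inl ⟨h9 k hk, .inl rfl⟩,
    fun i _ => h7 i, rfl, by omega, by simp⟩) ?_
  intro s' c hs hI
  obtain ⟨j, g0, hjn, ha, hz, h5, hopt, hc⟩ := (hInv _ _).1 hI
  have e0 : s'.nat 0 = s.nat 0 := hs.nat 0 (by simp [dpInner_writes])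
  have e4 : s'.nat 4 = s.nat 4 := hs.nat 4 (by simp [dpInner_writes])
  have r0 : ∀ a, a ≠ 5 → s'.real a = s.real a := fun a ha =>
    hs.real a (by simp [dpInner_writesReal, ha])
  refine ⟨by simp; omega, fun hg => ?_, fun hg => ?_⟩ <;> simp [g0, e0, hn] at hg
  · have hcc : (300 * m + 100) * (n - j) = (300 * m + 100) * (n - (j + 1)) + 300 * m + 100 := by
      rw [show n - j = n - (j + 1) + 1 by omega]; ring
    simp only [wp_seq, wp_nset]
    refine ⟨by simp; omega, by simp; omega, ?_⟩
    refine (dpInner_runs (cov := cov) (j := j) (m := m) (by simp [g0]) (by simp)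
      (by simp [e0, hm]) ?_ (by simpa using ha) (by simpa using hz (j + 1) (by omega))).wp
      (by simp; omega) ?_
    · intro k
      simp [g0, e4, r0, hcov]
    · rintro s₂ c₂ hs₂ ⟨q0, q9, qi, qo⟩ hc₂
      simp at qi qo hc₂
      simp only [wp_nset]
      refine ⟨by simp; omega, ?_⟩
      rw [hInv]
      have qo' : IsChainOpt cov (s.real 4) m (s₂.real 5) (s₂.nat 7) (s₂.nat 8) m (j + 1) := by
        rcases qo with h | h
        · obtain ⟨k, hk, hkc⟩ := hex j (by omega)
          exact absurd hkc (h k hk)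
        · rwa [r0 4 (by omega)] at h
      refine ⟨j + 1, by simp [q0], by omega, by simpa using q9, fun i hi => ?_, ?_, fun i h1 h2 => ?_,
        by simp; omega⟩
      · simpa [qi i (by omega)] using hz i (by omega)
      · simpa [(qi 0 (by omega)).2.2] using h5
      · simp only [ne_eq, Nat.reduceEqDiff, not_false_eq_true, State.setNat_nat_ne,
          State.setNat_real]
        rcases Nat.lt_succ_iff_lt_or_eq.1 (Nat.lt_succ_of_le h2) with h | rfl
        · exact (hopt i h1 (by omega)).congr (fun i' h' => (qi i' (by omega)).2.2)
            (qi i (by omega)).1 (qi i (by omega)).2.1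
        · exact qo'
  · obtain rfl : j = n := by omega
    exact ⟨h5, hopt⟩

/-- The predecessors decrease, so at most `n` links are followed, and their runs cover all points. A
disk may own several links of the chain but is output once; since weights are nonnegative, this can
only lower the total, whence an inequality instead of an equation. -/
theorem dpTrace_runs {cov : ℕ → ℕ → Prop} {W : ℕ → ℝ} {s : State} {n m : ℕ} (hW : ∀ k, 0 ≤ W k)
    (hv : s.nat 6 3 = n) (h1 : ∀ k, s.nat 1 k = 0) (h50 : s.real 5 0 = 0)
    (hopt : ∀ j, 1 ≤ j → j ≤ n → IsChainOpt cov W m (s.real 5) (s.nat 7) (s.nat 8) m j) :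
    Runs dpTrace s (50 * n + 20) fun s' => ∃ D ⊆ Finset.range m,
      (∀ k, s'.nat 1 k = 1 ↔ k ∈ D) ∧ (∀ i, 1 ≤ i → i ≤ n → ∃ k ∈ D, cov k i) ∧
      ∑ k ∈ D, W k ≤ s.real 5 n := by
  unfold Runs dpTrace
  refine wp_while (fun s' c => ∃ v, ∃ D ⊆ Finset.range m, s'.nat 6 3 = v ∧ v ≤ n ∧
    (∀ k, s'.nat 1 k = 1 ↔ k ∈ D) ∧ (∀ i, v < i → i ≤ n → ∃ k ∈ D, cov k i) ∧
    ∑ k ∈ D, W k + s.real 5 v ≤ s.real 5 n ∧ 50 * v + 20 ≤ c) ?_ ?_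
  · exact ⟨n, ∅, by simp, hv, le_rfl, by simp [h1], by omega, by simp, le_rfl⟩
  · rintro s' c hs ⟨v, D, hD, g3, hvn, hk, hcov, hsum, hc⟩
    have e7 : s'.nat 7 = s.nat 7 := hs.nat 7 (by simp)
    have e8 : s'.nat 8 = s.nat 8 := hs.nat 8 (by simp)
    refine ⟨by simp; omega, fun hg => ?_, fun hg => ?_⟩ <;> simp [g3] at hg
    · have ho := hopt v (by omega) hvn
      have hp := ho.pr_lt
      have hch := ho.ch_pos
      have hcl := ho.ch_le
      simp [g3, e7, e8]
      refine ⟨by omega, by omega, insert (s.nat 7 v - 1) D, ?_, by omega, fun k => ?_,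
        fun i hi hin => ?_, ?_, by omega⟩
      · rw [Finset.insert_subset_iff]
        exact ⟨Finset.mem_range.2 (by omega), hD⟩
      · rw [Function.update_apply, Finset.mem_insert]
        split_ifs with h
        · simp [h]
        · simp [h, hk]
      · rcases Nat.lt_or_ge v i with h | h
        · obtain ⟨k, hkD, hkc⟩ := hcov i h hin
          exact ⟨k, Finset.mem_insert_of_mem hkD, hkc⟩
        · exact ⟨_, Finset.mem_insert_self _ _, ho.run i hi h⟩
      · have h2 : ∑ k ∈ insert (s.nat 7 v - 1) D, W k ≤ W (s.nat 7 v - 1) + ∑ k ∈ D, W k := by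
          by_cases h : s.nat 7 v - 1 ∈ D
          · rw [Finset.insert_eq_of_mem h]
            linarith [hW (s.nat 7 v - 1)]
          · rw [Finset.sum_insert h]
        linarith [ho.eq]
    · subst hg
      refine ⟨D, hD, hk, fun i h1 h2 => hcov i h1 h2, ?_⟩
      rwa [h50, add_zero] at hsum

/-- The test that orders points by abscissa. -/
def pointCmp : BExp := .rle (.read 0 (sv 0)) (.read 0 (sv 1))

/-- The program that treats every disk at every point. -/
def quadraticProg : Prog :=
  sset 2 (.read 0 (.lit 0)) ;; sortProg pointCmp ;; aset 0 (.lit 1) ;; dpOuter ;;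
    aset 3 (.read 0 (.lit 0)) ;; dpTrace

end RealRAM

/-! ### Correctness of the quadratic program -/

namespace LineDiskInstance
open RealRAM

/-- The factor `407` is the constant `400` of merge sort plus the cost `7` of one comparison of
abscissas. -/
theorem quadraticProg_solves {n m : ℕ} (I : LineDiskInstance n m) (hn : 0 < n)
    (hI : I.Covers Finset.univ) :
    ∃ s, ∃ t ≤ 407 * (n + 1) * (Nat.clog 2 n + 1) + (300 * m + 100) * n + 50 * n + 100,
      Exec quadraticProg I.input s t ∧ I.IsOptimal (output m s) := by
  have main : Runs quadraticProg I.input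
      (407 * (n + 1) * (Nat.clog 2 n + 1) + (300 * m + 100) * n + 50 * n + 100)
      fun s => I.IsOptimal (output m s) := by
    unfold Runs quadraticProg
    have hin : I.input.nat 0 0 = n := rfl
    have him : I.input.nat 0 1 = m := rfl
    have hz : ∀ a, a ≠ 0 → ∀ i, I.input.nat a i = 0 := by
      intro a ha i
      simp only [input]
      rcases a with - | a
      · exact absurd rfl ha
      · rfl
    obtain ⟨L, hL⟩ : ∃ L, L = 407 * (n + 1) * (Nat.clog 2 n + 1) := ⟨_, rfl⟩
    obtain ⟨M, hM⟩ : ∃ M, M = (300 * m + 100) * n := ⟨_, rfl⟩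
    rw [← hL, ← hM]
    set s₀ := I.input with hs₀
    clear_value s₀
    simp only [wp_seq, wp_nset]
    refine ⟨by simp, ?_⟩
    have hd : Decides pointCmp (fun u v => s₀.real 0 u ≤ s₀.real 0 v)
        (s₀.setNat 3 ((NExp.lit 2).eval s₀) ((NExp.read 0 (.lit 0)).eval s₀)) := by
      intro s hs hr
      simp [pointCmp, hr]
    refine (sortProg_runs (le := fun u v => s₀.real 0 u ≤ s₀.real 0 v) (fun _ _ _ h h' => le_trans h h') (fun a b => le_total (s₀.real 0 a) (s₀.real 0 b)) hd (N := n)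
      (by simp [hin])).wp (by rw [show pointCmp.cost = 7 from rfl]; simp; omega) ?_
    rintro s₁ c₁ hs₁ ⟨hsort, hperm⟩ hc₁
    rw [show pointCmp.cost = 7 from rfl] at hc₁
    have hr₁ : s₁.real = s₀.real := by
      funext a
      rw [hs₁.real a sortProg_writesReal]
      simp
    have hn₁ : ∀ a, a ≠ 3 → a ≠ 4 → a ≠ 5 → s₁.nat a = s₀.nat a := by
      intro a h3 h4 h5
      rw [hs₁.nat a (by rw [sortProg_writes]; omega)]
      simp [h3]
    simp at hc₁
    simp only [wp_seq, wp_nset]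
    refine ⟨by simp; omega, ?_⟩
    have hperm' : ∀ j < n, s₁.nat 4 j < n := by
      intro j hj
      have : s₁.nat 4 j ∈ seg (s₁.nat 4) 0 n := mem_seg.2 ⟨j, by omega, hj, rfl⟩
      rw [hperm.mem_iff] at this
      exact List.mem_range.1 this
    have hpermS : ∀ i < n, ∃ j < n, s₁.nat 4 j = i := by
      intro i hi
      have : i ∈ seg (s₁.nat 4) 0 n := hperm.mem_iff.2 (List.mem_range.2 hi)
      obtain ⟨j, -, hj, rfl⟩ := mem_seg.1 this
      exact ⟨j, hj, rfl⟩
    -- Points are renumbered by rank, starting from `1`, so that index `0` stands for the empty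
    -- chain of cost `0`.
    obtain ⟨cov, hcov⟩ : ∃ cov : ℕ → ℕ → Prop, ∀ k i, cov k i ↔ I.CoversAt k (s₁.nat 4 (i - 1)) :=
      ⟨_, fun _ _ => Iff.rfl⟩
    have hcov' : ∀ k i, cov k i ↔ s₀.real 1 (s₁.nat 4 (i - 1)) * s₀.real 1 (s₁.nat 4 (i - 1)) ≤
        discHeight (s₀.real 2 k) (s₀.real 3 k) (s₀.real 0 (s₁.nat 4 (i - 1))) := by
      intro k i
      rw [hcov, hs₀]; rfl
    refine (dpOuter_runs (cov := cov) (n := n) (m := m) (by simp [hn₁, hin]) (by simp [hn₁, him])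
      (by simp) ?_ (by simp [hn₁, hz]) (by simp [hn₁, hz]) ?_).wp (by simp; omega) ?_
    · intro k j
      simp [hcov', hr₁]
    · intro j hj
      obtain ⟨k, hk, hkc⟩ := I.coversIdx_range hI _ (hperm' j hj)
      exact ⟨k, Finset.mem_range.1 hk, by rwa [hcov]⟩
    rintro s₂ c₂ hs₂ ⟨h50, hopt⟩ hc₂
    simp at hc₂
    have hout : dpOuter.WritesNat 0 = False ∧ dpOuter.WritesNat 1 = False := by
      simp [dpOuter, dpInner_writes]
    simp only [wp_seq, wp_nset]
    refine ⟨by simp; omega, ?_⟩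
    have hW : ∀ k, 0 ≤ s₀.real 4 k := by
      intro k; rw [hs₀]; exact I.weight_nonneg_idx k
    have hf0 : s₂.real 5 0 = 0 := by
      rw [h50]; simp only [State.setNat_real, hr₁, hs₀]; rfl
    simp only [State.setNat_real, hr₁] at hopt
    refine (dpTrace_runs (cov := cov) (n := n) (m := m) hW ?_ ?_ ?_ ?_).wp
      (by simp; omega) ?_
    · simp [hs₂.nat 0 (by simp [hout]), hn₁, hin]
    · simp [hs₂.nat 1 (by simp [hout]), hn₁, hz]
    · simpa using hf0
    · simpa using hopt
    rintro s₃ c₃ - ⟨D, hD, hDm, hDc, hDs⟩ -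
    refine I.isOptimal_output hD (fun k _ => hDm k) ?_ ?_
    · intro i hi
      obtain ⟨j, hj, rfl⟩ := hpermS i hi
      obtain ⟨k, hk, hkc⟩ := hDc (j + 1) (by omega) (by omega)
      exact ⟨k, hk, by simpa [hcov] using hkc⟩
    · intro T hT hTc
      rw [← hs₀]
      refine hDs.trans ?_
      simp only [State.setNat_real]
      refine chain_le_sum (C := s₀.real 2) (R := s₀.real 3) (X := fun i => s₀.real 0 (s₁.nat 4 (i - 1)))
        (Y := fun i => s₀.real 1 (s₁.nat 4 (i - 1))) hW ?_ hn hf0 hcov' hopt hT ?_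
      · intro i j h1 hij hj
        rw [pairwise_seg] at hsort
        exact hsort (i - 1) (j - 1) (by omega) (by omega) (by omega)
      · intro i h1 h2
        obtain ⟨k, hk, hkc⟩ := hTc _ (hperm' (i - 1) (by omega))
        exact ⟨k, hk, (hcov _ _).2 hkc⟩
  obtain ⟨s, t, he, ht, h⟩ := main
  exact ⟨s, t, ht, he, h⟩

end LineDiskInstance

/-! ### Logarithms and the first time bound -/

theorem clog_le_log {N : ℕ} (hN : 1 ≤ N) : (Nat.clog 2 N : ℝ) ≤ Real.log N / Real.log 2 + 1 := by
  have h := Real.natCeil_logb_natCast 2 N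
  have h0 : 0 ≤ Real.logb 2 N := Real.logb_nonneg (by norm_num) (by exact_mod_cast hN)
  have := Nat.ceil_lt_add_one h0
  rw [Real.logb] at this
  have h' : (Nat.clog 2 N : ℝ) = (⌈Real.logb ((2 : ℕ) : ℝ) N⌉₊ : ℝ) := by exact_mod_cast h.symm
  rw [h', Real.logb]
  push_cast
  exact this.le

theorem half_le_log_two : (1 / 2 : ℝ) ≤ Real.log 2 := by
  have := Real.log_two_gt_d9
  linarith

/-- Since `log 2 ≥ 1/2`, the quotient `log N / log 2` is at most `2l`, and the additive `2` is at
most `4l` because `l ≥ 1/2`. -/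
theorem clog_succ_le {N : ℕ} {l : ℝ} (hN : 1 ≤ N) (h : Real.log N ≤ l) (hl : Real.log 2 ≤ l) :
    (Nat.clog 2 N + 1 : ℝ) ≤ 6 * l := by
  have h1 := clog_le_log hN
  have h2 := half_le_log_two
  have h3 : Real.log N / Real.log 2 ≤ l / (1 / 2) := by
    apply div_le_div₀ <;> linarith
  linarith

namespace LineDiskInstance
open RealRAM

theorem exists_quadratic : ∃ (p : RealRAM.Prog) (C : ℝ), ∀ (n m : ℕ) (I : LineDiskInstance n m),
    0 < n → I.Covers Finset.univ →
      I.SolvedWithin p (C * ((n : ℝ) * (m : ℝ) * Real.log ((m : ℝ) + (n : ℝ)))) := by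
  refine ⟨quadraticProg, 10000, fun n m I hn hI => ?_⟩
  obtain ⟨s, t, ht, he, ho⟩ := I.quadraticProg_solves hn hI
  refine ⟨s, t, he, ?_, ho⟩
  -- A point must be covered, so there is a disk. Hence `m + n ≥ 2`, the logarithm is bounded away
  -- from zero, and lower-order terms can be absorbed.
  have hm : 1 ≤ m := by
    obtain ⟨k, -, -⟩ := hI ⟨0, hn⟩
    have := k.2
    omega
  have hn' : (1 : ℝ) ≤ n := by exact_mod_cast hn
  have hm' : (1 : ℝ) ≤ m := by exact_mod_cast hm
  set l := Real.log ((m : ℝ) + n) with hl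
  have hl2 : Real.log 2 ≤ l := Real.log_le_log (by norm_num) (by linarith)
  have hln : Real.log n ≤ l := Real.log_le_log (by linarith) (by linarith)
  have hc := clog_succ_le hn hln hl2
  have hlh := half_le_log_two.trans hl2
  have ht' : (t : ℝ) ≤ 407 * (n + 1) * (Nat.clog 2 n + 1) + (300 * m + 100) * n + 50 * n + 100 := by
    exact_mod_cast ht
  have hnm : (n : ℝ) ≤ n * m := by nlinarith
  have h1 : 407 * ((n : ℝ) + 1) * (Nat.clog 2 n + 1) ≤ 407 * (2 * (n * m)) * (6 * l) := by
    apply mul_le_mul <;> linarith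
  have h2 : (1 : ℝ) ≤ n * m := by nlinarith
  have h3 : (n : ℝ) * m ≤ n * m * (2 * l) := by nlinarith
  nlinarith

end LineDiskInstance

/-! ## The plane sweep: events and their order -/

/-- Points with abscissas `X` and ordinates `Y`, and disks with centres `C` on the axis, radii `R`
and weights `W`; there are `n` points and `m` disks. -/
structure Scene where
  C : ℕ → ℝ
  R : ℕ → ℝ
  W : ℕ → ℝ
  X : ℕ → ℝ
  Y : ℕ → ℝ
  m : ℕ
  n : ℕ

/-- The events of the sweep: a disk begins, a disk is overtaken by another one, a point is passed,
a disk ends. -/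
inductive Ev : Type
  | ins (k : ℕ)
  | crs (a b : ℕ)
  | pt (i : ℕ)
  | rem (k : ℕ)

namespace Ev

/-- The kind of an event. -/
def level : Ev → ℕ
  | ins _ => 0
  | crs _ _ => 1
  | pt _ => 2
  | rem _ => 3

/-- The first object of an event. -/
def fst : Ev → ℕ
  | ins k => k
  | crs a _ => a
  | pt i => i
  | rem k => k

/-- The second object of an event. -/
def snd : Ev → ℕ
  | crs _ b => b
  | _ => 0

end Ev

namespace Scene
variable (G : Scene)

/-- The height function of a disk. -/
def h (k : ℕ) (x : ℝ) : ℝ := discHeight (G.C k) (G.R k) x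

/-- The left end of a disk. -/
def lo (k : ℕ) : ℝ := G.C k - G.R k

/-- The right end of a disk. -/
def hi (k : ℕ) : ℝ := G.C k + G.R k

/-- The abscissa where two disks have the same height. -/
noncomputable def cross (a b : ℕ) : ℝ :=
  ((G.R a * G.R a - G.C a * G.C a) - (G.R b * G.R b - G.C b * G.C b)) / (2 * (G.C b - G.C a))

/-- The abscissa of an event. -/
noncomputable def pos : Ev → ℝ
  | .ins k => G.lo k
  | .crs a b => G.cross a b
  | .pt i => G.X i
  | .rem k => G.hi k

/-- The key by which events are sorted. -/
noncomputable def key (e : Ev) : ℝ ×ₗ ℕ ×ₗ ℝ ×ₗ ℝ :=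
  toLex (G.pos e, toLex (e.level, toLex (G.C e.fst, G.C e.snd)))

/-- The events that occur. -/
def IsEvent : Ev → Prop
  | .ins k => k < G.m
  | .crs a b => a < G.m ∧ b < G.m ∧ G.C a < G.C b ∧ G.lo a ≤ G.hi b ∧ G.lo b ≤ G.hi a
  | .pt i => i < G.n
  | .rem k => k < G.m

/-- No two disks are equal, and all radii are positive. -/
structure Valid : Prop where
  R_pos : ∀ k < G.m, 0 < G.R k
  W_nonneg : ∀ k < G.m, 0 ≤ G.W k
  inj : ∀ a < G.m, ∀ b < G.m, G.C a = G.C b → G.R a = G.R b → a = b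

/-- `done` is the set of the events that precede `ev`. -/
structure At (done : Set Ev) (ev : Ev) : Prop where
  isEvent : G.IsEvent ev
  not_mem : ev ∉ done
  le : ∀ e ∈ done, G.key e ≤ G.key ev
  ge : ∀ e, G.IsEvent e → e ∉ done → G.key ev ≤ G.key e

/-- Disk `k` has begun and not ended. -/
def Active (done : Set Ev) (k : ℕ) : Prop := k < G.m ∧ .ins k ∈ done ∧ .rem k ∉ done

/-- Disk `p` is lower than disk `q` between the events of `done` and the other events. -/
def Below (done : Set Ev) (p q : ℕ) : Prop :=
  (G.C p < G.C q → .crs p q ∈ done) ∧ (G.C q < G.C p → .crs q p ∉ done) ∧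
    (G.C p = G.C q → G.R p < G.R q)

variable {G}

/-- The quadratic terms cancel. All comparisons of disks with different centres come from this
affine difference. -/
theorem h_sub {a b : ℕ} (hab : G.C a < G.C b) (x : ℝ) :
    G.h a x - G.h b x = 2 * (G.C b - G.C a) * (G.cross a b - x) := by
  have : G.C b - G.C a ≠ 0 := by linarith
  unfold h discHeight cross
  field_simp
  ring

theorem h_le_iff {a b : ℕ} (hab : G.C a < G.C b) (x : ℝ) :
    G.h a x ≤ G.h b x ↔ G.cross a b ≤ x := by
  have := h_sub hab x
  constructor <;> intro h <;> nlinarith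

theorem h_ge_iff {a b : ℕ} (hab : G.C a < G.C b) (x : ℝ) :
    G.h b x ≤ G.h a x ↔ x ≤ G.cross a b := by
  have := h_sub hab x
  constructor <;> intro h <;> nlinarith

theorem h_eq_mul (k : ℕ) (x : ℝ) : G.h k x = (x - G.lo k) * (G.hi k - x) := by
  unfold h discHeight lo hi; ring

theorem h_nonneg {k : ℕ} {x : ℝ} (h1 : G.lo k ≤ x) (h2 : x ≤ G.hi k) : 0 ≤ G.h k x := by
  rw [h_eq_mul]; exact mul_nonneg (by linarith) (by linarith)

theorem eq_of_h_eq_zero {k : ℕ} {x : ℝ} (h : G.h k x = 0) : x = G.lo k ∨ x = G.hi k := by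
  rw [h_eq_mul, mul_eq_zero] at h
  rcases h with h | h
  · left; linarith
  · right; linarith

theorem range_of_h_nonneg {k : ℕ} (hr : 0 < G.R k) {x : ℝ} (h : 0 ≤ G.h k x) :
    G.lo k ≤ x ∧ x ≤ G.hi k := by
  rw [h_eq_mul] at h
  have : G.lo k ≤ G.hi k := by unfold lo hi; linarith
  constructor <;> nlinarith

theorem h_lt_of_radius {a b : ℕ} (hc : G.C a = G.C b) (h0 : 0 < G.R a) (hr : G.R a < G.R b)
    (x : ℝ) : G.h a x < G.h b x := by
  unfold h discHeight
  rw [hc]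
  nlinarith

theorem key_le_iff {e e' : Ev} : G.key e ≤ G.key e' ↔ G.pos e < G.pos e' ∨ (G.pos e = G.pos e' ∧
    (e.level < e'.level ∨ (e.level = e'.level ∧
      (G.C e.fst < G.C e'.fst ∨ (G.C e.fst = G.C e'.fst ∧ G.C e.snd ≤ G.C e'.snd))))) := by
  simp [key, Prod.Lex.toLex_le_toLex]

theorem key_lt_iff {e e' : Ev} : G.key e < G.key e' ↔ G.pos e < G.pos e' ∨ (G.pos e = G.pos e' ∧
    (e.level < e'.level ∨ (e.level = e'.level ∧
      (G.C e.fst < G.C e'.fst ∨ (G.C e.fst = G.C e'.fst ∧ G.C e.snd < G.C e'.snd))))) := by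
  simp [key, Prod.Lex.toLex_lt_toLex]

theorem pos_le_of_key_le {e e' : Ev} (h : G.key e ≤ G.key e') : G.pos e ≤ G.pos e' := by
  rcases key_le_iff.1 h with h | h
  · exact h.le
  · exact h.1.le

section At
variable {d : Set Ev} {ev : Ev} (A : G.At d ev)
include A

theorem At.mem {e : Ev} (he : G.IsEvent e) (h : G.key e < G.key ev) : e ∈ d := by
  by_contra hc
  exact absurd (A.ge e he hc) (not_le.2 h)

theorem At.notMem {e : Ev} (h : G.key ev < G.key e) : e ∉ d := fun hc =>
  absurd (A.le e hc) (not_le.2 h)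

theorem At.pos_le {e : Ev} (h : e ∈ d) : G.pos e ≤ G.pos ev := pos_le_of_key_le (A.le e h)

theorem At.pos_ge {e : Ev} (he : G.IsEvent e) (h : e ∉ d) : G.pos ev ≤ G.pos e :=
  pos_le_of_key_le (A.ge e he h)

theorem At.range {k : ℕ} (hk : G.Active d k) : G.lo k ≤ G.pos ev ∧ G.pos ev ≤ G.hi k :=
  ⟨A.pos_le hk.2.1, A.pos_ge (e := .rem k) hk.1 hk.2.2⟩

theorem At.nonneg {k : ℕ} (hk : G.Active d k) : 0 ≤ G.h k (G.pos ev) :=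
  h_nonneg (A.range hk).1 (A.range hk).2

theorem At.isEvent_crs {p q : ℕ} (hp : G.Active d p) (hq : G.Active d q) (h : G.C p < G.C q) :
    G.IsEvent (.crs p q) := by
  have h1 := A.range hp
  have h2 := A.range hq
  exact ⟨hp.1, hq.1, h, by linarith, by linarith⟩

/-- The link between the combinatorial order and geometry. Crossings already processed lie at or
left of the current abscissa, pending ones at or right of it, and concentric disks compare by
radius. The converse fails at ties, where the event order decides. -/
theorem At.below_le (hv : G.Valid) {p q : ℕ} (hp : G.Active d p) (hq : G.Active d q)
    (h : G.Below d p q) : G.h p (G.pos ev) ≤ G.h q (G.pos ev) := by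
  rcases lt_trichotomy (G.C p) (G.C q) with hc | hc | hc
  · exact (h_le_iff hc _).2 (A.pos_le (h.1 hc))
  · exact (h_lt_of_radius hc (hv.R_pos p hp.1) (h.2.2 hc) _).le
  · exact (h_ge_iff hc _).2 (A.pos_ge (A.isEvent_crs hq hp hc) (h.2.1 hc))

end At

theorem Below.asymm {d : Set Ev} {p q : ℕ} (h : G.Below d p q) : ¬ G.Below d q p := by
  intro h'
  rcases lt_trichotomy (G.C p) (G.C q) with hc | hc | hc
  · exact h'.2.1 hc (h.1 hc)
  · exact absurd (h.2.2 hc) (not_lt.2 (h'.2.2 hc.symm).le)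
  · exact h.2.1 hc (h'.1 hc)

/-- Together with `Below.asymm` this orders any two different disks in exactly one way, even where
their heights agree. Concentric disks need the absence of duplicates. -/
theorem Below.total (hv : G.Valid) (d : Set Ev) {p q : ℕ} (hp : p < G.m) (hq : q < G.m)
    (hpq : p ≠ q) : G.Below d p q ∨ G.Below d q p := by
  rcases lt_trichotomy (G.C p) (G.C q) with hc | hc | hc
  · by_cases h : Ev.crs p q ∈ d
    · exact .inl ⟨fun _ => h, fun h' => absurd h' hc.not_gt, fun h' => absurd h' hc.ne⟩
    · exact .inr ⟨fun h' => absurd h' hc.not_gt, fun _ => h, fun h' => absurd h' hc.ne'⟩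
  · rcases lt_trichotomy (G.R p) (G.R q) with hr | hr | hr
    · exact .inl ⟨fun h' => absurd hc h'.ne, fun h' => absurd hc h'.ne', fun _ => hr⟩
    · exact absurd (hv.inj p hp q hq hc hr) hpq
    · exact .inr ⟨fun h' => absurd hc h'.ne', fun h' => absurd hc h'.ne, fun _ => hr⟩
  · by_cases h : Ev.crs q p ∈ d
    · exact .inr ⟨fun _ => h, fun h' => absurd h' hc.not_gt, fun h' => absurd h' hc.ne⟩
    · exact .inl ⟨fun h' => absurd h' hc.not_gt, fun _ => h, fun h' => absurd h' hc.ne'⟩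

/-- At the moment when `b` overtakes `a`, no disk lies strictly between them. -/
theorem At.below_crs_iff {d : Set Ev} {a b l : ℕ} (A : G.At d (.crs a b)) (hv : G.Valid)
    (ha : G.Active d a) (hb : G.Active d b) (hl : G.Active d l) (hla : l ≠ a) (hlb : l ≠ b) :
    G.Below d l a ↔ G.Below d l b := by
  have hab : G.C a < G.C b := A.isEvent.2.2.1
  set x := G.pos (.crs a b) with hx
  have hxc : x = G.cross a b := rfl
  have heq : G.h a x = G.h b x :=
    le_antisymm ((h_le_iff hab x).2 hxc.ge) ((h_ge_iff hab x).2 hxc.le)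
  -- A disk concentric with `a` or `b` but of a different radius is nowhere of equal height, so a
  -- disk through the common point of `a` and `b` has a third centre.
  have hne : G.h l x = G.h a x → G.C l ≠ G.C a ∧ G.C l ≠ G.C b := by
    intro h
    constructor <;> intro hc
    · rcases lt_trichotomy (G.R l) (G.R a) with hr | hr | hr
      · exact absurd h (h_lt_of_radius hc (hv.R_pos l hl.1) hr x).ne
      · exact hla (hv.inj _ hl.1 _ ha.1 hc hr)
      · exact absurd h (h_lt_of_radius hc.symm (hv.R_pos a ha.1) hr x).ne'
    · rcases lt_trichotomy (G.R l) (G.R b) with hr | hr | hr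
      · exact absurd (h.trans heq) (h_lt_of_radius hc (hv.R_pos l hl.1) hr x).ne
      · exact hlb (hv.inj _ hl.1 _ hb.1 hc hr)
      · exact absurd (h.trans heq) (h_lt_of_radius hc.symm (hv.R_pos b hb.1) hr x).ne'
  have hcr : ∀ p q, G.C p < G.C q → G.h p x = G.h q x → G.pos (.crs p q) = x := by
    intro p q hpq he
    exact le_antisymm ((h_le_iff hpq x).1 he.le) ((h_ge_iff hpq x).1 he.ge)
  have hbefore : ∀ p q, G.Active d p → G.Active d q → G.C p < G.C q → G.h p x = G.h q x →
      (G.C p < G.C a ∨ (p = a ∧ G.C q < G.C b)) → Ev.crs p q ∈ d := by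
    intro p q hp hq hpq he hlt
    refine A.mem (A.isEvent_crs hp hq hpq) (key_lt_iff.2 (.inr ⟨hcr p q hpq he, .inr ⟨rfl, ?_⟩⟩))
    rcases hlt with h | ⟨rfl, h⟩
    · exact .inl h
    · exact .inr ⟨rfl, h⟩
  have hafter : ∀ p q, G.C p < G.C q → G.h p x = G.h q x →
      (G.C a < G.C p ∨ (p = a ∧ G.C b < G.C q)) → Ev.crs p q ∉ d := by
    intro p q hpq he hlt
    refine A.notMem (key_lt_iff.2 (.inr ⟨(hcr p q hpq he).symm, .inr ⟨rfl, ?_⟩⟩))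
    rcases hlt with h | ⟨rfl, h⟩
    · exact .inl h
    · exact .inr ⟨rfl, h⟩
  -- A disk strictly between `a` and `b` would pass through their common point, so all three
  -- crossings have the same abscissa and are ordered lexicographically by centres. For each
  -- position of the third centre, one crossing is then on the wrong side of the current event.
  constructor
  · intro h
    rcases Below.total hv d hl.1 hb.1 hlb with h' | h'
    · exact h'
    exfalso
    have h1 := A.below_le hv hl ha h
    have h2 := A.below_le hv hb hl h'
    rw [← hx] at h1 h2
    have e1 : G.h l x = G.h a x := le_antisymm h1 (heq ▸ h2)
    have e2 : G.h l x = G.h b x := e1.trans heq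
    obtain ⟨n1, n2⟩ := hne e1
    rcases lt_or_gt_of_ne n1 with c1 | c1
    · exact h'.2.1 (c1.trans hab) (hbefore l b hl hb (c1.trans hab) e2 (.inl c1))
    · rcases lt_or_gt_of_ne n2 with c2 | c2
      · exact h.2.1 c1 (hbefore a l ha hl c1 e1.symm (.inr ⟨rfl, c2⟩))
      · exact hafter b l c2 e2.symm (.inl hab) (h'.1 c2)
  · intro h
    rcases Below.total hv d hl.1 ha.1 hla with h' | h'
    · exact h'
    exfalso
    have h1 := A.below_le hv hl hb h
    have h2 := A.below_le hv ha hl h'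
    rw [← hx] at h1 h2
    have e1 : G.h l x = G.h a x := le_antisymm (heq ▸ h1) h2
    have e2 : G.h l x = G.h b x := e1.trans heq
    obtain ⟨n1, n2⟩ := hne e1
    rcases lt_or_gt_of_ne n1 with c1 | c1
    · exact h'.2.1 c1 (hbefore l a hl ha c1 e1 (.inl c1))
    · rcases lt_or_gt_of_ne n2 with c2 | c2
      · exact hafter l b c2 e2 (.inl c1) (h.1 c2)
      · exact hafter a l c1 e1.symm (.inr ⟨rfl, c2⟩) (h'.1 c1)

/-- A disk that begins is lower than all others. -/
theorem At.ins_below {d : Set Ev} {b l : ℕ} (A : G.At d (.ins b)) (hv : G.Valid)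
    (hl : G.Active d l) (hlb : l ≠ b) : G.Below d b l := by
  have hb : b < G.m := A.isEvent
  have hx : G.pos (.ins b) = G.lo b := rfl
  have hr := hv.R_pos b hb
  have hlr := A.range hl
  have hnn := A.nonneg hl
  rw [hx] at hlr hnn
  have hb0 : G.h b (G.lo b) = 0 := by rw [h_eq_mul]; ring
  have hbh : G.lo b ≤ G.hi b := by unfold lo hi; linarith
  refine ⟨fun hc => ?_, fun hc => ?_, fun hc => ?_⟩
  · have h1 : G.cross b l ≤ G.lo b := (h_le_iff hc _).1 (hb0 ▸ hnn)
    refine A.mem ⟨hb, hl.1, hc, hlr.2, hlr.1.trans hbh⟩ (key_lt_iff.2 (.inl ?_))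
    -- Equality makes both heights vanish at the left end of `b`. If `l` also begins there, its
    -- larger centre would place its beginning after that of `b`; if it ends there, its centre would
    -- lie left of that of `b`.
    refine lt_of_le_of_ne h1 fun he => ?_
    have h2 : G.h l (G.lo b) = 0 := by
      rw [← hb0]
      exact le_antisymm ((h_ge_iff hc _).2 he.ge) (hb0 ▸ hnn)
    rcases eq_of_h_eq_zero h2 with h2 | h2
    · have := A.le _ hl.2.1
      rw [key_le_iff] at this
      rcases this with h | ⟨-, h | ⟨-, h | ⟨h, -⟩⟩⟩
      · exact absurd h2 (ne_of_gt h)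
      · exact absurd h (lt_irrefl _)
      · exact absurd hc (not_lt.2 h.le)
      · exact hc.ne' h
    · have hrl := hv.R_pos l hl.1
      unfold lo hi at h2
      linarith
  · have h1 : G.lo b ≤ G.cross l b := (h_ge_iff hc _).1 (hb0 ▸ hnn)
    refine A.notMem (key_lt_iff.2 ?_)
    rcases h1.lt_or_eq with h | h
    · exact .inl h
    -- A crossing exactly at the left end is still pending, because beginnings precede crossings.
    · exact .inr ⟨h, .inl Nat.zero_lt_one⟩
  · refine lt_of_le_of_ne ?_ fun he => hlb (hv.inj b hb l hl.1 hc he).symm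
    have := hlr.1
    unfold lo at this
    linarith

/-- A disk that ends is lower than all others. -/
theorem At.rem_below {d : Set Ev} {k l : ℕ} (A : G.At d (.rem k)) (hv : G.Valid)
    (hk : G.Active d k) (hl : G.Active d l) (hlk : l ≠ k) : G.Below d k l := by
  have hx : G.pos (.rem k) = G.hi k := rfl
  have hr := hv.R_pos k hk.1
  have hlr := A.range hl
  have hnn := A.nonneg hl
  rw [hx] at hlr hnn
  have hk0 : G.h k (G.hi k) = 0 := by rw [h_eq_mul]; ring
  refine ⟨fun hc => ?_, fun hc => ?_, fun hc => ?_⟩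
  · have h1 : G.cross k l ≤ G.hi k := (h_le_iff hc _).1 (hk0 ▸ hnn)
    refine A.mem (A.isEvent_crs hk hl hc) (key_lt_iff.2 ?_)
    rcases h1.lt_or_eq with h | h
    · exact .inl h
    · exact .inr ⟨h, .inl (by simp [Ev.level])⟩
  · have h1 : G.hi k ≤ G.cross l k := (h_ge_iff hc _).1 (hk0 ▸ hnn)
    -- The mirror image: two disks tangent at a common right end have already crossed, and the one
    -- with the smaller centre ends first.
    refine A.notMem (key_lt_iff.2 (.inl (lt_of_le_of_ne h1 fun he => ?_)))
    have h2 : G.h l (G.hi k) = 0 := by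
      rw [← hk0]
      exact le_antisymm ((h_le_iff hc _).2 he.ge) (hk0 ▸ hnn)
    rcases eq_of_h_eq_zero h2 with h2 | h2
    · have hrl := hv.R_pos l hl.1
      unfold lo hi at h2
      linarith
    · have := A.ge (.rem l) hl.1 hl.2.2
      rw [key_le_iff] at this
      rcases this with h | ⟨-, h | ⟨-, h | ⟨h, -⟩⟩⟩
      · exact absurd h2 (ne_of_lt h)
      · exact absurd h (lt_irrefl _)
      · exact absurd hc (not_lt.2 h.le)
      · exact hc.ne' h
  · refine lt_of_le_of_ne ?_ fun he => hlk (hv.inj k hk.1 l hl.1 hc he).symm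
    have := hlr.2
    unfold hi at this
    linarith

end Scene

/-! ## The plane sweep: the data structure -/

/-- The data of the sweep.  A token `t ≠ 0` stands for a set of disks: `owner t` and the disks of
token `npar t`.  The tokens form a linked list that begins with the sentinel `0`; `tok b` is the
current token of disk `b`, and is `0` if there is none.  If `fok ≠ 0`, then `fnode` is the best
token of a disk that has ended. -/
structure Mach where
  tok : ℕ → ℕ
  next : ℕ → ℕ
  owner : ℕ → ℕ
  npar : ℕ → ℕ
  cost : ℕ → ℝ
  cnt : ℕ
  fok : ℕ
  fnode : ℕ

namespace Mach
variable (σ : Mach)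

/-- A new token of disk `b` after the token `t`. -/
noncomputable def push (b t par : ℕ) (c : ℝ) : Mach where
  tok := Function.update σ.tok b (σ.cnt + 1)
  next := Function.update (Function.update σ.next (σ.cnt + 1) (σ.next t)) t (σ.cnt + 1)
  owner := Function.update σ.owner (σ.cnt + 1) b
  npar := Function.update σ.npar (σ.cnt + 1) par
  cost := Function.update σ.cost (σ.cnt + 1) c
  cnt := σ.cnt + 1
  fok := σ.fok
  fnode := σ.fnode

open Classical in
/-- Disk `b` of weight `w` begins. -/
noncomputable def onIns (w : ℝ) (b : ℕ) : Mach :=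
  if σ.fok = 0 then σ else σ.push b 0 σ.fnode (σ.cost σ.fnode + w)

open Classical in
/-- Disk `b` of weight `w` overtakes disk `a`. -/
noncomputable def onCrs (w : ℝ) (a b : ℕ) : Mach :=
  if σ.tok a = 0 then σ
  else if σ.tok b ≠ 0 ∧ σ.cost (σ.tok b) ≤ σ.cost (σ.tok a) + w then
    σ.push b (σ.tok a) (σ.npar (σ.tok b)) (σ.cost (σ.tok b))
  else σ.push b (σ.tok a) (σ.tok a) (σ.cost (σ.tok a) + w)

/-- A point is reached. -/
def onPt : Mach := { σ with fok := 0 }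

open Classical in
/-- Remove the first token of the list. -/
noncomputable def pop : Mach :=
  { σ with
    next := Function.update σ.next 0 (σ.next (σ.next 0))
    tok := if σ.tok (σ.owner (σ.next 0)) = σ.next 0 then
      Function.update σ.tok (σ.owner (σ.next 0)) 0 else σ.tok }

open Classical in
/-- Disk `k` ends. -/
noncomputable def onRem (k : ℕ) : Mach :=
  if σ.tok k = 0 then σ
  else if σ.fok ≠ 0 ∧ σ.cost σ.fnode ≤ σ.cost (σ.tok k) then
    { σ with tok := Function.update σ.tok k 0 }
  else { σ with tok := Function.update σ.tok k 0, fok := 1, fnode := σ.tok k }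

end Mach

/-- `L` is the list of the cells that follow cell `t` in a linked list that ends with `0`. -/
def Linked (next : ℕ → ℕ) : ℕ → List ℕ → Prop
  | t, [] => next t = 0
  | t, u :: L => next t = u ∧ Linked next u L

theorem Linked.congr {next next' : ℕ → ℕ} {t : ℕ} {L : List ℕ} (h : Linked next t L)
    (he : ∀ u ∈ t :: L, next' u = next u) : Linked next' t L := by
  induction L generalizing t with
  | nil => simpa [Linked, he t (by simp)] using h
  | cons u L ih =>
    exact ⟨(he t (by simp)).trans h.1, ih h.2 fun v hv => he v (List.mem_cons_of_mem _ hv)⟩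

/-- `getLastD` returns the anchor `t` itself when `A` is empty, so insertion at the front needs no
separate statement. -/
theorem Linked.insert {next : ℕ → ℕ} {t u v : ℕ} {A B : List ℕ} (h : Linked next t (A ++ B))
    (hu : A.getLastD t = u) (hnd : (t :: (A ++ B)).Nodup) (hv : v ∉ t :: (A ++ B)) :
    Linked (Function.update (Function.update next v (next u)) u v) t (A ++ v :: B) := by
  induction A generalizing t with
  | nil =>
    obtain rfl : t = u := by simpa using hu
    have hvt : v ≠ t := by rintro rfl; simp at hv
    refine ⟨by simp, ?_⟩
    cases B with
    | nil => simpa [Linked, hvt] using h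
    | cons w B =>
      refine ⟨by simpa [hvt] using h.1, h.2.congr fun x hx => ?_⟩
      have h1 : x ≠ t := by rintro rfl; exact (List.nodup_cons.1 hnd).1 hx
      have h2 : x ≠ v := by rintro rfl; exact hv (List.mem_cons_of_mem _ hx)
      simp [h1, h2]
  | cons a A ih =>
    have hu' : A.getLastD a = u := by rwa [List.getLastD_cons] at hu
    have hmem : u ∈ a :: A := by
      rw [← hu']
      cases A with
      | nil => simp
      | cons b A => simp [List.getLastD_eq_getLast?, List.getLast?_eq_some_getLast]
    have h1 : t ≠ u := by
      rintro rfl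
      exact (List.nodup_cons.1 hnd).1 (List.mem_append_left _ hmem)
    have h2 : t ≠ v := by rintro rfl; simp at hv
    refine ⟨by simpa [h1, h2] using h.1, ih h.2 hu' (List.nodup_cons.1 hnd).2 fun hc => ?_⟩
    exact hv (List.mem_cons_of_mem _ hc)

namespace Scene
variable {G : Scene}

/-- Point `i` lies in disk `k`. -/
def Cov (G : Scene) (k i : ℕ) : Prop := G.Y i * G.Y i ≤ G.h k (G.X i)

/-- The linked list `L` of tokens is ordered by the heights of their disks. -/
structure ListInv (G : Scene) (d : Set Ev) (σ : Mach) (L : List ℕ) : Prop where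
  linked : Linked σ.next 0 L
  nodup : L.Nodup
  bound : ∀ u ∈ L, 1 ≤ u ∧ u ≤ σ.cnt
  fnode : σ.fnode ≤ σ.cnt
  alive : ∀ b, σ.tok b ≠ 0 → G.Active d b ∧ σ.tok b ∈ L ∧ σ.owner (σ.tok b) = b
  sorted : L.Pairwise fun u v => σ.tok (σ.owner u) = u → σ.tok (σ.owner v) = v →
    G.Below d (σ.owner u) (σ.owner v)

/-- `S t` is the set of the disks of token `t`; those of the current tokens cover all points that
have been passed. -/
structure Sound (G : Scene) (d : Set Ev) (σ : Mach) (S : ℕ → Finset ℕ) : Prop where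
  zero : S 0 = ∅
  npar : ∀ t, 1 ≤ t → t ≤ σ.cnt → σ.npar t < t
  owner : ∀ t, 1 ≤ t → t ≤ σ.cnt → σ.owner t < G.m
  eq : ∀ t, 1 ≤ t → t ≤ σ.cnt → S t = insert (σ.owner t) (S (σ.npar t))
  sum : ∀ t, t ≤ σ.cnt → ∑ k ∈ S t, G.W k ≤ σ.cost t
  cov : ∀ b, σ.tok b ≠ 0 → ∀ i, .pt i ∈ d → ∃ k ∈ S (σ.tok b), G.Cov k i
  covF : σ.fok ≠ 0 → ∀ i, .pt i ∈ d → ∃ k ∈ S σ.fnode, G.Cov k i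

/-- The weight of disk `k` and all disks of `T` with a smaller centre. -/
noncomputable def prefixWeight (G : Scene) (T : Finset ℕ) (k : ℕ) : ℝ :=
  G.W k + ∑ l ∈ T with G.C l < G.C k, G.W l

/-- The weight of the disks of `T` that have ended. -/
noncomputable def doneWeight (G : Scene) (T : Finset ℕ) (d : Set Ev) : ℝ :=
  ∑ l ∈ T, Set.indicator {l | Ev.rem l ∈ d} G.W l

theorem doneWeight_congr {T : Finset ℕ} {d d' : Set Ev}
    (h : ∀ l ∈ T, (Ev.rem l ∈ d' ↔ Ev.rem l ∈ d)) : G.doneWeight T d' = G.doneWeight T d := by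
  classical
  refine Finset.sum_congr rfl fun l hl => ?_
  simp [Set.indicator_apply, h l hl]

theorem doneWeight_le {T : Finset ℕ} {d : Set Ev} {P : ℕ → Prop} [DecidablePred P]
    (hW : ∀ l ∈ T, 0 ≤ G.W l) (h : ∀ l ∈ T, Ev.rem l ∈ d → P l) :
    G.doneWeight T d ≤ ∑ l ∈ T with P l, G.W l := by
  classical
  rw [Finset.sum_filter]
  refine Finset.sum_le_sum fun l hl => ?_
  rw [Set.indicator_apply]
  split_ifs with h1 h2 h2
  · exact le_rfl
  · exact absurd (h l hl h1) h2
  · exact hW l hl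
  · exact le_rfl

theorem le_doneWeight {T s : Finset ℕ} {d : Set Ev} (hW : ∀ l ∈ T, 0 ≤ G.W l) (hs : s ⊆ T)
    (h : ∀ l ∈ s, Ev.rem l ∈ d) : ∑ l ∈ s, G.W l ≤ G.doneWeight T d := by
  classical
  refine le_trans (le_of_eq (Finset.sum_congr rfl fun l hl => ?_))
    (Finset.sum_le_sum_of_subset_of_nonneg hs fun l hl _ => ?_)
  · simp [h l hl]
  · exact Set.indicator_apply_nonneg fun _ => hW l hl

/-- The costs of the tokens compete with the cover `T`. -/
structure Opt (G : Scene) (T : Finset ℕ) (d : Set Ev) (σ : Mach) : Prop where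
  top : ∀ k ∈ T, G.Active d k → (∀ l ∈ T, G.Active d l → l ≠ k → G.Below d l k) →
    σ.tok k ≠ 0 ∧ σ.cost (σ.tok k) ≤ G.prefixWeight T k
  fin : (∀ k ∈ T, ¬ G.Active d k) →
    σ.fok ≠ 0 ∧ σ.cost σ.fnode ≤ G.doneWeight T d

theorem ListInv.tok_le {d : Set Ev} {σ : Mach} {L : List ℕ} (hL : G.ListInv d σ L) {b : ℕ} :
    σ.tok b ≤ σ.cnt := by
  by_cases h : σ.tok b = 0
  · omega
  · exact (hL.bound _ (hL.alive b h).2.1).2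

theorem below_insert_iff {d : Set Ev} {ev : Ev} {p q : ℕ} (h1 : ev ≠ .crs p q)
    (h2 : ev ≠ .crs q p) : G.Below (insert ev d) p q ↔ G.Below d p q := by
  simp [Below, h1.symm, h2.symm]

theorem Below.of_insert {d : Set Ev} {ev : Ev} {p q : ℕ} (h : G.Below (insert ev d) p q)
    (h1 : ev ≠ .crs p q) : G.Below d p q := by
  refine ⟨fun hc => ?_, fun hc h' => h.2.1 hc (Set.mem_insert_of_mem _ h'), h.2.2⟩
  exact (Set.mem_insert_iff.1 (h.1 hc)).resolve_left (Ne.symm h1)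

/-- A new token of `b` supersedes the old one, which stays in the list but no longer constrains the
order. Hence old comparisons matter only for owners other than `b`, and the two hypotheses `hA` and
`hB` place `b` itself. -/
theorem ListInv.push {d d' : Set Ev} {σ : Mach} {A B : List ℕ} (hL : G.ListInv d σ (A ++ B))
    {b t par : ℕ} {c : ℝ} (ht : A.getLastD 0 = t) (hb : G.Active d' b)
    (hact : ∀ p, G.Active d p → G.Active d' p)
    (hbel : ∀ p q, p ≠ b → q ≠ b → G.Below d p q → G.Below d' p q)
    (hA : ∀ u ∈ A, σ.tok (σ.owner u) = u → σ.owner u ≠ b → G.Below d' (σ.owner u) b)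
    (hB : ∀ u ∈ B, σ.tok (σ.owner u) = u → σ.owner u ≠ b → G.Below d' b (σ.owner u)) :
    G.ListInv d' (σ.push b t par c) (A ++ (σ.cnt + 1) :: B) := by
  have hnew : σ.cnt + 1 ∉ A ++ B := fun h => by have := (hL.bound _ h).2; omega
  have hz : (0 : ℕ) ∉ A ++ B := fun h => by have := (hL.bound _ h).1; omega
  have hown : ∀ u ∈ A ++ B, (σ.push b t par c).owner u = σ.owner u := fun u hu => by
    have : u ≠ σ.cnt + 1 := by rintro rfl; exact hnew hu
    simp [Mach.push, this]
  have hval : ∀ u ∈ A ++ B, (σ.push b t par c).tok ((σ.push b t par c).owner u) = u →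
      σ.tok (σ.owner u) = u ∧ σ.owner u ≠ b := by
    intro u hu h
    rw [hown u hu] at h
    by_cases hb : σ.owner u = b
    · have : u ≠ σ.cnt + 1 := by rintro rfl; exact hnew hu
      rw [hb] at h
      simp [Mach.push] at h
      exact absurd h.symm this
    · simp [Mach.push, hb] at h
      exact ⟨h, hb⟩
  have hnown : (σ.push b t par c).owner (σ.cnt + 1) = b := by simp [Mach.push]
  have hR : ∀ u ∈ A ++ B, ∀ v ∈ A ++ B, (σ.tok (σ.owner u) = u → σ.tok (σ.owner v) = v →
      G.Below d (σ.owner u) (σ.owner v)) →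
      (σ.push b t par c).tok ((σ.push b t par c).owner u) = u →
      (σ.push b t par c).tok ((σ.push b t par c).owner v) = v →
      G.Below d' ((σ.push b t par c).owner u) ((σ.push b t par c).owner v) := by
    intro u hu v hv h h1 h2
    obtain ⟨h1, h1'⟩ := hval u hu h1
    obtain ⟨h2, h2'⟩ := hval v hv h2
    rw [hown u hu, hown v hv]
    exact hbel _ _ h1' h2' (h h1 h2)
  refine ⟨?_, ?_, ?_, ?_, ?_, ?_⟩
  · exact hL.linked.insert ht (List.nodup_cons.2 ⟨hz, hL.nodup⟩) (by
      rw [List.mem_cons]; rintro (h | h)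
      · omega
      · exact hnew h)
  · have := (List.perm_middle (a := σ.cnt + 1) (l₁ := A) (l₂ := B)).nodup_iff.2
      (List.nodup_cons.2 ⟨hnew, hL.nodup⟩)
    exact this
  · intro u hu
    rw [List.perm_middle.mem_iff, List.mem_cons] at hu
    change 1 ≤ u ∧ u ≤ σ.cnt + 1
    rcases hu with rfl | hu
    · omega
    · have := hL.bound u hu; omega
  · exact hL.fnode.trans (Nat.le_succ _)
  · intro p hp
    by_cases hpb : p = b
    · subst hpb
      simp [Mach.push, hb]
    · have hp' : σ.tok p ≠ 0 := by simpa [Mach.push, hpb] using hp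
      obtain ⟨h1, h2, h3⟩ := hL.alive p hp'
      have : (σ.push b t par c).tok p = σ.tok p := by simp [Mach.push, hpb]
      rw [this, hown _ h2]
      refine ⟨hact p h1, ?_, h3⟩
      rw [List.perm_middle.mem_iff]
      exact List.mem_cons_of_mem _ h2
  · have hs := hL.sorted
    rw [List.pairwise_append] at hs ⊢
    obtain ⟨s1, s2, s3⟩ := hs
    refine ⟨?_, ?_, ?_⟩
    · exact s1.imp_of_mem fun {u v} hu hv h =>
        hR u (List.mem_append_left _ hu) v (List.mem_append_left _ hv) h
    · rw [List.pairwise_cons]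
      refine ⟨fun v hv _ h2 => ?_, s2.imp_of_mem fun {u v} hu hv h =>
        hR u (List.mem_append_right _ hu) v (List.mem_append_right _ hv) h⟩
      have hv' : v ∈ A ++ B := List.mem_append_right _ hv
      obtain ⟨h2, h2'⟩ := hval v hv' h2
      rw [hnown, hown v hv']
      exact hB v hv h2 h2'
    · intro u hu v hv
      have hu' : u ∈ A ++ B := List.mem_append_left _ hu
      rw [List.mem_cons] at hv
      rcases hv with rfl | hv
      · intro h1 _
        obtain ⟨h1, h1'⟩ := hval u hu' h1
        rw [hnown, hown u hu']
        exact hA u hu h1 h1'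
      · exact hR u hu' v (List.mem_append_right _ hv) (s3 u hu v hv)

/-- The new token gets a fresh number above all others. Its parent is older, so the new set is
defined without changing any set that earlier tokens stand for. -/
theorem Sound.push {d d' : Set Ev} {σ : Mach} {S : ℕ → Finset ℕ} (hS : G.Sound d σ S)
    {b t par : ℕ} {c : ℝ} (hpt : ∀ i, Ev.pt i ∈ d' → Ev.pt i ∈ d) (hb : b < G.m)
    (hpar : par ≤ σ.cnt) (htok : ∀ b, σ.tok b ≤ σ.cnt) (hf : σ.fnode ≤ σ.cnt)
    (hc : ∑ k ∈ insert b (S par), G.W k ≤ c)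
    (hcov : ∀ i, Ev.pt i ∈ d → ∃ k ∈ insert b (S par), G.Cov k i) :
    G.Sound d' (σ.push b t par c) (Function.update S (σ.cnt + 1) (insert b (S par))) := by
  have hSl : ∀ u ≤ σ.cnt, Function.update S (σ.cnt + 1) (insert b (S par)) u = S u := fun u hu =>
    Function.update_of_ne (by omega) _ _
  have hl : ∀ {α : Type} (f : ℕ → α) (v : α) u, u ≤ σ.cnt →
      Function.update f (σ.cnt + 1) v u = f u := fun f v u hu =>
    Function.update_of_ne (by omega) _ _
  refine ⟨by rw [hSl 0 (by omega)]; exact hS.zero, ?_, ?_, ?_, ?_, ?_, ?_⟩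
  · intro u h1 h2
    change u ≤ σ.cnt + 1 at h2
    rcases Nat.lt_or_ge σ.cnt u with h | h
    · obtain rfl : u = σ.cnt + 1 := by omega
      simp [Mach.push]; omega
    · simpa [Mach.push, hl _ _ u h] using hS.npar u h1 h
  · intro u h1 h2
    change u ≤ σ.cnt + 1 at h2
    rcases Nat.lt_or_ge σ.cnt u with h | h
    · obtain rfl : u = σ.cnt + 1 := by omega
      simpa [Mach.push] using hb
    · simpa [Mach.push, hl _ _ u h] using hS.owner u h1 h
  · intro u h1 h2
    change u ≤ σ.cnt + 1 at h2
    rcases Nat.lt_or_ge σ.cnt u with h | h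
    · obtain rfl : u = σ.cnt + 1 := by omega
      simp [Mach.push, hl S _ par hpar]
    · have := hS.npar u h1 h
      simpa [Mach.push, hl _ _ u h, hl S _ (σ.npar u) (by omega)] using hS.eq u h1 h
  · intro u h2
    change u ≤ σ.cnt + 1 at h2
    rcases Nat.lt_or_ge σ.cnt u with h | h
    · obtain rfl : u = σ.cnt + 1 := by omega
      simpa [Mach.push] using hc
    · simpa [Mach.push, hl _ _ u h] using hS.sum u h
  · intro p hp i hi
    by_cases hpb : p = b
    · subst hpb
      simpa [Mach.push] using hcov i (hpt i hi)
    · have hp' : (σ.push b t par c).tok p = σ.tok p := by simp [Mach.push, hpb]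
      rw [hp', hSl _ (htok p)]
      exact hS.cov p (hp' ▸ hp) i (hpt i hi)
  · intro h i hi
    rw [show (σ.push b t par c).fnode = σ.fnode from rfl, hSl _ hf]
    exact hS.covF h i (hpt i hi)

/-! ### The events preserve the order of the list -/

section events
variable {d : Set Ev} {σ : Mach} {L : List ℕ} {S : ℕ → Finset ℕ} {T : Finset ℕ}

theorem At.active_ins_iff {b : ℕ} (A : G.At d (.ins b)) (hv : G.Valid) {k : ℕ} :
    G.Active (insert (.ins b) d) k ↔ G.Active d k ∨ k = b := by
  have hb : b < G.m := A.isEvent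
  have hr := hv.R_pos b hb
  have : Ev.rem b ∉ d := A.notMem (key_lt_iff.2 (.inl (by simp only [pos, lo, hi]; linarith)))
  simp only [Active, Set.mem_insert_iff, Ev.ins.injEq, reduceCtorEq, false_or]
  constructor
  · rintro ⟨h1, rfl | h2, h3⟩
    · exact .inr rfl
    · exact .inl ⟨h1, h2, h3⟩
  · rintro (⟨h1, h2, h3⟩ | rfl)
    · exact ⟨h1, .inr h2, h3⟩
    · exact ⟨hb, .inl rfl, this⟩

theorem At.not_active_ins {b : ℕ} (A : G.At d (.ins b)) : ¬ G.Active d b := fun h =>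
  A.not_mem h.2.1

theorem active_crs_iff {a b k : ℕ} : G.Active (insert (.crs a b) d) k ↔ G.Active d k := by
  simp [Active]

theorem active_pt_iff {i k : ℕ} : G.Active (insert (.pt i) d) k ↔ G.Active d k := by
  simp [Active]

theorem active_rem_iff {k l : ℕ} :
    G.Active (insert (.rem k) d) l ↔ G.Active d l ∧ l ≠ k := by
  simp only [Active, Set.mem_insert_iff, Ev.rem.injEq, reduceCtorEq, false_or, not_or]
  tauto

theorem At.active_rem {k : ℕ} (A : G.At d (.rem k)) (hv : G.Valid) : G.Active d k := by
  have hk : k < G.m := A.isEvent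
  have hr := hv.R_pos k hk
  exact ⟨hk, A.mem (e := .ins k) hk
    (key_lt_iff.2 (.inl (by simp only [pos, lo, hi]; linarith))), A.not_mem⟩

/-- A disk that is overtaken is overtaken by an active disk. -/
theorem At.active_crs {a b : ℕ} (A : G.At d (.crs a b)) (hv : G.Valid) (ha : G.Active d a) :
    G.Active d b := by
  obtain ⟨ha', hb, hab, -⟩ := A.isEvent
  have h1 := A.nonneg ha
  have h2 : G.h a (G.pos (.crs a b)) ≤ G.h b (G.pos (.crs a b)) := (h_le_iff hab _).2 le_rfl
  obtain ⟨h3, h4⟩ := range_of_h_nonneg (hv.R_pos b hb) (h1.trans h2)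
  refine ⟨hb, A.mem (e := .ins b) hb (key_lt_iff.2 ?_), A.notMem (key_lt_iff.2 ?_)⟩
  · rcases h3.lt_or_eq with h | h
    · exact .inl h
    · exact .inr ⟨h, .inl (by simp [Ev.level])⟩
  · rcases h4.lt_or_eq with h | h
    · exact .inl h
    · exact .inr ⟨h, .inl (by simp [Ev.level])⟩

/-- A disk that covers a point is active when the point is reached. -/
theorem At.active_pt {i k : ℕ} (A : G.At d (.pt i)) (hv : G.Valid) (hk : k < G.m)
    (hc : G.Cov k i) : G.Active d k := by
  have h1 : 0 ≤ G.h k (G.pos (.pt i)) := (mul_self_nonneg _).trans hc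
  obtain ⟨h3, h4⟩ := range_of_h_nonneg (hv.R_pos k hk) h1
  refine ⟨hk, A.mem (e := .ins k) hk (key_lt_iff.2 ?_), A.notMem (key_lt_iff.2 ?_)⟩
  · rcases h3.lt_or_eq with h | h
    · exact .inl h
    · exact .inr ⟨h, .inl (by simp [Ev.level])⟩
  · rcases h4.lt_or_eq with h | h
    · exact .inl h
    · exact .inr ⟨h, .inl (by simp [Ev.level])⟩

theorem ListInv.congr {d' : Set Ev} (hL : G.ListInv d σ L)
    (hact : ∀ p, G.Active d p → G.Active d' p)
    (hbel : ∀ p q, G.Below d p q → G.Below d' p q) : G.ListInv d' σ L :=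
  { hL with
    alive := fun b hb => ⟨hact b (hL.alive b hb).1, (hL.alive b hb).2⟩
    sorted := hL.sorted.imp fun h h1 h2 => hbel _ _ (h h1 h2) }

theorem ListInv.onIns {b : ℕ} (hL : G.ListInv d σ L) (A : G.At d (.ins b)) (hv : G.Valid) (w : ℝ) :
    ∃ L', G.ListInv (insert (.ins b) d) (σ.onIns w b) L' ∧ L'.length ≤ L.length + 1 := by
  have hact : ∀ p, G.Active d p → G.Active (insert (.ins b) d) p := fun p hp =>
    (A.active_ins_iff hv).2 (.inl hp)
  have hbel : ∀ p q, G.Below d p q → G.Below (insert (.ins b) d) p q := fun p q h =>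
    (below_insert_iff (by simp) (by simp)).2 h
  unfold Mach.onIns
  split_ifs with hf
  · exact ⟨L, hL.congr hact hbel, by omega⟩
  · refine ⟨_, ListInv.push (A := []) (B := L) hL rfl ((A.active_ins_iff hv).2 (.inr rfl)) hact
      (fun p q _ _ h => hbel p q h) (by simp) fun u hu h1 h2 => hbel _ _ ?_, by simp⟩
    have hu0 : σ.tok (σ.owner u) ≠ 0 := by have := (hL.bound u hu).1; omega
    exact A.ins_below hv (hL.alive _ hu0).1 h2

/-- By `At.below_crs_iff` every third disk compares with `b` as it does with `a`, so the position
directly after the token of `a` is right for the new token of `b`. -/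
theorem ListInv.onCrs {a b : ℕ} (hL : G.ListInv d σ L) (A : G.At d (.crs a b)) (hv : G.Valid)
    (w : ℝ) :
    ∃ L', G.ListInv (insert (.crs a b) d) (σ.onCrs w a b) L' ∧ L'.length ≤ L.length + 1 := by
  have hab : G.C a < G.C b := A.isEvent.2.2.1
  have hne : a ≠ b := by rintro rfl; exact lt_irrefl _ hab
  have hact : ∀ p, G.Active d p → G.Active (insert (.crs a b) d) p := fun p hp =>
    active_crs_iff.2 hp
  have hbel : ∀ p q, p ≠ b → q ≠ b → G.Below d p q → G.Below (insert (.crs a b) d) p q :=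
    fun p q hp hq h => (below_insert_iff (by simp [Ne.symm hq]) (by simp [Ne.symm hp])).2 h
  unfold Mach.onCrs
  by_cases hta : σ.tok a = 0
  -- Without a token of `a`, the reversed pair does not occur among the current tokens, and the list
  -- stays ordered.
  · rw [if_pos hta]
    refine ⟨L, { hL with alive := fun p hp => ⟨hact p (hL.alive p hp).1, (hL.alive p hp).2⟩, sorted := ?_ },
      by omega⟩
    refine hL.sorted.imp_of_mem fun {u v} hu hv' h h1 h2 => ?_
    have hua : σ.owner u ≠ a := by rintro rfl; have := (hL.bound u hu).1; omega
    have hva : σ.owner v ≠ a := by rintro rfl; have := (hL.bound v hv').1; omega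
    exact (below_insert_iff (by simp [Ne.symm hua]) (by simp [Ne.symm hva])).2 (h h1 h2)
  · rw [if_neg hta]
    obtain ⟨haA, haL, hao⟩ := hL.alive a hta
    have hbA := A.active_crs hv haA
    obtain ⟨L₁, L₂, rfl⟩ := List.append_of_mem haL
    have hL' : G.ListInv d σ ((L₁ ++ [σ.tok a]) ++ L₂) := by simpa using hL
    have hal : ∀ u ∈ (L₁ ++ [σ.tok a]) ++ L₂, σ.tok (σ.owner u) = u → G.Active d (σ.owner u) := by
      intro u hu h
      have := (hL'.bound u hu).1
      exact (hL'.alive _ (by omega)).1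
    have hP : ∀ par c, G.ListInv (insert (.crs a b) d) (σ.push b (σ.tok a) par c)
        ((L₁ ++ [σ.tok a]) ++ (σ.cnt + 1) :: L₂) := by
      intro par c
      have hs := hL.sorted
      rw [List.pairwise_append, List.pairwise_cons] at hs
      obtain ⟨-, ⟨s2, -⟩, s3⟩ := hs
      refine ListInv.push hL' (by simp) (hact b hbA) hact hbel ?_ ?_
      · intro u hu h1 h2
        have hact' := hal u (List.mem_append_left _ hu) h1
        rw [List.mem_append, List.mem_singleton] at hu
        rcases hu with hu | rfl
        · have hB := s3 u hu (σ.tok a) (by simp) h1 (by rw [hao])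
          rw [hao] at hB
          have hua : σ.owner u ≠ a := by
            intro h
            rw [h] at hB
            exact hB.asymm hB
          exact (below_insert_iff (by simp [Ne.symm hua]) (by simp [hne])).2
            ((A.below_crs_iff hv haA hbA hact' hua h2).1 hB)
        · rw [hao]
          exact ⟨fun _ => Set.mem_insert _ _, fun h => absurd h hab.not_gt, fun h => absurd h hab.ne⟩
      · intro u hu h1 h2
        have hact' := hal u (List.mem_append_right _ hu) h1
        have hB := s2 u hu (by rw [hao]) h1
        rw [hao] at hB
        have hua : σ.owner u ≠ a := by
          intro h
          rw [h] at hB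
          exact hB.asymm hB
        have hiff := A.below_crs_iff hv haA hbA hact' hua h2
        refine (below_insert_iff (by simp [hne]) (by simp [Ne.symm hua])).2 ?_
        rcases Below.total hv d hbA.1 hact'.1 (Ne.symm h2) with h | h
        · exact h
        · exact absurd (hiff.2 h) hB.asymm
    split_ifs with hc
    · exact ⟨_, hP _ _, by simp; omega⟩
    · exact ⟨_, hP _ _, by simp; omega⟩

/-- The token of `k` is not unlinked; it merely ceases to be current and is discarded when it
reaches the front. -/
theorem ListInv.onRem {k : ℕ} (hL : G.ListInv d σ L) :
    G.ListInv (insert (.rem k) d) (σ.onRem k) L := by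
  have hbel : ∀ p q, G.Below d p q → G.Below (insert (.rem k) d) p q := fun p q h =>
    (below_insert_iff (by simp) (by simp)).2 h
  by_cases hk : σ.tok k = 0
  · rw [Mach.onRem, if_pos hk]
    refine { hL with alive := fun b hb => ⟨?_, (hL.alive b hb).2⟩, sorted := ?_ }
    · refine active_rem_iff.2 ⟨(hL.alive b hb).1, ?_⟩
      rintro rfl; exact hb hk
    · exact hL.sorted.imp fun h h1 h2 => hbel _ _ (h h1 h2)
  · have hal : ∀ b, Function.update σ.tok k 0 b ≠ 0 → G.Active (insert (.rem k) d) b ∧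
        Function.update σ.tok k 0 b ∈ L ∧ σ.owner (Function.update σ.tok k 0 b) = b := by
      intro b hb
      have hbk : b ≠ k := by rintro rfl; simp at hb
      rw [Function.update_of_ne hbk] at hb ⊢
      obtain ⟨h1, h2, h3⟩ := hL.alive b hb
      exact ⟨active_rem_iff.2 ⟨h1, hbk⟩, h2, h3⟩
    have hval : ∀ u ∈ L, Function.update σ.tok k 0 (σ.owner u) = u → σ.tok (σ.owner u) = u := by
      intro u hu h
      by_cases hb : σ.owner u = k
      · rw [hb, Function.update_self] at h
        have := (hL.bound u hu).1
        omega
      · rwa [Function.update_of_ne hb] at h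
    have hs : L.Pairwise fun u v => Function.update σ.tok k 0 (σ.owner u) = u →
        Function.update σ.tok k 0 (σ.owner v) = v →
        G.Below (insert (.rem k) d) (σ.owner u) (σ.owner v) :=
      hL.sorted.imp_of_mem fun {u v} hu hv h h1 h2 => hbel _ _ (h (hval u hu h1) (hval v hv h2))
    unfold Mach.onRem
    rw [if_neg hk]
    split_ifs with hc
    · exact ⟨hL.linked, hL.nodup, hL.bound, hL.fnode, hal, hs⟩
    · exact ⟨hL.linked, hL.nodup, hL.bound, hL.tok_le, hal, hs⟩

/-- `tok` is cleared only if the front token is current. A superseded token disappears without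
affecting the newer token of its disk. -/
theorem ListInv.pop {u : ℕ} (hL : G.ListInv d σ (u :: L)) : G.ListInv d σ.pop L := by
  have hnu : σ.next 0 = u := hL.linked.1
  have hu1 := (hL.bound u (by simp)).1
  have hsub : ∀ b, σ.pop.tok b ≠ 0 → σ.pop.tok b = σ.tok b ∧ σ.tok b ≠ u := by
    intro b hb
    simp only [Mach.pop, hnu] at hb ⊢
    split_ifs at hb ⊢ with h
    · have hbu : b ≠ σ.owner u := by rintro rfl; simp at hb
      rw [Function.update_of_ne hbu] at hb ⊢
      refine ⟨rfl, fun hbu' => hbu ?_⟩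
      rw [← hbu']
      exact ((hL.alive b hb).2.2).symm
    · refine ⟨rfl, fun hbu' => h ?_⟩
      have := (hL.alive b hb).2.2
      rw [hbu'] at this
      rw [this, hbu']
  refine ⟨?_, (List.nodup_cons.1 hL.nodup).2, fun v hv => hL.bound v (List.mem_cons_of_mem _ hv),
    hL.fnode, ?_, ?_⟩
  · have h0 : 0 ∉ L := fun h => by
      have := (hL.bound 0 (List.mem_cons_of_mem _ h)).1; omega
    have hlk := hL.linked.2
    simp only [Mach.pop, hnu]
    cases L with
    | nil => simpa [Linked] using hlk
    | cons v L =>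
      refine ⟨by simpa using hlk.1, hlk.2.congr fun x hx => ?_⟩
      have : x ≠ 0 := by rintro rfl; exact h0 hx
      simp [this]
  · intro b hb
    obtain ⟨h1, h2⟩ := hsub b hb
    rw [h1] at hb ⊢
    obtain ⟨h3, h4, h5⟩ := hL.alive b hb
    exact ⟨h3, (List.mem_cons.1 h4).resolve_left h2, h5⟩
  · refine (List.pairwise_cons.1 hL.sorted).2.imp_of_mem fun {v w} hv hw h h1 h2 => ?_
    have hv1 := (hL.bound v (List.mem_cons_of_mem _ hv)).1
    have hw1 := (hL.bound w (List.mem_cons_of_mem _ hw)).1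
    change σ.pop.tok (σ.owner v) = v at h1
    change σ.pop.tok (σ.owner w) = w at h2
    exact h ((hsub (σ.owner v) (by omega)).1.symm.trans h1)
      ((hsub (σ.owner w) (by omega)).1.symm.trans h2)

theorem ListInv.onPt (hL : G.ListInv d σ L) : G.ListInv d σ.onPt L :=
  { hL with }

end events

end Scene

namespace Scene
variable {G : Scene} {d : Set Ev} {σ : Mach} {L : List ℕ} {S : ℕ → Finset ℕ} {T : Finset ℕ}

/-! ### The events preserve soundness -/

theorem sum_insert_le {s : Finset ℕ} {b : ℕ} (hb : 0 ≤ G.W b) :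
    ∑ k ∈ insert b s, G.W k ≤ ∑ k ∈ s, G.W k + G.W b := by
  by_cases h : b ∈ s
  · rw [Finset.insert_eq_of_mem h]; linarith
  · rw [Finset.sum_insert h]; linarith

theorem Sound.congr {d' : Set Ev} (hS : G.Sound d σ S) (hpt : ∀ i, Ev.pt i ∈ d' → Ev.pt i ∈ d) :
    G.Sound d' σ S :=
  { hS with
    cov := fun b hb i hi => hS.cov b hb i (hpt i hi)
    covF := fun h i hi => hS.covF h i (hpt i hi) }

theorem Sound.onIns {b : ℕ} (hS : G.Sound d σ S) (hL : G.ListInv d σ L) (A : G.At d (.ins b))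
    (hv : G.Valid) : ∃ S', G.Sound (insert (.ins b) d) (σ.onIns (G.W b) b) S' := by
  have hb : b < G.m := A.isEvent
  unfold Mach.onIns
  split_ifs with hf
  · exact ⟨S, hS.congr (by simp)⟩
  · refine ⟨_, hS.push (by simp) hb hL.fnode (fun _ => hL.tok_le) hL.fnode ?_ fun i hi => ?_⟩
    · exact (sum_insert_le (hv.W_nonneg b hb)).trans (by linarith [hS.sum _ hL.fnode])
    · obtain ⟨k, hk, hc⟩ := hS.covF hf i hi
      exact ⟨k, Finset.mem_insert_of_mem hk, hc⟩

theorem Sound.onCrs {a b : ℕ} (hS : G.Sound d σ S) (hL : G.ListInv d σ L)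
    (A : G.At d (.crs a b)) (hv : G.Valid) :
    ∃ S', G.Sound (insert (.crs a b) d) (σ.onCrs (G.W b) a b) S' := by
  have hb : b < G.m := A.isEvent.2.1
  unfold Mach.onCrs
  split_ifs with hf hc
  · exact ⟨S, hS.congr (by simp)⟩
  -- The old set of `b` is cheaper. The new token duplicates it, with the same parent and cost, only
  -- to occupy the new place in the list.
  · obtain ⟨h1, h2, h3⟩ := hL.alive b hc.1
    have hlt := hS.npar (σ.tok b) (by omega) hL.tok_le
    have heq := hS.eq (σ.tok b) (by omega) hL.tok_le
    rw [h3] at heq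
    refine ⟨_, hS.push (by simp) hb (hlt.le.trans hL.tok_le) (fun _ => hL.tok_le) hL.fnode ?_
      fun i hi => ?_⟩
    · rw [← heq]
      exact hS.sum _ hL.tok_le
    · rw [← heq]
      exact hS.cov b hc.1 i hi
  · refine ⟨_, hS.push (by simp) hb hL.tok_le (fun _ => hL.tok_le) hL.fnode ?_ fun i hi => ?_⟩
    · exact (sum_insert_le (hv.W_nonneg b hb)).trans
        (by linarith [hS.sum (σ.tok a) hL.tok_le])
    · obtain ⟨k, hk, hc⟩ := hS.cov a hf i hi
      exact ⟨k, Finset.mem_insert_of_mem hk, hc⟩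

theorem Sound.onRem {k : ℕ} (hS : G.Sound d σ S) :
    G.Sound (insert (.rem k) d) (σ.onRem k) S := by
  have hcov : ∀ b, Function.update σ.tok k 0 b ≠ 0 → ∀ i, Ev.pt i ∈ insert (Ev.rem k) d →
      ∃ l ∈ S (Function.update σ.tok k 0 b), G.Cov l i := by
    intro b hb i hi
    have hbk : b ≠ k := by rintro rfl; simp at hb
    rw [Function.update_of_ne hbk] at hb ⊢
    exact hS.cov b hb i (by simpa using hi)
  unfold Mach.onRem
  split_ifs with hk hc
  · exact hS.congr (by simp)
  · exact { hS with cov := hcov, covF := fun h i hi => hS.covF h i (by simpa using hi) }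
  · exact { hS with cov := hcov, covF := fun _ i hi => hS.cov k hk i (by simpa using hi) }

theorem Sound.onPt (hS : G.Sound d σ S) : G.Sound d σ.onPt S :=
  { hS with covF := fun h => absurd rfl h }

theorem Sound.pop (hS : G.Sound d σ S) : G.Sound d σ.pop S := by
  refine { hS with cov := fun b hb i hi => ?_ }
  have : σ.pop.tok b = σ.tok b := by
    simp only [Mach.pop] at hb ⊢
    split_ifs at hb ⊢ with h
    · have hbu : b ≠ σ.owner (σ.next 0) := by rintro rfl; simp at hb
      rw [Function.update_of_ne hbu]
    · rfl
  rw [this] at hb ⊢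
  exact hS.cov b hb i hi

/-- The set of a current token contains its owner, so it suffices that the owners contain the new
point. Finished tokens need no check, since `fok` has been reset. -/
theorem Sound.insert_pt {i : ℕ} (hS : G.Sound d σ S) (hL : G.ListInv d σ L) (hf : σ.fok = 0)
    (hc : ∀ b, σ.tok b ≠ 0 → G.Cov b i) : G.Sound (insert (.pt i) d) σ S := by
  refine { hS with cov := fun b hb j hj => ?_, covF := fun h => absurd hf h }
  rcases hj with hj | hj
  · obtain rfl : j = i := by simpa using hj
    refine ⟨b, ?_, hc b hb⟩
    rw [hS.eq (σ.tok b) (by omega) hL.tok_le, (hL.alive b hb).2.2]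
    exact Finset.mem_insert_self _ _
  · exact hS.cov b hb j hj

/-! ### The events preserve optimality -/

/-- The disk `a` and all disks left of `a` are counted among the disks left of `b`. This is what
makes an overtaking affordable. -/
theorem prefixWeight_add_le {a b : ℕ} (hT : T ⊆ Finset.range G.m) (hv : G.Valid) (ha : a ∈ T)
    (hab : G.C a < G.C b) : G.prefixWeight T a + G.W b ≤ G.prefixWeight T b := by
  unfold prefixWeight
  have hnot : a ∉ T.filter fun l => G.C l < G.C a := by simp
  have : ∑ l ∈ insert a (T.filter fun l => G.C l < G.C a), G.W l ≤
      ∑ l ∈ T.filter fun l => G.C l < G.C b, G.W l := by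
    refine Finset.sum_le_sum_of_subset_of_nonneg (fun l hl => ?_) fun l hl _ => ?_
    · rw [Finset.mem_insert, Finset.mem_filter] at hl
      rw [Finset.mem_filter]
      rcases hl with rfl | ⟨h1, h2⟩
      · exact ⟨ha, hab⟩
      · exact ⟨h1, h2.trans hab⟩
    · exact hv.W_nonneg l (Finset.mem_range.1 (hT (Finset.mem_filter.1 hl).1))
  rw [Finset.sum_insert hnot] at this
  linarith

theorem Mach.push_tok_ne (σ : Mach) {b k t par : ℕ} {c : ℝ} (h : k ≠ b) :
    (σ.push b t par c).tok k = σ.tok k := by simp [Mach.push, h]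

theorem Mach.push_cost_le (σ : Mach) {b t par u : ℕ} {c : ℝ} (h : u ≤ σ.cnt) :
    (σ.push b t par c).cost u = σ.cost u := by
  simp [Mach.push, show u ≠ σ.cnt + 1 by omega]

theorem Mach.push_tok_self (σ : Mach) {b t par : ℕ} {c : ℝ} :
    (σ.push b t par c).tok b ≠ 0 ∧ (σ.push b t par c).cost ((σ.push b t par c).tok b) = c := by
  simp [Mach.push]

theorem Opt.onIns {b : ℕ} (hO : G.Opt T d σ) (hL : G.ListInv d σ L) (A : G.At d (.ins b))
    (hv : G.Valid) (hT : T ⊆ Finset.range G.m) :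
    G.Opt T (insert (.ins b) d) (σ.onIns (G.W b) b) := by
  have hb : b < G.m := A.isEvent
  have hbel : ∀ p q, G.Below (insert (.ins b) d) p q ↔ G.Below d p q := fun p q =>
    below_insert_iff (by simp) (by simp)
  -- A disk that ended before `b` begins has its centre left of that of `b`.
  have hfin : (∀ k ∈ T, ¬ G.Active d k) →
      σ.cost σ.fnode ≤ ∑ l ∈ T with G.C l < G.C b, G.W l := by
    intro h
    refine (hO.fin h).2.trans (doneWeight_le (fun l hl => hv.W_nonneg l (Finset.mem_range.1 (hT hl)))
      fun l hl hrem => ?_)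
    have h1 : G.hi l ≤ G.lo b := A.pos_le hrem
    have h2 := hv.R_pos l (Finset.mem_range.1 (hT hl))
    have h3 := hv.R_pos b hb
    unfold hi lo at h1
    linarith
  constructor
  · intro k hk hka htop
    rcases (A.active_ins_iff hv).1 hka with hka' | rfl
    · have hkb : k ≠ b := by rintro rfl; exact A.not_active_ins hka'
      obtain ⟨h1, h2⟩ := hO.top k hk hka' fun l hl hla hlk =>
        (hbel _ _).1 (htop l hl ((A.active_ins_iff hv).2 (.inl hla)) hlk)
      unfold Mach.onIns
      split_ifs with hf
      · exact ⟨h1, h2⟩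
      · rw [Mach.push_tok_ne _ hkb, Mach.push_cost_le _ hL.tok_le]
        exact ⟨h1, h2⟩
    -- The new disk enters at the bottom. It can be the highest of `T` only if `T` has no other
    -- active disk, and then the finished token extended by it meets the bound.
    · have hno : ∀ l ∈ T, ¬ G.Active d l := by
        intro l hl hla
        have hlk : l ≠ k := by rintro rfl; exact A.not_active_ins hla
        have h1 := htop l hl ((A.active_ins_iff hv).2 (.inl hla)) hlk
        exact ((hbel _ _).1 h1).asymm (A.ins_below hv hla hlk)
      have hf := (hO.fin hno).1
      rw [Mach.onIns, if_neg hf]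
      obtain ⟨h1, h2⟩ := Mach.push_tok_self σ (b := k) (t := 0) (par := σ.fnode)
        (c := σ.cost σ.fnode + G.W k)
      refine ⟨h1, h2.le.trans ?_⟩
      unfold prefixWeight
      linarith [hfin hno]
  · intro hno
    have hno' : ∀ k ∈ T, ¬ G.Active d k := fun k hk hka =>
      hno k hk ((A.active_ins_iff hv).2 (.inl hka))
    obtain ⟨h1, h2⟩ := hO.fin hno'
    rw [Mach.onIns, if_neg h1]
    refine ⟨h1, ?_⟩
    change (σ.push b 0 σ.fnode (σ.cost σ.fnode + G.W b)).cost σ.fnode ≤ _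
    rw [Mach.push_cost_le _ hL.fnode]
    exact h2.trans (doneWeight_congr fun l _ => by simp).ge

/-- The highest active disk of `T` changes only from `a` to `b`, when both belong to `T`; then the
token of `a` extended by `b` is cheap enough. In all other cases the highest disk is unchanged, and
its current token has not become dearer. -/
theorem Opt.onCrs {a b : ℕ} (hO : G.Opt T d σ) (hL : G.ListInv d σ L) (A : G.At d (.crs a b))
    (hv : G.Valid) (hT : T ⊆ Finset.range G.m) :
    G.Opt T (insert (.crs a b) d) (σ.onCrs (G.W b) a b) := by
  have hab : G.C a < G.C b := A.isEvent.2.2.1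
  have hne : a ≠ b := by rintro rfl; exact lt_irrefl _ hab
  have hother : ∀ k, k ≠ b → (σ.onCrs (G.W b) a b).tok k = σ.tok k ∧
      (σ.onCrs (G.W b) a b).cost (σ.tok k) = σ.cost (σ.tok k) := by
    intro k hkb
    unfold Mach.onCrs
    split_ifs with h1 h2
    · exact ⟨rfl, rfl⟩
    · exact ⟨Mach.push_tok_ne _ hkb, Mach.push_cost_le _ hL.tok_le⟩
    · exact ⟨Mach.push_tok_ne _ hkb, Mach.push_cost_le _ hL.tok_le⟩
  have hbold : σ.tok b ≠ 0 → (σ.onCrs (G.W b) a b).tok b ≠ 0 ∧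
      (σ.onCrs (G.W b) a b).cost ((σ.onCrs (G.W b) a b).tok b) ≤ σ.cost (σ.tok b) := by
    intro h
    unfold Mach.onCrs
    split_ifs with h1 h2
    · exact ⟨h, le_rfl⟩
    · exact ⟨(Mach.push_tok_self σ).1, (Mach.push_tok_self σ).2.le⟩
    · refine ⟨(Mach.push_tok_self σ).1, (Mach.push_tok_self σ).2.le.trans ?_⟩
      have := fun h' => h2 ⟨h, h'⟩
      exact (not_le.1 this).le
  have hbnew : σ.tok a ≠ 0 → (σ.onCrs (G.W b) a b).tok b ≠ 0 ∧
      (σ.onCrs (G.W b) a b).cost ((σ.onCrs (G.W b) a b).tok b) ≤ σ.cost (σ.tok a) + G.W b := by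
    intro h
    rw [Mach.onCrs, if_neg h]
    split_ifs with h2
    · exact ⟨(Mach.push_tok_self σ).1, (Mach.push_tok_self σ).2.le.trans h2.2⟩
    · exact ⟨(Mach.push_tok_self σ).1, (Mach.push_tok_self σ).2.le⟩
  constructor
  · intro k hk hka htop
    rw [active_crs_iff] at hka
    by_cases hcase : k = b ∧ a ∈ T ∧ G.Active d a
    · obtain ⟨rfl, haT, haA⟩ := hcase
      have h1 := hO.top a haT haA fun l hl hla hlne => by
        by_cases hlk : l = k
        · subst hlk
          exact ⟨fun h => absurd h hab.not_gt, fun _ => A.not_mem, fun h => absurd h hab.ne'⟩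
        · refine (A.below_crs_iff hv haA hka hla hlne hlk).2 ?_
          exact (htop l hl (active_crs_iff.2 hla) hlk).of_insert (by simp [Ne.symm hlne])
      obtain ⟨h2, h3⟩ := hbnew h1.1
      exact ⟨h2, h3.trans ((add_le_add_left h1.2 _).trans (prefixWeight_add_le hT hv haT hab))⟩
    · obtain ⟨h1, h2⟩ := hO.top k hk hka fun l hl hla hlk => by
        refine (htop l hl (active_crs_iff.2 hla) hlk).of_insert fun he => ?_
        simp only [Ev.crs.injEq] at he
        obtain ⟨rfl, rfl⟩ := he
        exact hcase ⟨rfl, hl, hla⟩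
      by_cases hkb : k = b
      · subst hkb
        obtain ⟨h3, h4⟩ := hbold h1
        exact ⟨h3, h4.trans h2⟩
      · obtain ⟨h3, h4⟩ := hother k hkb
        rw [h3, h4]
        exact ⟨h1, h2⟩
  · intro hno
    obtain ⟨h1, h2⟩ := hO.fin fun k hk hka => hno k hk (active_crs_iff.2 hka)
    have h3 : (σ.onCrs (G.W b) a b).fok = σ.fok ∧ (σ.onCrs (G.W b) a b).fnode = σ.fnode ∧
        (σ.onCrs (G.W b) a b).cost σ.fnode = σ.cost σ.fnode := by
      unfold Mach.onCrs
      split_ifs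
      · exact ⟨rfl, rfl, rfl⟩
      · exact ⟨rfl, rfl, Mach.push_cost_le _ hL.fnode⟩
      · exact ⟨rfl, rfl, Mach.push_cost_le _ hL.fnode⟩
    rw [h3.1, h3.2.1, h3.2.2]
    exact ⟨h1, h2.trans (doneWeight_congr fun l _ => by simp).ge⟩

/-- Forgetting the finished tokens is harmless: `T` contains a disk over the point, and such a disk
is active, so the clause about finished tokens is vacuous. -/
theorem Opt.onPt {i : ℕ} (hO : G.Opt T d σ) (A : G.At d (.pt i)) (hv : G.Valid)
    (hT : T ⊆ Finset.range G.m) (hc : ∃ k ∈ T, G.Cov k i) :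
    G.Opt T (insert (.pt i) d) σ.onPt := by
  constructor
  · intro k hk hka htop
    rw [active_pt_iff] at hka
    exact hO.top k hk hka fun l hl hla hlk =>
      (below_insert_iff (by simp) (by simp)).1 (htop l hl (active_pt_iff.2 hla) hlk)
  · intro hno
    obtain ⟨k, hk, hkc⟩ := hc
    exact absurd (active_pt_iff.2 (A.active_pt hv (Finset.mem_range.1 (hT hk)) hkc)) (hno k hk)

/-- The highest active disk of `T` is at least as high as the one that contains the point, so it
contains the point too. A current token that is popped belongs to a disk that misses the point,
hence to another disk. -/
theorem Opt.pop {i : ℕ} (hO : G.Opt T (insert (.pt i) d) σ)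
    (A : G.At d (.pt i)) (hv : G.Valid) (hT : T ⊆ Finset.range G.m) (hc : ∃ k ∈ T, G.Cov k i)
    (hp : σ.tok (σ.owner (σ.next 0)) = σ.next 0 → ¬ G.Cov (σ.owner (σ.next 0)) i) :
    G.Opt T (insert (.pt i) d) σ.pop := by
  obtain ⟨k₀, hk₀, hkc₀⟩ := hc
  have hact := A.active_pt hv (Finset.mem_range.1 (hT hk₀)) hkc₀
  constructor
  · intro k hk hka htop
    obtain ⟨h1, h2⟩ := hO.top k hk hka htop
    have hcov : G.Cov k i := by
      by_cases h : k₀ = k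
      · rwa [← h]
      · have hb := (below_insert_iff (by simp) (by simp)).1 (htop k₀ hk₀ (active_pt_iff.2 hact) h)
        exact le_trans hkc₀ (A.below_le hv hact (active_pt_iff.1 hka) hb)
    have : σ.pop.tok k = σ.tok k := by
      simp only [Mach.pop]
      split_ifs with h
      · have : k ≠ σ.owner (σ.next 0) := by
          rintro rfl; exact hp h hcov
        rw [Function.update_of_ne this]
      · rfl
    rw [this]
    exact ⟨h1, h2⟩
  · intro hno
    exact absurd (active_pt_iff.2 hact) (hno k₀ hk₀)

/-- The ending disk is lowest, so it is the highest of `T` only if it is the last active one. The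
disks of `T` with smaller centres have then all ended: they have begun, since a disk beginning right
of the end of `k` has a larger centre, and they are not active. -/
theorem Opt.onRem {k : ℕ} (hO : G.Opt T d σ) (A : G.At d (.rem k)) (hv : G.Valid)
    (hT : T ⊆ Finset.range G.m) : G.Opt T (insert (.rem k) d) (σ.onRem k) := by
  have hkA := A.active_rem hv
  have hbel : ∀ p q, G.Below (insert (.rem k) d) p q ↔ G.Below d p q := fun p q =>
    below_insert_iff (by simp) (by simp)
  have hcost : (σ.onRem k).cost = σ.cost := by
    unfold Mach.onRem; split_ifs <;> rfl
  constructor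
  · intro l hl hla htop
    obtain ⟨hla', hlk⟩ := active_rem_iff.1 hla
    obtain ⟨h1, h2⟩ := hO.top l hl hla' fun j hj hja hjl => by
      by_cases hjk : j = k
      · subst hjk
        exact A.rem_below hv hkA hla' hlk
      · exact (hbel _ _).1 (htop j hj (active_rem_iff.2 ⟨hja, hjk⟩) hjl)
    have : (σ.onRem k).tok l = σ.tok l := by
      unfold Mach.onRem; split_ifs <;> simp [hlk]
    rw [this, hcost]
    exact ⟨h1, h2⟩
  · intro hno
    rw [hcost]
    by_cases hkT : k ∈ T
    · have hno' : ∀ j ∈ T, G.Active d j → j = k := fun j hj hja => by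
        by_contra hjk
        exact hno j hj (active_rem_iff.2 ⟨hja, hjk⟩)
      obtain ⟨h1, h2⟩ := hO.top k hkT hkA fun l hl hla hlk => absurd (hno' l hl hla) hlk
      have h3 : (σ.onRem k).fok ≠ 0 ∧ σ.cost (σ.onRem k).fnode ≤ σ.cost (σ.tok k) := by
        rw [Mach.onRem, if_neg h1]
        split_ifs with hc
        · exact hc
        · exact ⟨one_ne_zero, le_rfl⟩
      refine ⟨h3.1, h3.2.trans (h2.trans ?_)⟩
      unfold prefixWeight
      have hnot : k ∉ T.filter fun l => G.C l < G.C k := by simp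
      rw [← Finset.sum_insert hnot]
      refine le_doneWeight (fun l hl => hv.W_nonneg l (Finset.mem_range.1 (hT hl)))
        (Finset.insert_subset hkT (Finset.filter_subset _ _)) fun l hl => ?_
      · rw [Finset.mem_insert, Finset.mem_filter] at hl
        rcases hl with rfl | ⟨hlT, hlc⟩
        · exact Set.mem_insert _ _
        · refine Set.mem_insert_of_mem _ ?_
          by_contra hrem
          have hlm := Finset.mem_range.1 (hT hlT)
          have hins : Ev.ins l ∈ d := by
            by_contra hins
            have h4 : G.hi k ≤ G.lo l := A.pos_ge (e := .ins l) hlm hins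
            have h5 := hv.R_pos l hlm
            have h6 := hv.R_pos k hkA.1
            unfold hi lo at h4
            linarith
          have := hno' l hlT ⟨hlm, hins, hrem⟩
          rw [this] at hlc
          exact lt_irrefl _ hlc
    · obtain ⟨h1, h2⟩ := hO.fin fun j hj hja => hno j hj
        (active_rem_iff.2 ⟨hja, by rintro rfl; exact hkT hj⟩)
      have h3 : (σ.onRem k).fok ≠ 0 ∧ σ.cost (σ.onRem k).fnode ≤ σ.cost σ.fnode := by
        unfold Mach.onRem
        split_ifs with hc hc'
        · exact ⟨h1, le_rfl⟩
        · exact ⟨h1, le_rfl⟩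
        · refine ⟨one_ne_zero, ?_⟩
          by_contra hlt
          exact hc' ⟨h1, (not_le.1 hlt).le⟩
      refine ⟨h3.1, h3.2.trans (h2.trans (doneWeight_congr fun l hl => ?_).ge)⟩
      have : l ≠ k := by rintro rfl; exact hkT hl
      simp [this]

/-! ### The invariant of the sweep -/

/-- The set `T` of disks covers all points. -/
def CoversAll (G : Scene) (T : Finset ℕ) : Prop := ∀ i < G.n, ∃ k ∈ T, G.Cov k i

/-- The invariant of the sweep. -/
structure Inv (G : Scene) (d : Set Ev) (σ : Mach) (L : List ℕ) : Prop where
  list : G.ListInv d σ L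
  sound : ∃ S, G.Sound d σ S
  opt : ∀ T ⊆ Finset.range G.m, G.CoversAll T → G.Opt T d σ

/-- The invariant while lower disks are removed at point `i`. -/
structure PopInv (G : Scene) (d : Set Ev) (i : ℕ) (σ : Mach) (L : List ℕ) : Prop where
  fok : σ.fok = 0
  list : G.ListInv d σ L
  sound : ∃ S, G.Sound d σ S
  opt : ∀ T ⊆ Finset.range G.m, G.CoversAll T → G.Opt T (insert (.pt i) d) σ

theorem Inv.onIns {b : ℕ} (h : G.Inv d σ L) (A : G.At d (.ins b)) (hv : G.Valid) :
    ∃ L', G.Inv (insert (.ins b) d) (σ.onIns (G.W b) b) L' ∧ L'.length ≤ L.length + 1 := by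
  obtain ⟨L', hL', hlen⟩ := h.list.onIns A hv (G.W b)
  obtain ⟨S, hS⟩ := h.sound
  exact ⟨L', ⟨hL', hS.onIns h.list A hv, fun T hT hc => (h.opt T hT hc).onIns h.list A hv hT⟩, hlen⟩

theorem Inv.onCrs {a b : ℕ} (h : G.Inv d σ L) (A : G.At d (.crs a b)) (hv : G.Valid) :
    ∃ L', G.Inv (insert (.crs a b) d) (σ.onCrs (G.W b) a b) L' ∧ L'.length ≤ L.length + 1 := by
  obtain ⟨L', hL', hlen⟩ := h.list.onCrs A hv (G.W b)
  obtain ⟨S, hS⟩ := h.sound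
  exact ⟨L', ⟨hL', hS.onCrs h.list A hv, fun T hT hc => (h.opt T hT hc).onCrs h.list A hv hT⟩, hlen⟩

theorem Inv.onRem {k : ℕ} (h : G.Inv d σ L) (A : G.At d (.rem k)) (hv : G.Valid) :
    G.Inv (insert (.rem k) d) (σ.onRem k) L := by
  obtain ⟨S, hS⟩ := h.sound
  exact ⟨h.list.onRem, ⟨S, hS.onRem⟩, fun T hT hc => (h.opt T hT hc).onRem A hv hT⟩

theorem Inv.onPt {i : ℕ} (h : G.Inv d σ L) (A : G.At d (.pt i)) (hv : G.Valid) :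
    G.PopInv d i σ.onPt L := by
  obtain ⟨S, hS⟩ := h.sound
  exact ⟨rfl, h.list.onPt, ⟨S, hS.onPt⟩, fun T hT hc => (h.opt T hT hc).onPt A hv hT (hc i A.isEvent)⟩

theorem PopInv.pop {i u : ℕ} (h : G.PopInv d i σ (u :: L)) (A : G.At d (.pt i)) (hv : G.Valid)
    (hp : σ.tok (σ.owner (σ.next 0)) = σ.next 0 → ¬ G.Cov (σ.owner (σ.next 0)) i) :
    G.PopInv d i σ.pop L := by
  obtain ⟨S, hS⟩ := h.sound
  exact ⟨h.fok, h.list.pop, ⟨S, hS.pop⟩,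
    fun T hT hc => (h.opt T hT hc).pop A hv hT (hc i A.isEvent) hp⟩

/-- Popping stops at a current token whose disk contains the point. All other current tokens belong
to higher disks, which then contain it as well. -/
theorem PopInv.inv {i : ℕ} (h : G.PopInv d i σ L) (A : G.At d (.pt i)) (hv : G.Valid)
    (hp : σ.next 0 ≠ 0 → σ.tok (σ.owner (σ.next 0)) = σ.next 0 ∧ G.Cov (σ.owner (σ.next 0)) i) :
    G.Inv (insert (.pt i) d) σ L := by
  obtain ⟨S, hS⟩ := h.sound
  have hL := h.list
  refine ⟨hL.congr (fun p hp => active_pt_iff.2 hp) fun p q hpq =>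
    (below_insert_iff (by simp) (by simp)).2 hpq, ⟨S, hS.insert_pt hL h.fok fun b hb => ?_⟩, h.opt⟩
  obtain ⟨hbA, hbL, hbo⟩ := hL.alive b hb
  cases L with
  | nil => simp at hbL
  | cons u L =>
    have hnu : σ.next 0 = u := hL.linked.1
    have hu1 := (hL.bound u (by simp)).1
    obtain ⟨h1, h2⟩ := hp (by omega)
    rw [hnu] at h1 h2
    rw [List.mem_cons] at hbL
    rcases hbL with hbu | hbL
    · rwa [← hbu, hbo] at h2
    · have hB := (List.pairwise_cons.1 hL.sorted).1 _ hbL h1 (by rw [hbo])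
      rw [hbo] at hB
      have huA := (hL.alive (σ.owner u) (by omega)).1
      exact le_trans h2 (A.below_le hv huA hbA hB)

/-- At the end of the sweep, `fnode` stands for an optimal cover. -/
theorem Inv.final (h : G.Inv d σ L) (hv : G.Valid) (hd : ∀ e, G.IsEvent e → e ∈ d)
    (hc : G.CoversAll (Finset.range G.m)) :
    σ.fnode ≤ σ.cnt ∧ ∃ S, G.Sound d σ S ∧ G.CoversAll (S σ.fnode) ∧
      ∀ T ⊆ Finset.range G.m, G.CoversAll T → ∑ k ∈ S σ.fnode, G.W k ≤ ∑ k ∈ T, G.W k := by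
  obtain ⟨S, hS⟩ := h.sound
  have key : ∀ T ⊆ Finset.range G.m, G.CoversAll T → σ.fok ≠ 0 ∧
      σ.cost σ.fnode ≤ ∑ k ∈ T, G.W k := by
    intro T hT hTc
    obtain ⟨h1, h2⟩ := (h.opt T hT hTc).fin fun k hk hka => hka.2.2 (hd (.rem k) hka.1)
    refine ⟨h1, h2.trans ?_⟩
    simpa using doneWeight_le (d := d) (P := fun _ => True)
      (fun l hl => hv.W_nonneg l (Finset.mem_range.1 (hT hl))) fun _ _ _ => trivial
  refine ⟨h.list.fnode, S, hS, fun i hi => ?_, fun T hT hTc => ?_⟩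
  · exact hS.covF (key _ subset_rfl hc).1 i (hd (.pt i) hi)
  · exact (hS.sum _ h.list.fnode).trans (key T hT hTc).2

/-- The initial data. -/
noncomputable def _root_.Mach.init : Mach where
  tok := fun _ => 0
  next := fun _ => 0
  owner := fun _ => 0
  npar := fun _ => 0
  cost := fun _ => 0
  cnt := 0
  fok := 1
  fnode := 0

/-- Initially the sentinel `0`, with the empty set and cost `0`, serves as a finished token: no
point has been passed. -/
theorem Inv.init : G.Inv ∅ Mach.init [] := by
  refine ⟨⟨rfl, by simp, by simp, le_rfl, fun b hb => absurd rfl hb, by simp⟩,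
    ⟨fun _ => ∅, ⟨rfl, ?_, ?_, ?_, ?_, ?_, ?_⟩⟩, fun T _ _ => ⟨?_, ?_⟩⟩
  · intro t h1 h2; change t ≤ 0 at h2; omega
  · intro t h1 h2; change t ≤ 0 at h2; omega
  · intro t h1 h2; change t ≤ 0 at h2; omega
  · intro t _; simp [Mach.init]
  · intro b hb; exact absurd rfl hb
  · intro _ i hi; simp at hi
  · intro k _ hk; exact absurd hk.2.1 (by simp)
  · intro _; simp [Mach.init, doneWeight]

end Scene

namespace RealRAM

/-! ## The plane sweep as a program -/

/-- The data of the sweep in memory. -/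
noncomputable def mach (s : State) : Mach where
  tok := s.nat 11
  next := s.nat 12
  owner := s.nat 13
  npar := s.nat 14
  cost := s.real 9
  cnt := s.nat 6 7
  fok := s.nat 6 8
  fnode := s.nat 6 9

/-- The points and the disks in memory. -/
def scene (s : State) (m n : ℕ) : Scene where
  C := s.real 5
  R := s.real 6
  W := s.real 7
  X := s.real 0
  Y := s.real 1
  m := m
  n := n

/-- A new token of disk `b` (variable `6`) after token `t` (variable `10`), with the parent in
variable `11` and the cost in the tenth array of reals. -/
def pushProg : Prog :=
  aset 7 (.add (av 7) (.lit 1)) ;;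
  .nset 12 (av 7) (.read 12 (av 10)) ;;
  .nset 12 (av 10) (av 7) ;;
  .nset 13 (av 7) (av 6) ;;
  .nset 14 (av 7) (av 11) ;;
  .rset 9 (av 7) (.read 10 (.lit 0)) ;;
  .nset 11 (av 6) (av 7)

/-- The fragments of the sweep are specified by their effect on the abstract data `mach`. Besides
these, only the number of events and the position in the schedule must survive, in cells `1` and `4`
of array `6`. -/
theorem wp_pushProg {Q : State → ℕ → Prop} {s : State} {c : ℕ} (hc : 60 ≤ c)
    (h : ∀ s' c', c ≤ c' + 60 →
      mach s' = (mach s).push (s.nat 6 6) (s.nat 6 10) (s.nat 6 11) (s.real 10 0) →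
      s'.nat 6 1 = s.nat 6 1 → s'.nat 6 4 = s.nat 6 4 → Q s' c') : wp pushProg Q s c := by
  simp [pushProg]
  refine ⟨by omega, by omega, by omega, by omega, by omega, by omega, by omega, ?_⟩
  refine h _ _ (by omega) ?_ (by simp) (by simp)
  simp [mach, Mach.push]

/-- Disk `a` begins. -/
def insProg : Prog :=
  .ite (.nle (av 8) (.lit 0)) .skip
    (aset 6 (av 5) ;; aset 10 (.lit 0) ;; aset 11 (av 9) ;;
      .rset 10 (.lit 0) (.add (.read 9 (av 9)) (.read 7 (av 6))) ;; pushProg)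

theorem wp_insProg {Q : State → ℕ → Prop} {s : State} {c : ℕ} (hc : 150 ≤ c)
    (h : ∀ s' c', c ≤ c' + 150 → mach s' = (mach s).onIns (s.real 7 (s.nat 6 5)) (s.nat 6 5) →
      s'.nat 6 1 = s.nat 6 1 → s'.nat 6 4 = s.nat 6 4 → Q s' c') : wp insProg Q s c := by
  rw [insProg, wp_ite]
  refine ⟨by simp; omega, fun hb => ?_, fun hb => ?_⟩ <;> simp at hb
  · rw [wp_skip]
    refine ⟨by simp; omega, h _ _ (by simp; omega) ?_ rfl rfl⟩
    rw [Mach.onIns, if_pos (by simpa [mach] using hb)]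
  · simp only [wp_seq, wp_nset, wp_rset]
    refine ⟨by simp; omega, by simp; omega, by simp; omega, by simp; omega, ?_⟩
    refine wp_pushProg (by simp; omega) fun s' c' hc' hm h1 h2 => h _ _ (by simp at hc'; omega) ?_
      (by simpa using h1) (by simpa using h2)
    rw [hm, Mach.onIns, if_neg (by simpa [mach] using hb)]
    simp [mach]

/-- Disk `b` overtakes disk `a`. -/
def crsProg : Prog :=
  .ite (.nle (.read 11 (av 5)) (.lit 0)) .skip
    (aset 10 (.read 11 (av 5)) ;;
      .ite (.and (.nlt (.lit 0) (.read 11 (av 6)))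
          (.rle (.read 9 (.read 11 (av 6))) (.add (.read 9 (.read 11 (av 5))) (.read 7 (av 6)))))
        (aset 11 (.read 14 (.read 11 (av 6))) ;;
          .rset 10 (.lit 0) (.read 9 (.read 11 (av 6))))
        (aset 11 (.read 11 (av 5)) ;;
          .rset 10 (.lit 0) (.add (.read 9 (.read 11 (av 5))) (.read 7 (av 6)))) ;;
      pushProg)

theorem wp_crsProg {Q : State → ℕ → Prop} {s : State} {c : ℕ} (hc : 200 ≤ c)
    (h : ∀ s' c', c ≤ c' + 200 →
      mach s' = (mach s).onCrs (s.real 7 (s.nat 6 6)) (s.nat 6 5) (s.nat 6 6) →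
      s'.nat 6 1 = s.nat 6 1 → s'.nat 6 4 = s.nat 6 4 → Q s' c') : wp crsProg Q s c := by
  rw [crsProg, wp_ite]
  refine ⟨by simp; omega, fun hb => ?_, fun hb => ?_⟩ <;> simp at hb
  · rw [wp_skip]
    refine ⟨by simp; omega, h _ _ (by simp; omega) ?_ rfl rfl⟩
    rw [Mach.onCrs, if_pos (by simpa [mach] using hb)]
  · simp only [wp_seq, wp_nset, wp_ite, wp_rset]
    refine ⟨by simp; omega, by simp; omega, fun hb' => ?_, fun hb' => ?_⟩ <;> simp at hb'
    · refine ⟨by simp; omega, by simp; omega, ?_⟩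
      refine wp_pushProg (by simp; omega) fun s' c' hc' hm h1 h2 =>
        h _ _ (by simp at hc'; omega) ?_ (by simpa using h1) (by simpa using h2)
      rw [hm, Mach.onCrs, if_neg (by simpa [mach] using hb), if_pos (by simpa [mach, Nat.pos_iff_ne_zero] using hb')]
      simp [mach]
    · refine ⟨by simp; omega, by simp; omega, ?_⟩
      refine wp_pushProg (by simp; omega) fun s' c' hc' hm h1 h2 =>
        h _ _ (by simp at hc'; omega) ?_ (by simpa using h1) (by simpa using h2)
      rw [hm, Mach.onCrs, if_neg (by simpa [mach] using hb), if_neg (by simpa [mach, Nat.pos_iff_ne_zero] using hb')]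
      simp [mach]

/-- Disk `a` ends. -/
def remProg : Prog :=
  .ite (.nle (.read 11 (av 5)) (.lit 0)) .skip
    (.ite (.and (.nlt (.lit 0) (av 8)) (.rle (.read 9 (av 9)) (.read 9 (.read 11 (av 5))))) .skip
        (aset 8 (.lit 1) ;; aset 9 (.read 11 (av 5))) ;;
      .nset 11 (av 5) (.lit 0))

theorem wp_remProg {Q : State → ℕ → Prop} {s : State} {c : ℕ} (hc : 100 ≤ c)
    (h : ∀ s' c', c ≤ c' + 100 → mach s' = (mach s).onRem (s.nat 6 5) →
      s'.nat 6 1 = s.nat 6 1 → s'.nat 6 4 = s.nat 6 4 → Q s' c') : wp remProg Q s c := by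
  rw [remProg, wp_ite]
  refine ⟨by simp; omega, fun hb => ?_, fun hb => ?_⟩ <;> simp at hb
  · rw [wp_skip]
    refine ⟨by simp; omega, h _ _ (by simp; omega) ?_ rfl rfl⟩
    rw [Mach.onRem, if_pos (by simpa [mach] using hb)]
  · simp only [wp_seq, wp_nset, wp_ite, wp_skip]
    refine ⟨by simp; omega, fun hb' => ?_, fun hb' => ?_⟩ <;> simp at hb'
    · refine ⟨by simp; omega, by simp; omega, h _ _ (by simp; omega) ?_ (by simp) (by simp)⟩
      rw [Mach.onRem, if_neg (by simpa [mach] using hb), if_pos (by simpa [mach, Nat.pos_iff_ne_zero] using hb')]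
      simp [mach]
    · refine ⟨by simp; omega, by simp; omega, by simp; omega, h _ _ (by simp; omega) ?_ (by simp) (by simp)⟩
      rw [Mach.onRem, if_neg (by simpa [mach] using hb), if_neg (by simpa [mach, Nat.pos_iff_ne_zero] using hb')]
      simp [mach]

/-- The first token of the list. -/
abbrev headTok : NExp := .read 12 (.lit 0)

/-- The first token is current, and its disk contains point `a`. -/
def headTest : BExp :=
  .and (.neq (.read 11 (.read 13 headTok)) headTok)
    (.rle (.mul (.read 1 (av 5)) (.read 1 (av 5)))
      (.sub (.mul (.read 6 (.read 13 headTok)) (.read 6 (.read 13 headTok)))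
        (.mul (.sub (.read 0 (av 5)) (.read 5 (.read 13 headTok)))
          (.sub (.read 0 (av 5)) (.read 5 (.read 13 headTok))))))

/-- Remove the first token. -/
def popProg : Prog :=
  aset 10 headTok ;;
  .ite (.neq (.read 11 (.read 13 (av 10))) (av 10)) (.nset 11 (.read 13 (av 10)) (.lit 0)) .skip ;;
  .nset 12 (.lit 0) (.read 12 (av 10))

/-- Point `a` is passed. -/
def ptProg : Prog :=
  aset 8 (.lit 0) ;; .while (.and (.nlt (.lit 0) headTok) (.not headTest)) popProg

theorem headTest_iff {s : State} {m n : ℕ} : headTest.Holds s ↔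
    (mach s).tok ((mach s).owner ((mach s).next 0)) = (mach s).next 0 ∧
      (scene s m n).Cov ((mach s).owner ((mach s).next 0)) (s.nat 6 5) := by
  simp only [headTest, BExp.Holds, NExp.eval, RExp.eval, ← le_antisymm_iff]
  exact Iff.rfl

theorem loopTest_iff {b c : BExp} {s : State} :
    (BExp.and b (.not c)).Holds s ↔ b.Holds s ∧ ¬ c.Holds s := Iff.rfl

theorem wp_popProg {Q : State → ℕ → Prop} {s : State} {c : ℕ} (hc : 50 ≤ c)
    (h : ∀ s' c', c ≤ c' + 50 → mach s' = (mach s).pop →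
      s'.nat 6 1 = s.nat 6 1 → s'.nat 6 4 = s.nat 6 4 → s'.nat 6 5 = s.nat 6 5 → Q s' c') :
    wp popProg Q s c := by
  simp only [popProg, wp_seq, wp_nset, wp_ite, wp_skip]
  refine ⟨by simp; omega, by simp; omega, fun hb => ?_, fun hb => ?_⟩ <;>
    simp [← le_antisymm_iff] at hb
  · refine ⟨by simp; omega, by simp; omega, h _ _ (by simp; omega) ?_ (by simp) (by simp) (by simp)⟩
    rw [Mach.pop, if_pos (by simpa [mach] using hb)]
    simp [mach]
  · refine ⟨by simp; omega, by simp; omega, h _ _ (by simp; omega) ?_ (by simp) (by simp) (by simp)⟩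
    rw [Mach.pop, if_neg (by simpa [mach] using hb)]
    simp [mach]

theorem popProg_writesReal {a : ℕ} : ¬ popProg.WritesReal a := by simp [popProg]

/-- Amortized accounting: each token in the list carries 150 credits, which are released when it is
popped. The net cost of a point is therefore bounded by a constant. -/
theorem wp_ptProg {Q : State → ℕ → Prop} {s : State} {c m n : ℕ} {d : Set Ev} {L : List ℕ}
    (hI : (scene s m n).Inv d (mach s) L) (hv : (scene s m n).Valid)
    (A : (scene s m n).At d (.pt (s.nat 6 5))) (hc : 150 * L.length + 100 ≤ c)
    (h : ∀ s' c' L', c + 150 * L'.length ≤ c' + 150 * L.length + 100 →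
      (scene s m n).Inv (insert (.pt (s.nat 6 5)) d) (mach s') L' → (mach s').cnt = (mach s).cnt →
      s'.nat 6 1 = s.nat 6 1 → s'.nat 6 4 = s.nat 6 4 → Q s' c') : wp ptProg Q s c := by
  simp only [ptProg, wp_seq, wp_nset]
  refine ⟨by simp; omega, ?_⟩
  set s₁ := s.setNat 6 ((NExp.lit 8).eval s) ((NExp.lit 0).eval s) with hs₁
  have hm₁ : mach s₁ = (mach s).onPt := by simp [hs₁, mach, Mach.onPt]
  refine wp_while (fun s' c' => ∃ L', (scene s m n).PopInv d (s.nat 6 5) (mach s') L' ∧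
    s'.nat 6 1 = s.nat 6 1 ∧ s'.nat 6 4 = s.nat 6 4 ∧ s'.nat 6 5 = s.nat 6 5 ∧
    (mach s').cnt = (mach s).cnt ∧
    c + 150 * L'.length ≤ c' + 150 * L.length + 20 ∧ 150 * L'.length + 80 ≤ c') ?_ ?_
  · refine ⟨L, ?_, by simp [hs₁], by simp [hs₁], by simp [hs₁], by simp [hs₁, mach],
      by simp; omega, by simp; omega⟩
    rw [hm₁]
    exact hI.onPt A hv
  · rintro s' c' hs ⟨L', hP, h1, h4, h5, hcnt, hcc, hcc'⟩
    have hsc : scene s' m n = scene s m n := by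
      have : s'.real = s.real := by
        funext a
        rw [hs.real a popProg_writesReal, hs₁]
        simp
      simp [scene, this]
    have hcost : (BExp.and (.nlt (.lit 0) headTok) (.not headTest)).cost + 1 ≤ 80 := by
      simp [headTest]
    refine ⟨by omega, fun hb => ?_, fun hb => ?_⟩
    · rw [loopTest_iff, headTest_iff (m := m) (n := n), hsc, h5] at hb
      obtain ⟨hb1, hb2⟩ := hb
      have hb1 : (mach s').next 0 ≠ 0 := by simpa [mach, Nat.pos_iff_ne_zero] using hb1
      cases L' with
      -- The loop test has excluded the empty list, whose first link is `0`.
      | nil => exact absurd hP.list.linked hb1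
      | cons u L' =>
        simp only [List.length_cons] at hcc hcc'
        refine wp_popProg (by omega) fun s'' c'' hc'' hm g1 g4 g5 => ?_
        refine ⟨L', ?_, g1.trans h1, g4.trans h4, g5.trans h5, ?_, by omega, by omega⟩
        · rw [hm]
          exact hP.pop A hv fun h1 h2 => hb2 ⟨h1, h2⟩
        · rw [hm]; exact hcnt
    · rw [loopTest_iff, headTest_iff (m := m) (n := n), hsc, h5] at hb
      refine h _ _ L' (by omega) (hP.inv A hv fun hn => ?_) hcnt h1 h4
      by_contra hcon
      exact hb ⟨by simpa [mach, Nat.pos_iff_ne_zero] using hn, hcon⟩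

end RealRAM

/-! ### The main loop of the sweep and its output -/

namespace RealRAM

/-- The event that is stored as a kind and two objects. -/
def evOf (t a b : ℕ) : Ev :=
  if t ≤ 0 then .ins a else if t ≤ 1 then .crs a b else if t ≤ 2 then .pt a else .rem a

/-- The event that is stored at index `i`. -/
def evAt (s : State) (i : ℕ) : Ev := evOf (s.nat 8 i) (s.nat 9 i) (s.nat 10 i)

/-- Treat the next event. -/
def stepProg : Prog :=
  aset 5 (.read 9 (.read 4 (av 4))) ;; aset 6 (.read 10 (.read 4 (av 4))) ;;
    .ite (.nle (.read 8 (.read 4 (av 4))) (.lit 0)) insProg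
      (.ite (.nle (.read 8 (.read 4 (av 4))) (.lit 1)) crsProg
        (.ite (.nle (.read 8 (.read 4 (av 4))) (.lit 2)) ptProg remProg)) ;;
    aset 4 (.add (av 4) (.lit 1))

/-- Treat all events. -/
def sweepProg : Prog := .while (.nlt (av 4) (av 1)) stepProg

theorem _root_.Mach.onIns_cnt_le (σ : Mach) (w : ℝ) (b : ℕ) : (σ.onIns w b).cnt ≤ σ.cnt + 1 := by
  unfold Mach.onIns; split_ifs <;> simp [Mach.push]

theorem _root_.Mach.onCrs_cnt_le (σ : Mach) (w : ℝ) (a b : ℕ) :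
    (σ.onCrs w a b).cnt ≤ σ.cnt + 1 := by
  unfold Mach.onCrs; split_ifs <;> simp [Mach.push]

theorem _root_.Mach.onRem_cnt (σ : Mach) (k : ℕ) : (σ.onRem k).cnt = σ.cnt := by
  unfold Mach.onRem; split_ifs <;> rfl

/-- With 150 credits stored per token, every kind of event costs at most 450, including the deposit
for a token it may add. -/
theorem wp_stepProg {Q : State → ℕ → Prop} {s : State} {c m n : ℕ} {d : Set Ev} {L : List ℕ}
    (hI : (scene s m n).Inv d (mach s) L) (hv : (scene s m n).Valid)
    (A : (scene s m n).At d (evAt s (s.nat 4 (s.nat 6 4)))) (hc : 150 * L.length + 300 ≤ c)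
    (h : ∀ s' c' L', c + 150 * L'.length ≤ c' + 150 * L.length + 450 →
      (scene s m n).Inv (insert (evAt s (s.nat 4 (s.nat 6 4))) d) (mach s') L' →
      (mach s').cnt ≤ (mach s).cnt + 1 →
      s'.nat 6 1 = s.nat 6 1 → s'.nat 6 4 = s.nat 6 4 + 1 → Q s' c') : wp stepProg Q s c := by
  simp only [stepProg, wp_seq, wp_nset]
  refine ⟨by simp; omega, by simp; omega, ?_⟩
  obtain ⟨s₁, hs₁⟩ : ∃ s₁, s₁ = State.setNat (s.setNat 6 ((NExp.lit 5).eval s)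
      ((NExp.read 9 (.read 4 (av 4))).eval s)) 6
      ((NExp.lit 6).eval (s.setNat 6 ((NExp.lit 5).eval s) ((NExp.read 9 (.read 4 (av 4))).eval s)))
      ((NExp.read 10 (.read 4 (av 4))).eval (s.setNat 6 ((NExp.lit 5).eval s)
        ((NExp.read 9 (.read 4 (av 4))).eval s))) := ⟨_, rfl⟩
  rw [← hs₁]
  have hm : mach s₁ = mach s := by simp [hs₁, mach]
  have hsc : scene s₁ m n = scene s m n := by simp [hs₁, scene]
  have h5 : s₁.nat 6 5 = s.nat 9 (s.nat 4 (s.nat 6 4)) := by simp [hs₁]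
  have h6 : s₁.nat 6 6 = s.nat 10 (s.nat 4 (s.nat 6 4)) := by simp [hs₁]
  have h61 : s₁.nat 6 1 = s.nat 6 1 := by simp [hs₁]
  have h64 : s₁.nat 6 4 = s.nat 6 4 := by simp [hs₁]
  have h8 : s₁.nat 8 (s₁.nat 4 (s₁.nat 6 4)) = s.nat 8 (s.nat 4 (s.nat 6 4)) := by simp [hs₁]
  have hw : ∀ k, (scene s m n).W k = s₁.real 7 k := by simp [hs₁, scene]
  have fin : ∀ s' c' L', c + 150 * L'.length ≤ c' + 150 * L.length + 400 →
      (scene s m n).Inv (insert (evAt s (s.nat 4 (s.nat 6 4))) d) (mach s') L' →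
      (mach s').cnt ≤ (mach s).cnt + 1 → 20 ≤ c' →
      s'.nat 6 1 = s₁.nat 6 1 → s'.nat 6 4 = s₁.nat 6 4 →
      wp (aset 4 (.add (av 4) (.lit 1))) Q s' c' := by
    intro s' c' L' hcc hI' hcnt hc' h1 h4
    rw [wp_nset]
    refine ⟨by simp; omega, h _ _ L' (by simp; omega) ?_ ?_ (by simp [h1, h61]) (by simp [h4, h64])⟩
    · simpa [mach] using hI'
    · simpa [mach] using hcnt
  clear hs₁
  simp only [wp_ite]
  refine ⟨by simp; omega, fun hb => ?_, fun hb => ?_⟩ <;> simp [h8] at hb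
  · have he : evAt s (s.nat 4 (s.nat 6 4)) = .ins (s₁.nat 6 5) := by simp [evAt, evOf, hb, h5]
    rw [he] at A fin
    refine wp_insProg (by simp; omega) fun s' c' hc' hm' g1 g4 => ?_
    obtain ⟨L', hI', hL'⟩ := hI.onIns A hv
    simp at hc'
    rw [hm, ← hw] at hm'
    rw [← hm'] at hI'
    exact fin s' c' L' (by omega) hI' (by rw [hm']; exact Mach.onIns_cnt_le _ _ _) (by omega) g1 g4
  refine ⟨by simp; omega, fun hb' => ?_, fun hb' => ?_⟩ <;> simp [h8] at hb'
  · have he : evAt s (s.nat 4 (s.nat 6 4)) = .crs (s₁.nat 6 5) (s₁.nat 6 6) := by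
      simp [evAt, evOf, hb, hb', h5, h6]
    rw [he] at A fin
    refine wp_crsProg (by simp; omega) fun s' c' hc' hm' g1 g4 => ?_
    obtain ⟨L', hI', hL'⟩ := hI.onCrs A hv
    simp at hc'
    rw [hm, ← hw] at hm'
    rw [← hm'] at hI'
    exact fin s' c' L' (by omega) hI' (by rw [hm']; exact Mach.onCrs_cnt_le _ _ _ _) (by omega) g1 g4
  refine ⟨by simp; omega, fun hb'' => ?_, fun hb'' => ?_⟩ <;> simp [h8] at hb''
  · have he : evAt s (s.nat 4 (s.nat 6 4)) = .pt (s₁.nat 6 5) := by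
      simp [evAt, evOf, hb, hb'', h5, hb'.not_ge]
    rw [he] at A fin
    rw [← hm, ← hsc] at hI
    rw [← hsc] at hv A fin
    refine wp_ptProg hI hv A (by simp; omega) fun s' c' L' hc' hI' hcnt g1 g4 => ?_
    simp at hc'
    exact fin s' c' L' (by omega) hI' (by rw [hcnt, hm]; omega) (by omega) g1 g4
  · have he : evAt s (s.nat 4 (s.nat 6 4)) = .rem (s₁.nat 6 5) := by
      simp [evAt, evOf, hb, hb''.not_ge, h5, hb'.not_ge]
    rw [he] at A fin
    refine wp_remProg (by simp; omega) fun s' c' hc' hm' g1 g4 => ?_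
    have hI' := hI.onRem A hv
    simp at hc'
    rw [hm] at hm'
    rw [← hm'] at hI'
    exact fin s' c' L (by omega) hI' (by rw [hm', Mach.onRem_cnt]; omega) (by omega) g1 g4

theorem stepProg_writes {a : ℕ} : stepProg.WritesNat a ↔ a = 6 ∨ 11 ≤ a ∧ a ≤ 14 := by
  simp [stepProg, insProg, crsProg, remProg, ptProg, popProg, pushProg]; omega

theorem stepProg_writesReal {a : ℕ} : stepProg.WritesReal a ↔ a = 9 ∨ a = 10 := by
  simp [stepProg, insProg, crsProg, remProg, ptProg, popProg, pushProg]; omega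

/-- A sequence `E 0, …, E (N - 1)` of all events in the order of the sweep. -/
structure _root_.Scene.Schedule (G : Scene) (E : ℕ → Ev) (N : ℕ) : Prop where
  inj : ∀ i j, i < j → j < N → E i ≠ E j
  sorted : ∀ i j, i < j → j < N → G.key (E i) ≤ G.key (E j)
  isEvent_iff : ∀ e, G.IsEvent e ↔ ∃ i < N, E i = e

/-- A proper prefix of the schedule is a legitimate set of past events for the event that follows
it. Which of several events with equal keys comes first does not matter. -/
theorem _root_.Scene.Schedule.at {G : Scene} {E : ℕ → Ev} {N i : ℕ} (h : G.Schedule E N)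
    (hi : i < N) : G.At {e | ∃ j < i, E j = e} (E i) where
  isEvent := (h.isEvent_iff _).2 ⟨i, hi, rfl⟩
  not_mem := by
    rintro ⟨j, hj, hjE⟩
    exact h.inj j i hj hi hjE
  le := by
    rintro e ⟨j, hj, rfl⟩
    exact h.sorted j i hj hi
  ge := by
    intro e he hn
    obtain ⟨j, hj, rfl⟩ := (h.isEvent_iff _).1 he
    rcases Nat.lt_trichotomy i j with h' | rfl | h'
    · exact h.sorted i j h' hj
    · exact le_rfl
    · exact absurd ⟨j, h', rfl⟩ hn

/-- Each event brings 500 credits, enough for its amortized cost and the loop test. At most one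
token is created per event, which later bounds the time of the output. -/
theorem sweepProg_runs {s : State} {m n N : ℕ} (hN : s.nat 6 1 = N) (h4 : s.nat 6 4 = 0)
    (hM : mach s = Mach.init) (hv : (scene s m n).Valid)
    (hE : (scene s m n).Schedule (fun i => evAt s (s.nat 4 i)) N) :
    Runs sweepProg s (500 * N + 10) fun s' => ∃ L,
      (scene s m n).Inv {e | ∃ j < N, evAt s (s.nat 4 j) = e} (mach s') L ∧
        (mach s').cnt ≤ N := by
  unfold Runs sweepProg
  obtain ⟨Inv, hInv⟩ : ∃ Inv : State → ℕ → Prop, ∀ s' c, Inv s' c ↔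
    ∃ i L, s'.nat 6 1 = N ∧ s'.nat 6 4 = i ∧ i ≤ N ∧ (mach s').cnt ≤ i ∧
      (scene s m n).Inv {e | ∃ j < i, evAt s (s.nat 4 j) = e} (mach s') L ∧
      500 * (N - i) + 150 * L.length + 10 ≤ c := ⟨_, fun _ _ => Iff.rfl⟩
  refine wp_while Inv ((hInv _ _).2 ⟨0, [], hN, h4, by omega, by simp [hM, Mach.init], ?_,
    by simp⟩) ?_
  · simpa [hM] using Scene.Inv.init
  intro s' c hs hI
  obtain ⟨i, L, g1, g4, hi, hcnt, hI, hc⟩ := (hInv _ _).1 hI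
  refine ⟨by simp; omega, fun hg => ?_, fun hg => ?_⟩ <;> simp [g1, g4] at hg
  · have e4 : s'.nat 4 = s.nat 4 := hs.nat 4 (by simp [stepProg_writes])
    have e8 : s'.nat 8 = s.nat 8 := hs.nat 8 (by simp [stepProg_writes])
    have e9 : s'.nat 9 = s.nat 9 := hs.nat 9 (by simp [stepProg_writes])
    have e10 : s'.nat 10 = s.nat 10 := hs.nat 10 (by simp [stepProg_writes])
    have hsc : scene s' m n = scene s m n := by
      have (a) (ha : ¬ (a = 9 ∨ a = 10)) : s'.real a = s.real a :=
        hs.real a (by rwa [stepProg_writesReal])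
      simp [scene, this]
    have hev : evAt s' (s'.nat 4 (s'.nat 6 4)) = evAt s (s.nat 4 i) := by
      simp [evAt, e4, e8, e9, e10, g4]
    have A := hE.at hg
    simp only [← hev] at A
    rw [← hsc] at hI hv A
    refine wp_stepProg hI hv A (by simp; omega) fun s'' c'' L' hc'' hI' hcnt' g1' g4' => ?_
    simp at hc''
    rw [hInv]
    refine ⟨i + 1, L', g1'.trans g1, by omega, by omega, by omega, ?_, by omega⟩
    rw [hev, hsc] at hI'
    convert hI' using 1
    ext e
    simp only [Set.mem_ofPred_eq, Set.mem_insert_iff]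
    constructor
    · rintro ⟨j, hj, rfl⟩
      rcases Nat.lt_succ_iff_lt_or_eq.1 hj with h | rfl
      · exact .inr ⟨j, h, rfl⟩
      · exact .inl rfl
    · rintro (rfl | ⟨j, hj, rfl⟩)
      · exact ⟨i, by omega, rfl⟩
      · exact ⟨j, by omega, rfl⟩
  · obtain rfl : i = N := by omega
    exact ⟨L, hI, hcnt⟩

/-- Output the disks of the best token. -/
def traceProg : Prog :=
  aset 11 (av 9) ;; .while (.nlt (.lit 0) (av 11))
    (.nset 1 (.read 7 (.read 13 (av 11))) (.lit 1) ;; aset 11 (.read 14 (av 11)))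

theorem traceProg_runs {G : Scene} {s : State} {d : Set Ev} {S : ℕ → Finset ℕ}
    (hS : G.Sound d (mach s) S) (hf : (mach s).fnode ≤ (mach s).cnt) (h1 : ∀ k, s.nat 1 k = 0) :
    Runs traceProg s (50 * (mach s).cnt + 50) fun s' =>
      ∀ k, s'.nat 1 k = 1 ↔ k ∈ (S (mach s).fnode).image (s.nat 7) := by
  unfold Runs traceProg
  simp only [wp_seq, wp_nset]
  refine ⟨by simp, ?_⟩
  -- What has been output and what the remaining token `v` still contributes together form the
  -- wanted set. Parents have smaller numbers, so `v` bounds the remaining time. Array `7`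
  -- translates the reduced disks to input indices.
  refine wp_while (fun s' c => ∃ v, s'.nat 6 11 = v ∧ v ≤ (mach s).cnt ∧
    (∀ k, (s'.nat 1 k = 1 ∨ k ∈ (S v).image (s.nat 7)) ↔ k ∈ (S (mach s).fnode).image (s.nat 7)) ∧
    50 * v + 10 ≤ c) ?_ ?_
  · refine ⟨(mach s).fnode, by simp [mach], hf, fun k => by simp [h1], by simp; omega⟩
  · rintro s' c hs ⟨v, g, hv, hk, hc⟩
    have e7 : s'.nat 7 = s.nat 7 := by rw [hs.nat 7 (by simp)]; simp
    have e13 : s'.nat 13 = s.nat 13 := by rw [hs.nat 13 (by simp)]; simp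
    have e14 : s'.nat 14 = s.nat 14 := by rw [hs.nat 14 (by simp)]; simp
    refine ⟨by simp; omega, fun hg => ?_, fun hg => ?_⟩ <;> simp [g] at hg
    · have hlt := hS.npar v (Nat.pos_of_ne_zero hg) hv
      have heq := hS.eq v (Nat.pos_of_ne_zero hg) hv
      simp only [mach] at hlt heq
      simp [g, e7, e13, e14]
      refine ⟨by omega, by omega, by omega, fun k => ?_, by omega⟩
      rw [← Finset.mem_image, ← Finset.mem_image, ← hk, heq, Finset.image_insert, Finset.mem_insert, Function.update_apply]
      split_ifs with h <;> simp [h]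
    · intro k
      rw [← hk, hg, hS.zero]
      simp

end RealRAM

namespace RealRAM

/-! ## Removal of duplicate disks -/

/-- Lexicographic comparison, first by two reals. -/
abbrev BExp.rlex (e f : RExp) (b : BExp) : BExp := .or (.rlt e f) (.and (.rle e f) b)

/-- Lexicographic comparison, first by two indices. -/
abbrev BExp.nlex (e f : NExp) (b : BExp) : BExp := .or (.nlt e f) (.and (.nle e f) b)

theorem BExp.or_holds {b c : BExp} {s : State} :
    (BExp.or b c).Holds s ↔ b.Holds s ∨ c.Holds s := by
  simp only [Holds]
  tauto

theorem BExp.rlex_holds {e f : RExp} {b : BExp} {s : State} :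
    (BExp.rlex e f b).Holds s ↔ e.eval s < f.eval s ∨ e.eval s = f.eval s ∧ b.Holds s := by
  rw [or_holds]
  simp only [Holds, not_le]
  constructor
  · rintro (h | ⟨h, hb⟩)
    · exact .inl h
    · exact h.lt_or_eq.imp id fun h => ⟨h, hb⟩
  · exact Or.imp id fun h => ⟨h.1.le, h.2⟩

theorem BExp.nlex_holds {e f : NExp} {b : BExp} {s : State} :
    (BExp.nlex e f b).Holds s ↔ e.eval s < f.eval s ∨ e.eval s = f.eval s ∧ b.Holds s := by
  rw [or_holds]
  simp only [Holds, not_le]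
  constructor
  · rintro (h | ⟨h, hb⟩)
    · exact .inl h
    · exact h.lt_or_eq.imp id fun h => ⟨h, hb⟩
  · exact Or.imp id fun h => ⟨h.1.le, h.2⟩

/-- The key by which disks are sorted: left end, centre, weight. -/
noncomputable def diskKey (c r w : ℝ) : ℝ ×ₗ ℝ ×ₗ ℝ := toLex (c - r, toLex (c, w))

/-- The left end and the centre of a disk. -/
noncomputable def leftKey (c r : ℝ) : ℝ ×ₗ ℝ := toLex (c - r, c)

theorem leftKey_le {c r w c' r' w' : ℝ} (h : diskKey c r w ≤ diskKey c' r' w') :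
    leftKey c r ≤ leftKey c' r' := by
  simp only [diskKey, leftKey, Prod.Lex.toLex_le_toLex] at h ⊢
  rcases h with h | ⟨h, h' | h'⟩
  · exact .inl h
  · exact .inr ⟨h, h'.le⟩
  · exact .inr ⟨h, h'.1.le⟩

/-- Left end and centre determine the disk, so duplicates are adjacent once the disks are sorted by
`diskKey`. Having the left end first also makes the beginnings monotone. -/
theorem leftKey_inj {c r c' r' : ℝ} (h : leftKey c r = leftKey c' r') : c = c' ∧ r = r' := by
  have h' : (c - r, c) = (c' - r', c') := h
  rw [Prod.mk.injEq] at h'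
  obtain ⟨h1, rfl⟩ := h'
  exact ⟨rfl, by linarith⟩

/-- The test that compares disks. -/
def diskCmp : BExp :=
  .rlex (.sub (.read 2 (sv 0)) (.read 3 (sv 0))) (.sub (.read 2 (sv 1)) (.read 3 (sv 1)))
    (.rlex (.read 2 (sv 0)) (.read 2 (sv 1)) (.rle (.read 4 (sv 0)) (.read 4 (sv 1))))

theorem decides_diskCmp (s : State) : Decides diskCmp (fun u v =>
    diskKey (s.real 2 u) (s.real 3 u) (s.real 4 u) ≤
      diskKey (s.real 2 v) (s.real 3 v) (s.real 4 v)) s := by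
  intro s' hs hr
  rw [diskCmp, BExp.rlex_holds, BExp.rlex_holds]
  simp [hr, diskKey, Prod.Lex.toLex_le_toLex]

/-- The arrays `C`, `R`, `W` contain `m'` different disks, which occur at the indices `O` in the
arrays `c`, `r`, `w`; every disk with an index `P 0, …, P (k - 1)` is equal to one of these, and
not lighter. -/
structure Compact (c r w : ℕ → ℝ) (P : ℕ → ℕ) (k : ℕ) (C R W : ℕ → ℝ) (O : ℕ → ℕ) (m' : ℕ) :
    Prop where
  mem : ∀ j < m', ∃ i < k, O j = P i
  eq : ∀ j < m', C j = c (O j) ∧ R j = r (O j) ∧ W j = w (O j)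
  sorted : ∀ i j, i < j → j < m' → leftKey (C i) (R i) < leftKey (C j) (R j)
  exists_eq : ∀ i < k, ∃ j < m', C j = c (P i) ∧ R j = r (P i) ∧ W j ≤ w (P i)

section Compact
variable {c r w : ℕ → ℝ} {P : ℕ → ℕ} {k : ℕ} {C R W : ℕ → ℝ} {O : ℕ → ℕ} {m' : ℕ}

/-- Copies of one disk are sorted by weight, so the copy already kept is not heavier than the one
left out. -/
theorem Compact.skip (h : Compact c r w P k C R W O m') (hm : 0 < m')
    (hP : ∀ i < k, diskKey (c (P i)) (r (P i)) (w (P i)) ≤ diskKey (c (P k)) (r (P k)) (w (P k)))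
    (hC : C (m' - 1) = c (P k)) (hR : R (m' - 1) = r (P k)) :
    Compact c r w P (k + 1) C R W O m' where
  mem j hj := by
    obtain ⟨i, hi, h⟩ := h.mem j hj
    exact ⟨i, by omega, h⟩
  eq := h.eq
  sorted := h.sorted
  exists_eq i hi := by
    rcases Nat.lt_succ_iff_lt_or_eq.1 hi with hi | rfl
    · exact h.exists_eq i hi
    · refine ⟨m' - 1, by omega, hC, hR, ?_⟩
      obtain ⟨j, hj, hO⟩ := h.mem (m' - 1) (by omega)
      obtain ⟨e1, e2, e3⟩ := h.eq (m' - 1) (by omega)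
      have := hP j hj
      rw [hO] at e1 e2 e3
      rw [← e1, ← e2, ← e3, hC, hR, diskKey, diskKey, Prod.Lex.toLex_le_toLex,
        Prod.Lex.toLex_le_toLex] at this
      simpa using this

theorem Compact.push (h : Compact c r w P k C R W O m')
    (hP : ∀ i < k, diskKey (c (P i)) (r (P i)) (w (P i)) ≤ diskKey (c (P k)) (r (P k)) (w (P k)))
    (hne : 0 < m' → C (m' - 1) = c (P k) → R (m' - 1) ≠ r (P k)) :
    Compact c r w P (k + 1) (Function.update C m' (c (P k))) (Function.update R m' (r (P k)))
      (Function.update W m' (w (P k))) (Function.update O m' (P k)) (m' + 1) where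
  mem j hj := by
    rcases Nat.lt_succ_iff_lt_or_eq.1 hj with hj | rfl
    · obtain ⟨i, hi, h⟩ := h.mem j hj
      exact ⟨i, by omega, by simpa [hj.ne] using h⟩
    · exact ⟨k, by omega, by simp⟩
  eq j hj := by
    rcases Nat.lt_succ_iff_lt_or_eq.1 hj with hj | rfl
    · simpa [hj.ne] using h.eq j hj
    · simp
  sorted i j hij hj := by
    rcases Nat.lt_succ_iff_lt_or_eq.1 hj with hj | rfl
    · simpa [hj.ne, (hij.trans hj).ne] using h.sorted i j hij hj
    · have hlast : leftKey (C (j - 1)) (R (j - 1)) < leftKey (c (P k)) (r (P k)) := by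
        obtain ⟨l, hl, hO⟩ := h.mem (j - 1) (by omega)
        obtain ⟨e1, e2, -⟩ := h.eq (j - 1) (by omega)
        refine lt_of_le_of_ne ?_ fun he => ?_
        · rw [e1, e2, hO]
          exact leftKey_le (hP l hl)
        · obtain ⟨g1, g2⟩ := leftKey_inj he
          exact hne (by omega) g1 g2
      simp only [Function.update_self, Function.update_of_ne hij.ne]
      rcases Nat.lt_or_ge i (j - 1) with h' | h'
      · exact (h.sorted i (j - 1) h' (by omega)).trans hlast
      · rwa [show i = j - 1 by omega]
  exists_eq i hi := by
    rcases Nat.lt_succ_iff_lt_or_eq.1 hi with hi | rfl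
    · obtain ⟨j, hj, h⟩ := h.exists_eq i hi
      exact ⟨j, by omega, by simpa [hj.ne] using h⟩
    · exact ⟨m', by omega, by simp⟩

end Compact

/-- Copy the sorted disks and leave out duplicates. -/
def compactProg : Prog :=
  .while (.nlt (av 2) (.read 0 (.lit 1)))
    (aset 5 (.read 4 (av 2)) ;;
      .ite (.and (.nlt (.lit 0) (av 0))
          (.and (.req (.read 5 (.sub (av 0) (.lit 1))) (.read 2 (av 5)))
            (.req (.read 6 (.sub (av 0) (.lit 1))) (.read 3 (av 5))))) .skip
        (.rset 5 (av 0) (.read 2 (av 5)) ;; .rset 6 (av 0) (.read 3 (av 5)) ;;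
          .rset 7 (av 0) (.read 4 (av 5)) ;; .nset 7 (av 0) (av 5) ;;
          aset 0 (.add (av 0) (.lit 1))) ;;
      aset 2 (.add (av 2) (.lit 1)))

theorem compactProg_runs {s : State} {m : ℕ} (hm : s.nat 0 1 = m) (h0 : s.nat 6 0 = 0)
    (h2 : s.nat 6 2 = 0) (hP : ∀ i j, i < j → j < m →
      diskKey (s.real 2 (s.nat 4 i)) (s.real 3 (s.nat 4 i)) (s.real 4 (s.nat 4 i)) ≤
        diskKey (s.real 2 (s.nat 4 j)) (s.real 3 (s.nat 4 j)) (s.real 4 (s.nat 4 j))) :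
    Runs compactProg s (150 * m + 20) fun s' =>
      Compact (s.real 2) (s.real 3) (s.real 4) (s.nat 4) m (s'.real 5) (s'.real 6) (s'.real 7)
        (s'.nat 7) (s'.nat 6 0) ∧ s'.nat 6 0 ≤ m ∧
      ∀ j, j ≠ 0 → j ≠ 2 → j ≠ 5 → s'.nat 6 j = s.nat 6 j := by
  unfold Runs compactProg
  obtain ⟨Inv, hInv⟩ : ∃ Inv : State → ℕ → Prop, ∀ s' c, Inv s' c ↔
    ∃ k, s'.nat 6 2 = k ∧ k ≤ m ∧ s'.nat 6 0 ≤ k ∧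
      Compact (s.real 2) (s.real 3) (s.real 4) (s.nat 4) k (s'.real 5) (s'.real 6) (s'.real 7)
        (s'.nat 7) (s'.nat 6 0) ∧
      (∀ j, j ≠ 0 → j ≠ 2 → j ≠ 5 → s'.nat 6 j = s.nat 6 j) ∧ 150 * (m - k) + 10 ≤ c :=
    ⟨_, fun _ _ => Iff.rfl⟩
  refine wp_while Inv ((hInv _ _).2 ⟨0, h2, by omega, by omega, ?_, fun _ _ _ _ => rfl,
    by omega⟩) ?_
  · exact ⟨by simp [h0], by simp [h0], by simp [h0], by simp⟩
  intro s' c hs hI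
  obtain ⟨k, g2, hk, h0k, hI, hj, hc⟩ := (hInv _ _).1 hI
  have e0 : s'.nat 0 = s.nat 0 := hs.nat 0 (by simp)
  have e4 : s'.nat 4 = s.nat 4 := hs.nat 4 (by simp)
  have r2 : s'.real 2 = s.real 2 := hs.real 2 (by simp)
  have r3 : s'.real 3 = s.real 3 := hs.real 3 (by simp)
  have r4 : s'.real 4 = s.real 4 := hs.real 4 (by simp)
  refine ⟨by simp; omega, fun hg => ?_, fun hg => ?_⟩ <;> simp [g2, e0, hm] at hg
  · simp only [wp_seq, wp_nset, wp_ite, wp_skip, wp_rset]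
    refine ⟨by simp; omega, by simp; omega, fun hb => ?_, fun hb => ?_⟩ <;>
      simp [← le_antisymm_iff, g2, e4, r2, r3] at hb
    · refine ⟨by simp; omega, by simp; omega, ?_⟩
      rw [hInv]
      refine ⟨k + 1, by simp [g2], by omega, by simp; omega, ?_, fun j j0 j2 j5 => ?_, by simp; omega⟩
      · simpa using hI.skip (Nat.pos_of_ne_zero hb.1) (fun i hi => hP i k hi hg) hb.2.1 hb.2.2
      · simpa [j0, j2, j5] using hj j j0 j2 j5
    · refine ⟨by simp; omega, by simp; omega, by simp; omega, by simp; omega, by simp; omega,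
        by simp; omega, ?_⟩
      rw [hInv]
      refine ⟨k + 1, by simp [g2], by omega, by simp; omega, ?_, fun j j0 j2 j5 => ?_, by simp; omega⟩
      · have := hI.push (fun i hi => hP i k hi hg) fun h1 h2 => hb h1.ne' h2
        simpa [g2, e4, r2, r3, r4] using this
      · simpa [j0, j2, j5] using hj j j0 j2 j5
  · obtain rfl : k = m := by omega
    exact ⟨hI, h0k, hj⟩

end RealRAM

namespace RealRAM

/-! ## Generation of the events -/

/-- The events with property `Z` are stored in the event arrays, each of them once. -/
structure Emit (G : Scene) (Z : Ev → Prop) (s : State) : Prop where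
  mem : ∀ e, Z e ↔ ∃ i < s.nat 6 1, evAt s i = e
  inj : ∀ i j, i < j → j < s.nat 6 1 → evAt s i ≠ evAt s j
  fields : ∀ i < s.nat 6 1, s.real 8 i = G.pos (evAt s i) ∧ s.nat 8 i = (evAt s i).level ∧
    s.nat 9 i = (evAt s i).fst ∧ s.nat 10 i = (evAt s i).snd

theorem Emit.congr {G : Scene} {Z Z' : Ev → Prop} {s : State} (h : Emit G Z s)
    (hZ : ∀ e, Z' e ↔ Z e) : Emit G Z' s :=
  ⟨fun e => (hZ e).trans (h.mem e), h.inj, h.fields⟩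

theorem Emit.of_eq {G : Scene} {Z : Ev → Prop} {s s' : State} (h : Emit G Z s)
    (h6 : s'.nat 6 1 = s.nat 6 1) (h8 : s'.nat 8 = s.nat 8) (h9 : s'.nat 9 = s.nat 9)
    (h10 : s'.nat 10 = s.nat 10) (hr : s'.real 8 = s.real 8) : Emit G Z s' := by
  have : evAt s' = evAt s := by funext i; simp [evAt, h8, h9, h10]
  constructor
  · rw [this, h6]; exact h.mem
  · rw [this, h6]; exact h.inj
  · rw [this, h6, h8, h9, h10, hr]; exact h.fields

theorem evOf_eq (e : Ev) : evOf e.level e.fst e.snd = e := by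
  cases e <;> rfl

/-- Store an event of kind `t`. -/
def emitProg (t : ℕ) (a b : NExp) (x : RExp) : Prog :=
  .rset 8 (av 1) x ;; .nset 8 (av 1) (.lit t) ;; .nset 9 (av 1) a ;; .nset 10 (av 1) b ;;
    aset 1 (.add (av 1) (.lit 1))

/-- The object expressions are evaluated after the first writes to the event arrays, so they may
depend only on the scalar variables in array `6`. -/
theorem wp_emitProg {Q : State → ℕ → Prop} {s : State} {c t : ℕ} {a b : NExp} {x : RExp}
    {G : Scene} {Z : Ev → Prop} {e : Ev} (hE : Emit G Z s) (he : ¬ Z e) (ht : e.level = t)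
    (ha : ∀ s', s'.nat 6 = s.nat 6 → a.eval s' = e.fst)
    (hb : ∀ s', s'.nat 6 = s.nat 6 → b.eval s' = e.snd) (hx : x.eval s = G.pos e)
    (hc : x.cost + a.cost + b.cost + 19 ≤ c)
    (h : ∀ s' c', c = c' + (x.cost + a.cost + b.cost + 19) → Emit G (fun e' => e' = e ∨ Z e') s' →
      (∀ j, j ≠ 1 → s'.nat 6 j = s.nat 6 j) → s'.nat 6 1 = s.nat 6 1 + 1 →
      (∀ j, j ≠ 8 → s'.real j = s.real j) → s'.nat 0 = s.nat 0 → Q s' c') :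
    wp (emitProg t a b x) Q s c := by
  simp only [emitProg, wp_seq, wp_nset, wp_rset]
  refine ⟨by simp; omega, by simp; omega, by simp; omega, by simp; omega, by simp; omega, ?_⟩
  refine h _ _ (by simp; omega) ?_ (fun j hj => by simp [hj]) (by simp)
    (fun j hj => by simp [hj]) (by simp)
  have hev : evOf t e.fst e.snd = e := by rw [← ht]; exact evOf_eq e
  constructor
  · intro e'
    rw [hE.mem]
    simp [evAt, ha, hb]
    constructor
    · rintro (rfl | ⟨i, hi, rfl⟩)
      · exact ⟨s.nat 6 1, by omega, by simp [hev]⟩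
      · exact ⟨i, by omega, by simp [hi.ne]⟩
    · rintro ⟨i, hi, rfl⟩
      rcases Nat.lt_or_eq_of_le hi with hi | rfl
      · exact .inr ⟨i, hi, by simp [hi.ne]⟩
      · left; simp [hev]
  · intro i j hij hj
    simp at hj
    simp [evAt, ha, hb]
    rcases Nat.lt_or_eq_of_le hj with hj | rfl
    · simpa [hj.ne, (hij.trans hj).ne, evAt] using hE.inj i j hij hj
    · simp only [Function.update_self, Function.update_of_ne hij.ne, hev]
      intro hc
      exact he ((hE.mem e).2 ⟨i, hij, hc⟩)
  · intro i hi
    simp at hi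
    simp [evAt, ha, hb]
    rcases Nat.lt_or_eq_of_le hi with hi | rfl
    · simpa [hi.ne, evAt] using hE.fields i hi
    · simp [hev, ht, hx]

/-- The events that are generated when the first `p` points have been treated, the beginnings of
the first `k₁` disks, the ends of the first `k₂` disks, and the crossings of all disks with the
first `q` disks and of the first `l` disks with disk `q`. -/
def Emitted (G : Scene) (p k₁ k₂ q l : ℕ) : Ev → Prop
  | .ins j => j < k₁
  | .crs a b => G.IsEvent (.crs a b) ∧ (min a b < q ∨ min a b = q ∧ max a b < l)
  | .pt i => i < p
  | .rem j => j < k₂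

section Emitted
variable {G : Scene} {p k₁ k₂ q l k : ℕ}

theorem emitted_pt (e : Ev) :
    Emitted G (p + 1) k₁ k₂ q l e ↔ e = .pt p ∨ Emitted G p k₁ k₂ q l e := by
  cases e <;> simp [Emitted]; omega

theorem emitted_ins (e : Ev) :
    Emitted G p (k₁ + 1) k₂ q l e ↔ e = .ins k₁ ∨ Emitted G p k₁ k₂ q l e := by
  cases e <;> simp [Emitted]; omega

theorem emitted_rem (e : Ev) :
    Emitted G p k₁ (k₂ + 1) q l e ↔ e = .rem k₂ ∨ Emitted G p k₁ k₂ q l e := by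
  cases e <;> simp [Emitted]; omega

/-- The scan may start at `k + 1`, since a disk has no crossing with itself. -/
theorem emitted_start (e : Ev) :
    Emitted G p k₁ k₂ k (k + 1) e ↔ Emitted G p k₁ k₂ k 0 e := by
  cases e with
  | crs a b =>
    refine and_congr_right fun h => ?_
    have : a ≠ b := fun h' => absurd h.2.2.1 (h' ▸ lt_irrefl _)
    omega
  | _ => exact Iff.rfl

theorem emitted_skip (hkl : k < l) (hC : G.C k = G.C l) (e : Ev) :
    Emitted G p k₁ k₂ k (l + 1) e ↔ Emitted G p k₁ k₂ k l e := by
  cases e with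
  | crs a b =>
    refine and_congr_right fun h => ?_
    have h1 : ¬ (a = k ∧ b = l) := by
      rintro ⟨rfl, rfl⟩; exact h.2.2.1.ne hC
    have h2 : ¬ (a = l ∧ b = k) := by
      rintro ⟨rfl, rfl⟩; exact h.2.2.1.ne' hC
    omega
  | _ => exact Iff.rfl

theorem emitted_crs (hkl : k < l) (hI : G.IsEvent (.crs k l)) (e : Ev) :
    Emitted G p k₁ k₂ k (l + 1) e ↔ e = .crs k l ∨ Emitted G p k₁ k₂ k l e := by
  cases e with
  | crs a b =>
    simp only [Emitted, Ev.crs.injEq]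
    have h2 : G.IsEvent (.crs a b) → ¬ (a = l ∧ b = k) := by
      rintro h ⟨rfl, rfl⟩; exact h.2.2.1.not_gt hI.2.2.1
    constructor
    · rintro ⟨h, h'⟩
      have := h2 h
      by_cases hab : a = k ∧ b = l
      · exact .inl hab
      · exact .inr ⟨h, by omega⟩
    · rintro (⟨rfl, rfl⟩ | ⟨h, h'⟩)
      · exact ⟨hI, by omega⟩
      · exact ⟨h, by omega⟩
  | _ => simp [Emitted]

theorem emitted_crs' (hkl : k < l) (hI : G.IsEvent (.crs l k)) (e : Ev) :
    Emitted G p k₁ k₂ k (l + 1) e ↔ e = .crs l k ∨ Emitted G p k₁ k₂ k l e := by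
  cases e with
  | crs a b =>
    simp only [Emitted, Ev.crs.injEq]
    have h2 : G.IsEvent (.crs a b) → ¬ (a = k ∧ b = l) := by
      rintro h ⟨rfl, rfl⟩; exact h.2.2.1.not_gt hI.2.2.1
    constructor
    · rintro ⟨h, h'⟩
      have := h2 h
      by_cases hab : a = l ∧ b = k
      · exact .inl hab
      · exact .inr ⟨h, by omega⟩
    · rintro (⟨rfl, rfl⟩ | ⟨h, h'⟩)
      · exact ⟨hI, by omega⟩
      · exact ⟨h, by omega⟩
  | _ => simp [Emitted]

/-- The left ends are sorted, so once disk `l` begins after disk `k` ends, no later disk meets `k`.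
Stopping there keeps the generation within the number of intersecting pairs. -/
theorem emitted_end (hlo : ∀ i j, i < j → j < G.m → G.lo i ≤ G.lo j)
    (hl : l < G.m → G.hi k < G.lo l) (e : Ev) :
    Emitted G p k₁ k₂ (k + 1) 0 e ↔ Emitted G p k₁ k₂ k l e := by
  cases e with
  | crs a b =>
    refine and_congr_right fun h => ?_
    suffices min a b = k → max a b < l by omega
    intro hmin
    by_contra hmax
    obtain ⟨ha, hb, -, h1, h2⟩ := h
    have hle : G.lo (max a b) ≤ G.hi k := by
      rcases le_total a b with hab | hab
      · rw [max_eq_right hab, ← hmin, min_eq_left hab]; exact h2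
      · rw [max_eq_left hab, ← hmin, min_eq_right hab]; exact h1
    have hlm : G.hi k < G.lo l := hl (by omega)
    rcases Nat.lt_or_ge l (max a b) with hlt | hge
    · have := hlo l (max a b) hlt (by omega)
      linarith
    · rw [show max a b = l by omega] at hle
      linarith
  | _ => exact Iff.rfl

theorem emitted_all (e : Ev) :
    Emitted G G.n G.m G.m G.m 0 e ↔ G.IsEvent e := by
  cases e with
  | crs a b =>
    refine ⟨fun h => h.1, fun h => ⟨h, .inl ?_⟩⟩
    have := h.1
    omega
  | _ => exact Iff.rfl

end Emitted

open Classical in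
/-- The number of disks from index `l` on that begin before disk `k` ends. -/
noncomputable def _root_.Scene.degFrom (G : Scene) (k l : ℕ) : ℕ :=
  ((Finset.Ico l G.m).filter fun j => G.lo j ≤ G.hi k).card

theorem _root_.Scene.degFrom_eq {G : Scene} {k l : ℕ} (hl : l < G.m) (h : G.lo l ≤ G.hi k) :
    G.degFrom k l = G.degFrom k (l + 1) + 1 := by
  unfold Scene.degFrom
  rw [← Finset.insert_Ico_add_one_left_eq_Ico hl, Finset.filter_insert, if_pos h,
    Finset.card_insert_of_notMem (by simp)]

/-- The centre of a disk. -/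
abbrev ctr (k : ℕ) : RExp := .read 5 (av k)

/-- The radius of a disk. -/
abbrev rad (k : ℕ) : RExp := .read 6 (av k)

/-- The abscissa of the crossing of two disks. -/
def crossExp (a b : ℕ) : RExp :=
  .div (.sub (.sub (.mul (rad a) (rad a)) (.mul (ctr a) (ctr a)))
      (.sub (.mul (rad b) (rad b)) (.mul (ctr b) (ctr b))))
    (.mul (.lit 2) (.sub (ctr b) (ctr a)))

/-- Generate the crossings of disk `k` (variable `2`) with the later disks. -/
def crsLoop : Prog :=
  .while (.and (.nlt (av 3) (av 0)) (.rle (.sub (ctr 3) (rad 3)) (.add (ctr 2) (rad 2))))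
    (.ite (.rlt (ctr 2) (ctr 3)) (emitProg 1 (av 2) (av 3) (crossExp 2 3))
        (.ite (.rlt (ctr 3) (ctr 2)) (emitProg 1 (av 3) (av 2) (crossExp 3 2)) .skip) ;;
      aset 3 (.add (av 3) (.lit 1)))

theorem emitProg_writes {t i : ℕ} {a b : NExp} {x : RExp} :
    (emitProg t a b x).WritesNat i ↔ i = 6 ∨ i = 8 ∨ i = 9 ∨ i = 10 := by
  simp [emitProg]; omega

theorem emitProg_writesReal {t i : ℕ} {a b : NExp} {x : RExp} :
    (emitProg t a b x).WritesReal i ↔ i = 8 := by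
  simp [emitProg]; omega

/-- Every disk the scan passes meets disk `k`, and all but the last test is charged to such a disk.
Concentric pairs are passed without producing an event. -/
theorem crsLoop_runs {s : State} {m n k : ℕ} (h0 : s.nat 6 0 = m) (h2 : s.nat 6 2 = k)
    (h3 : s.nat 6 3 = k + 1) (hk : k < m) (hv : (scene s m n).Valid)
    (hlo : ∀ i j, i < j → j < m → (scene s m n).lo i ≤ (scene s m n).lo j)
    (hE : Emit (scene s m n) (Emitted (scene s m n) n (k + 1) (k + 1) k 0) s) :
    Runs crsLoop s (200 * (scene s m n).degFrom k (k + 1) + 50) fun s' =>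
      Emit (scene s m n) (Emitted (scene s m n) n (k + 1) (k + 1) (k + 1) 0) s' ∧
        s'.nat 6 1 ≤ s.nat 6 1 + (scene s m n).degFrom k (k + 1) ∧
        ∀ j, j ≠ 1 → j ≠ 3 → s'.nat 6 j = s.nat 6 j := by
  obtain ⟨G, hG⟩ : ∃ G, G = scene s m n := ⟨_, rfl⟩
  rw [← hG] at hv hlo hE ⊢
  have hGm : G.m = m := by rw [hG]; rfl
  have hGC : G.C = s.real 5 := by rw [hG]; rfl
  have hGR : G.R = s.real 6 := by rw [hG]; rfl
  unfold Runs crsLoop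
  obtain ⟨Inv, hInv⟩ : ∃ Inv : State → ℕ → Prop, ∀ s' c, Inv s' c ↔
    ∃ l, s'.nat 6 3 = l ∧ k < l ∧ Emit G (Emitted G n (k + 1) (k + 1) k l) s' ∧
      s'.nat 6 1 + G.degFrom k l ≤ s.nat 6 1 + G.degFrom k (k + 1) ∧
      (∀ j, j ≠ 1 → j ≠ 3 → s'.nat 6 j = s.nat 6 j) ∧ 200 * G.degFrom k l + 50 ≤ c :=
    ⟨_, fun _ _ => Iff.rfl⟩
  refine wp_while Inv ((hInv _ _).2 ⟨k + 1, h3, by omega, hE.congr emitted_start, by omega,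
    fun _ _ _ => rfl, le_rfl⟩) ?_
  intro s' c hs hI
  obtain ⟨l, g3, hkl, hE', hN, hj, hc⟩ := (hInv _ _).1 hI
  have g0 : s'.nat 6 0 = m := by rw [hj 0 (by omega) (by omega), h0]
  have g2 : s'.nat 6 2 = k := by rw [hj 2 (by omega) (by omega), h2]
  have r5 : s'.real 5 = G.C := by rw [hGC]; exact hs.real 5 (by simp [emitProg_writesReal])
  have r6 : s'.real 6 = G.R := by rw [hGR]; exact hs.real 6 (by simp [emitProg_writesReal])
  refine ⟨by simp; omega, fun hg => ?_, fun hg => ?_⟩ <;> simp [g3, g0, g2, r5, r6] at hg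
  · obtain ⟨hlm, hle⟩ := hg
    have hle : G.lo l ≤ G.hi k := by unfold Scene.lo Scene.hi; linarith
    have hdeg := Scene.degFrom_eq (hGm ▸ hlm) hle
    have hle' : G.lo k ≤ G.hi l := by
      have h1 := hlo k l hkl hlm
      have h2 := hv.R_pos l (hGm ▸ hlm)
      unfold Scene.lo Scene.hi at *
      linarith
    have fin : ∀ s₁ c₁, c ≤ c₁ + 150 → Emit G (Emitted G n (k + 1) (k + 1) k (l + 1)) s₁ →
        (∀ j, j ≠ 1 → s₁.nat 6 j = s'.nat 6 j) → s₁.nat 6 1 ≤ s'.nat 6 1 + 1 →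
        wp (aset 3 (.add (av 3) (.lit 1))) Inv s₁ c₁ := by
      intro s₁ c₁ hc₁ hE₁ hj₁ hN₁
      rw [wp_nset]
      refine ⟨by simp; omega, ?_⟩
      rw [hInv]
      refine ⟨l + 1, by simp [hj₁, g3], by omega, hE₁.of_eq (by simp) (by simp) (by simp)
        (by simp) (by simp), by simp; omega, fun j j1 j3 => ?_, by simp; omega⟩
      simp [j3, hj₁ j j1, hj j j1 j3]
    simp only [wp_seq, wp_ite, wp_skip]
    refine ⟨by simp; omega, fun hb => ?_, fun hb => ?_⟩ <;> simp [g3, g2, r5] at hb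
    · have hI : G.IsEvent (.crs k l) := ⟨hGm ▸ hk, hGm ▸ hlm, hb, hle', hle⟩
      refine wp_emitProg hE' (e := .crs k l) (fun h => ?_) rfl (fun s₂ h => by simp [h, g2, Ev.fst])
        (fun s₂ h => by simp [h, g3, Ev.snd])
        (by simp [crossExp, r5, r6, g2, g3, Scene.pos, Scene.cross]) (by simp [crossExp]; omega) ?_
      · have := h.2
        omega
      · intro s₁ c₁ hc₁ hE₁ hj₁ hN₁ _ _
        simp [crossExp] at hc₁
        exact fin s₁ c₁ (by omega) (hE₁.congr (emitted_crs hkl hI)) hj₁ (by omega)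
    refine ⟨by simp; omega, fun hb' => ?_, fun hb' => ?_⟩ <;> simp [g3, g2, r5] at hb'
    · have hI : G.IsEvent (.crs l k) := ⟨hGm ▸ hlm, hGm ▸ hk, hb', hle, hle'⟩
      refine wp_emitProg hE' (e := .crs l k) (fun h => ?_) rfl (fun s₂ h => by simp [h, g3, Ev.fst])
        (fun s₂ h => by simp [h, g2, Ev.snd])
        (by simp [crossExp, r5, r6, g2, g3, Scene.pos, Scene.cross]) (by simp [crossExp]; omega) ?_
      · have := h.2
        omega
      · intro s₁ c₁ hc₁ hE₁ hj₁ hN₁ _ _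
        simp [crossExp] at hc₁
        exact fin s₁ c₁ (by omega) (hE₁.congr (emitted_crs' hkl hI)) hj₁ (by omega)
    · refine ⟨by simp; omega, ?_⟩
      exact fin _ _ (by simp; omega) (hE'.congr (emitted_skip hkl (le_antisymm hb' hb)))
        (fun _ _ => rfl) (by omega)
  · refine ⟨hE'.congr (emitted_end (by rwa [hGm]) ?_), by omega, hj⟩
    intro h
    have := hg (hGm ▸ h)
    unfold Scene.lo Scene.hi
    linarith

/-- Generate all events. -/
def genProg : Prog :=
  aset 2 (.lit 0) ;;
  .while (.nlt (av 2) (.read 0 (.lit 0)))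
    (emitProg 2 (av 2) (.lit 0) (.read 0 (av 2)) ;; aset 2 (.add (av 2) (.lit 1))) ;;
  aset 2 (.lit 0) ;;
  .while (.nlt (av 2) (av 0))
    (emitProg 0 (av 2) (.lit 0) (.sub (ctr 2) (rad 2)) ;;
      emitProg 3 (av 2) (.lit 0) (.add (ctr 2) (rad 2)) ;;
      aset 3 (.add (av 2) (.lit 1)) ;; crsLoop ;; aset 2 (.add (av 2) (.lit 1)))

theorem crsLoop_writes {i : ℕ} : crsLoop.WritesNat i ↔ i = 6 ∨ i = 8 ∨ i = 9 ∨ i = 10 := by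
  simp [crsLoop, emitProg_writes]; omega

theorem crsLoop_writesReal {i : ℕ} : crsLoop.WritesReal i ↔ i = 8 := by
  simp [crsLoop, emitProg_writesReal]

/-- The number of pairs of disks of which one begins before the other one ends. -/
noncomputable def _root_.Scene.pairs (G : Scene) (k : ℕ) : ℕ :=
  ∑ j ∈ Finset.range k, G.degFrom j (j + 1)

theorem genProg_runs {s : State} {m n : ℕ} (hn : s.nat 0 0 = n) (h0 : s.nat 6 0 = m)
    (h1 : s.nat 6 1 = 0) (hv : (scene s m n).Valid)
    (hlo : ∀ i j, i < j → j < m → (scene s m n).lo i ≤ (scene s m n).lo j) :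
    Runs genProg s (100 * n + 300 * m + 200 * (scene s m n).pairs m + 100) fun s' =>
      Emit (scene s m n) (scene s m n).IsEvent s' ∧
        s'.nat 6 1 ≤ n + 2 * m + (scene s m n).pairs m ∧
        ∀ j, j ≠ 1 → j ≠ 2 → j ≠ 3 → s'.nat 6 j = s.nat 6 j := by
  obtain ⟨G, hG⟩ : ∃ G, G = scene s m n := ⟨_, rfl⟩
  rw [← hG] at hv hlo ⊢
  have hGm : G.m = m := by rw [hG]; rfl
  have hGn : G.n = n := by rw [hG]; rfl
  unfold Runs genProg
  simp only [wp_seq, wp_nset]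
  refine ⟨by simp, ?_⟩
  obtain ⟨Inv, hInv⟩ : ∃ Inv : State → ℕ → Prop, ∀ s' c, Inv s' c ↔
    ∃ p, s'.nat 6 2 = p ∧ p ≤ n ∧ Emit G (Emitted G p 0 0 0 0) s' ∧ s'.nat 6 1 = p ∧
      (∀ j, j ≠ 1 → j ≠ 2 → s'.nat 6 j = s.nat 6 j) ∧
      100 * (n - p) + 300 * m + 200 * G.pairs m + 90 ≤ c :=
    ⟨_, fun _ _ => Iff.rfl⟩
  refine wp_while Inv ((hInv _ _).2 ⟨0, by simp, by omega, ?_, by simp [h1], fun j _ h => by simp [h],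
    by simp⟩) ?_
  · refine ⟨fun e => ?_, by simp [h1], by simp [h1]⟩
    cases e <;> simp [Emitted, h1]
  intro s' c hs hI
  obtain ⟨p, g2, hp, hE, hN, hj, hc⟩ := (hInv _ _).1 hI
  have e0 : s'.nat 0 = s.nat 0 := by rw [hs.nat 0 (by simp [emitProg_writes])]; simp
  have hr (a) (ha : a ≠ 8) : s'.real a = s.real a := by
    rw [hs.real a (by simp [emitProg_writesReal, ha])]; simp
  refine ⟨by simp; omega, fun hg => ?_, fun hg => ?_⟩ <;> simp [g2, e0, hn] at hg
  · simp only [wp_seq]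
    refine wp_emitProg hE (e := .pt p) (by simp [Emitted]) rfl (fun s₂ h => by simp [h, g2, Ev.fst])
        (fun s₂ h => by simp [Ev.snd]) ?_ (by simp; omega) ?_
    · simp [hr, g2, hG, scene, Scene.pos]
    · intro s₁ c₁ hc₁ hE₁ hj₁ hN₁ _ _
      simp at hc₁
      rw [wp_nset]
      refine ⟨by simp; omega, ?_⟩
      rw [hInv]
      refine ⟨p + 1, by simp [hj₁, g2], by omega, (hE₁.congr emitted_pt).of_eq (by simp) (by simp)
        (by simp) (by simp) (by simp), by simp [hN₁, hN], fun j j1 j2 => ?_, by simp; omega⟩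
      simp [j2, hj₁ j j1, hj j j1 j2]
  obtain rfl : p = n := by omega
  simp only [wp_seq, wp_nset]
  refine ⟨by simp; omega, ?_⟩
  clear hInv hI Inv
  have hmono : Monotone G.pairs := fun a b h =>
    Finset.sum_le_sum_of_subset (Finset.range_mono h)
  -- The credits already spent on pairs are added on the right, which avoids a truncated
  -- subtraction.
  obtain ⟨Inv, hInv⟩ : ∃ Inv : State → ℕ → Prop, ∀ s' c, Inv s' c ↔
    ∃ k, s'.nat 6 2 = k ∧ k ≤ m ∧ Emit G (Emitted G p k k k 0) s' ∧
      s'.nat 6 1 ≤ p + 2 * k + G.pairs k ∧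
      (∀ j, j ≠ 1 → j ≠ 2 → j ≠ 3 → s'.nat 6 j = s.nat 6 j) ∧
      300 * (m - k) + 200 * G.pairs m + 50 ≤ c + 200 * G.pairs k :=
    ⟨_, fun _ _ => Iff.rfl⟩
  refine wp_while Inv ((hInv _ _).2 ⟨0, by simp, by omega, hE.of_eq (by simp) (by simp)
    (by simp) (by simp) (by simp), by simp; omega, fun j h1 h2 _ => ?_,
    by simp; omega⟩) ?_
  · simp [h2, hj j h1 h2]
  intro s₁ c₁ hs₁ hI
  obtain ⟨k, i2, hk, hE₁, hN₁, hj₁, hc₁⟩ := (hInv _ _).1 hI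
  have hr₁ (a) (ha : a ≠ 8) : s₁.real a = s.real a := by
    rw [hs₁.real a (by simp [emitProg_writesReal, crsLoop_writesReal, ha])]; simp [hr a ha]
  have g0 : s₁.nat 6 0 = m := by rw [hj₁ 0 (by omega) (by omega) (by omega), h0]
  have hkm := hmono hk
  refine ⟨by simp; omega, fun hg => ?_, fun hg => ?_⟩ <;> simp [i2, g0] at hg
  · have hsucc : G.pairs (k + 1) = G.pairs k + G.degFrom k (k + 1) := Finset.sum_range_succ _ _
    have hkm' : G.pairs (k + 1) ≤ G.pairs m := hmono hg
    simp only [wp_seq]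
    refine wp_emitProg hE₁ (e := .ins k) (by simp [Emitted]) rfl
      (fun s₂ h => by simp [h, i2, Ev.fst]) (fun s₂ h => by simp [Ev.snd]) ?_ (by simp; omega) ?_
    · simp [hr₁, i2, hG, scene, Scene.pos, Scene.lo]
    intro s₂ c₂ hc₂ hE₂ hj₂ hN₂ hr₂ h₂0
    simp at hc₂
    simp only [wp_seq]
    refine wp_emitProg (hE₂.congr emitted_ins) (e := .rem k) (by simp [Emitted]) rfl
      (fun s₂ h => by simp [h, hj₂, i2, Ev.fst]) (fun s₂ h => by simp [Ev.snd]) ?_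
      (by simp; omega) ?_
    · simp [hr₂, hj₂, hr₁, i2, hG, scene, Scene.pos, Scene.hi]
    intro s₃ c₃ hc₃ hE₃ hj₃ hN₃ hr₃ h₃0
    simp at hc₃
    simp only [wp_seq, wp_nset]
    refine ⟨by simp; omega, ?_⟩
    have hE₄ := (hE₃.congr emitted_rem)
    obtain ⟨s₄, hs₄⟩ : ∃ s₄, s₄ = s₃.setNat 6 ((NExp.lit 3).eval s₃)
      ((NExp.add (av 2) (.lit 1)).eval s₃) := ⟨_, rfl⟩
    rw [← hs₄]
    have hsub : c₃ - ((NExp.lit 3).cost + ((av 2).add (NExp.lit 1)).cost + 1) = c₃ - 6 := by simp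
    rw [hsub]
    have hsc : scene s₄ m p = G := by
      rw [hG, hs₄]
      simp [scene, hr₃, hr₂, hr₁]
    have hj₄ (j) (h1 : j ≠ 1) (h3 : j ≠ 3) : s₄.nat 6 j = s₁.nat 6 j := by
      simp [hs₄, h3, hj₃ j h1, hj₂ j h1]
    refine (crsLoop_runs (s := s₄) (m := m) (n := p) (k := k) ((hj₄ 0 (by omega) (by omega)).trans g0)
      ((hj₄ 2 (by omega) (by omega)).trans i2) (by simp [hs₄, hj₃, hj₂, i2]) hg
      (by rwa [hsc]) (by rwa [hsc]) ?_).wp (by rw [hsc]; omega) ?_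
    · rw [hsc]
      exact hE₄.of_eq (by simp [hs₄]) (by simp [hs₄]) (by simp [hs₄]) (by simp [hs₄]) (by simp [hs₄])
    rw [hsc]
    rintro s₅ c₅ - ⟨hE₅, hN₅, hj₅⟩ hc₅
    simp at hc₅
    have hN₄ : s₄.nat 6 1 = s₁.nat 6 1 + 2 := by simp [hs₄, hN₃, hN₂]
    simp only [wp_nset]
    refine ⟨by simp; omega, ?_⟩
    rw [hInv]
    refine ⟨k + 1, ?_, by omega, hE₅.of_eq (by simp) (by simp) (by simp)
        (by simp) (by simp), by simp; omega, fun j j1 j2 j3 => ?_, by simp; omega⟩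
    · simp [hj₅, hj₄, i2]
    · simp [j2, hj₅ j j1 j3, hj₄ j j1 j3, hj₁ j j1 j2 j3]
  · obtain rfl : k = m := by omega
    subst hGn hGm
    exact ⟨hE₁.congr fun e => (emitted_all e).symm, hN₁, hj₁⟩

end RealRAM

/-! ### The sorted schedule of events -/

namespace RealRAM

/-- The key that is stored with an event. -/
noncomputable def keyAt (s : State) (i : ℕ) : ℝ ×ₗ ℕ ×ₗ ℝ ×ₗ ℝ :=
  toLex (s.real 8 i, toLex (s.nat 8 i, toLex (s.real 5 (s.nat 9 i), s.real 5 (s.nat 10 i))))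

/-- The test that compares events. -/
def evCmp : BExp :=
  .rlex (.read 8 (sv 0)) (.read 8 (sv 1)) (.nlex (.read 8 (sv 0)) (.read 8 (sv 1))
    (.rlex (.read 5 (.read 9 (sv 0))) (.read 5 (.read 9 (sv 1)))
      (.rle (.read 5 (.read 10 (sv 0))) (.read 5 (.read 10 (sv 1))))))

theorem decides_evCmp (s : State) : Decides evCmp (fun u v => keyAt s u ≤ keyAt s v) s := by
  intro s' hs hr
  rw [evCmp, BExp.rlex_holds, BExp.nlex_holds, BExp.rlex_holds]
  simp [hr, hs, keyAt, Prod.Lex.toLex_le_toLex]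

/-- The stored keys are the keys of the stored events, and a permutation lists each index once; as
each event is stored once, no event is repeated or lost. -/
theorem Emit.schedule {G : Scene} {s : State} {N : ℕ} {P : ℕ → ℕ} (h : Emit G G.IsEvent s)
    (hC : G.C = s.real 5) (hN : s.nat 6 1 = N)
    (hs : (seg P 0 N).Pairwise fun u v => keyAt s u ≤ keyAt s v)
    (hp : (seg P 0 N).Perm (List.range N)) : G.Schedule (fun i => evAt s (P i)) N := by
  have hlt : ∀ i < N, P i < N := fun i hi =>
    List.mem_range.1 (hp.mem_iff.1 (mem_seg.2 ⟨i, by omega, hi, rfl⟩))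
  have hkey : ∀ i < N, keyAt s i = G.key (evAt s i) := by
    intro i hi
    obtain ⟨h1, h2, h3, h4⟩ := h.fields i (by omega)
    rw [keyAt, Scene.key, h1, h2, h3, h4, hC]
  refine ⟨fun i j hij hj he => ?_, fun i j hij hj => ?_, fun e => ?_⟩
  · have hnd : (seg P 0 N).Nodup := hp.nodup_iff.2 List.nodup_range
    have hne : P i ≠ P j := by
      rw [List.Nodup, pairwise_seg] at hnd
      exact hnd i j (by omega) hij hj
    rcases Nat.lt_or_gt_of_ne hne with h' | h'
    · exact h.inj _ _ h' (hN ▸ hlt j hj) he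
    · exact h.inj _ _ h' (hN ▸ hlt i (by omega)) he.symm
  · rw [pairwise_seg] at hs
    have := hs i j (by omega) hij hj
    rwa [hkey _ (hlt i (by omega)), hkey _ (hlt j hj)] at this
  · rw [h.mem, hN]
    constructor
    · rintro ⟨i, hi, rfl⟩
      obtain ⟨j, -, hj, rfl⟩ := mem_seg.1 (hp.mem_iff.2 (List.mem_range.2 hi))
      exact ⟨j, hj, rfl⟩
    · rintro ⟨j, hj, rfl⟩
      exact ⟨P j, hlt j hj, rfl⟩

end RealRAM

/-! ### Transfer between the instance and its distinct disks -/

namespace LineDiskInstance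
open RealRAM
variable {n m : ℕ} (I : LineDiskInstance n m)

theorem radius_pos_idx {k : ℕ} (hk : k < m) : 0 < I.input.real 3 k := by
  simpa [input, toArray, hk] using I.radius_pos _

theorem axis_mem_disk {x : ℝ} {k : Fin m} (h1 : I.center k - I.radius k ≤ x)
    (h2 : x ≤ I.center k + I.radius k) : !₂[x, 0] ∈ I.disk k := by
  rw [disk, Metric.mem_closedBall, EuclideanSpace.dist_eq]
  simp [Fin.sum_univ_two, Real.dist_eq, Real.sqrt_sq_eq_abs, abs_le]
  constructor <;> linarith

/-- The scene of the points of the instance and of `m'` of its disks. -/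
structure Reduced (G : Scene) (O : ℕ → ℕ) : Prop where
  n_eq : G.n = n
  X_eq : G.X = I.input.real 0
  Y_eq : G.Y = I.input.real 1
  O_lt : ∀ j < G.m, O j < m
  eq : ∀ j < G.m, G.C j = I.input.real 2 (O j) ∧ G.R j = I.input.real 3 (O j) ∧
    G.W j = I.input.real 4 (O j)
  sorted : ∀ i j, i < j → j < G.m → leftKey (G.C i) (G.R i) < leftKey (G.C j) (G.R j)
  exists_eq : ∀ k < m, ∃ j < G.m, G.C j = I.input.real 2 k ∧ G.R j = I.input.real 3 k ∧
    G.W j ≤ I.input.real 4 k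

variable {I} {G : Scene} {O : ℕ → ℕ}

theorem Reduced.inj (h : I.Reduced G O) {a b : ℕ} (ha : a < G.m) (hb : b < G.m)
    (hC : G.C a = G.C b) (hR : G.R a = G.R b) : a = b := by
  rcases Nat.lt_trichotomy a b with h' | h' | h'
  · exact absurd (h.sorted a b h' hb) (by simp [hC, hR])
  · exact h'
  · exact absurd (h.sorted b a h' ha) (by simp [hC, hR])

theorem Reduced.valid (h : I.Reduced G O) : G.Valid where
  R_pos k hk := by
    rw [(h.eq k hk).2.1]
    exact I.radius_pos_idx (h.O_lt k hk)
  W_nonneg k hk := by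
    rw [(h.eq k hk).2.2]
    exact I.weight_nonneg_idx _
  inj _ ha _ hb := h.inj ha hb

theorem Reduced.lo_le (h : I.Reduced G O) {i j : ℕ} (hij : i < j) (hj : j < G.m) :
    G.lo i ≤ G.lo j := by
  have := h.sorted i j hij hj
  rw [leftKey, leftKey, Prod.Lex.toLex_lt_toLex] at this
  rcases this with h' | h'
  · exact h'.le
  · exact h'.1.le

theorem Reduced.O_inj (h : I.Reduced G O) {a b : ℕ} (ha : a < G.m) (hb : b < G.m)
    (hO : O a = O b) : a = b := by
  obtain ⟨h1, h2, -⟩ := h.eq a ha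
  obtain ⟨h3, h4, -⟩ := h.eq b hb
  exact h.inj ha hb (by rw [h1, h3, hO]) (by rw [h2, h4, hO])

theorem Reduced.cov_iff (h : I.Reduced G O) {j k : ℕ} (hC : G.C j = I.input.real 2 k)
    (hR : G.R j = I.input.real 3 k) (i : ℕ) : G.Cov j i ↔ I.CoversAt k i := by
  rw [Scene.Cov, Scene.h, hC, hR, h.X_eq, h.Y_eq]
  exact Iff.rfl

/-- Every cover of the instance can be replaced by disks of the scene. -/
theorem Reduced.exists_cover (h : I.Reduced G O) {T : Finset ℕ} (hT : T ⊆ Finset.range m)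
    (hc : I.CoversIdx T) : ∃ T' ⊆ Finset.range G.m, G.CoversAll T' ∧
      ∑ k ∈ T', G.W k ≤ ∑ k ∈ T, I.input.real 4 k := by
  have := h.exists_eq
  choose! f hf hC hR hW using this
  -- Copies in `T` may be sent to the same representative, which can only reduce the weight.
  refine ⟨T.image f, ?_, fun i hi => ?_, ?_⟩
  · intro j hj
    obtain ⟨k, hk, rfl⟩ := Finset.mem_image.1 hj
    exact Finset.mem_range.2 (hf k (Finset.mem_range.1 (hT hk)))
  · obtain ⟨k, hk, hki⟩ := hc i (h.n_eq ▸ hi)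
    have hkm := Finset.mem_range.1 (hT hk)
    exact ⟨f k, Finset.mem_image_of_mem f hk, (h.cov_iff (hC k hkm) (hR k hkm) i).2 hki⟩
  · refine (Finset.sum_image_le_of_nonneg fun j hj => ?_).trans
      (Finset.sum_le_sum fun k hk => hW k (Finset.mem_range.1 (hT hk)))
    obtain ⟨k, hk, rfl⟩ := Finset.mem_image.1 hj
    exact h.valid.W_nonneg _ (hf k (Finset.mem_range.1 (hT hk)))

/-- An optimal cover in the scene is an optimal cover of the instance. -/
theorem Reduced.isOptimal (h : I.Reduced G O) {S : Finset ℕ} {s : State}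
    (hS : S ⊆ Finset.range G.m) (hc : G.CoversAll S)
    (ho : ∀ T ⊆ Finset.range G.m, G.CoversAll T → ∑ k ∈ S, G.W k ≤ ∑ k ∈ T, G.W k)
    (hs : ∀ k, s.nat 1 k = 1 ↔ k ∈ S.image O) : I.IsOptimal (output m s) := by
  refine I.isOptimal_output (D := S.image O) ?_ (fun k _ => hs k) (fun i hi => ?_) fun T hT hTc => ?_
  · intro k hk
    obtain ⟨j, hj, rfl⟩ := Finset.mem_image.1 hk
    exact Finset.mem_range.2 (h.O_lt j (Finset.mem_range.1 (hS hj)))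
  · obtain ⟨j, hj, hji⟩ := hc i (h.n_eq ▸ hi)
    obtain ⟨h1, h2, -⟩ := h.eq j (Finset.mem_range.1 (hS hj))
    exact ⟨O j, Finset.mem_image_of_mem O hj, (h.cov_iff h1 h2 i).1 hji⟩
  · obtain ⟨T', hT', hTc', hle⟩ := h.exists_cover hT hTc
    refine le_trans ?_ ((ho T' hT' hTc').trans hle)
    rw [Finset.sum_image fun a ha b hb => h.O_inj (Finset.mem_range.1 (hS ha))
      (Finset.mem_range.1 (hS hb))]
    exact (Finset.sum_congr rfl fun j hj => ((h.eq j (Finset.mem_range.1 (hS hj))).2.2).symm).le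

/-- If a later disk begins before an earlier one ends, the left end of the later disk is a common
point of both. Writing the original indices in increasing order maps these pairs injectively to
pairs counted by `kappa`. -/
theorem Reduced.pairs_le (h : I.Reduced G O) : G.pairs G.m ≤ I.kappa := by
  classical
  unfold Scene.pairs Scene.degFrom kappa
  rw [← Finset.card_sigma]
  have hmem : ∀ q ∈ (Finset.range G.m).sigma fun j =>
      (Finset.Ico (j + 1) G.m).filter fun l => G.lo l ≤ G.hi j,
      q.1 < q.2 ∧ q.2 < G.m ∧ G.lo q.2 ≤ G.hi q.1 := by
    intro q hq
    simp only [Finset.mem_sigma, Finset.mem_range, Finset.mem_filter, Finset.mem_Ico] at hq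
    exact ⟨by omega, by omega, hq.2.2⟩
  have hmemO : ∀ q ∈ (Finset.range G.m).sigma fun j =>
      (Finset.Ico (j + 1) G.m).filter fun l => G.lo l ≤ G.hi j,
      min (O q.1) (O q.2) < m ∧ max (O q.1) (O q.2) < m := by
    intro q hq
    obtain ⟨h1, h2, -⟩ := hmem q hq
    have := h.O_lt q.1 (by omega)
    have := h.O_lt q.2 h2
    omega
  have hdisk : ∀ j, (hj : j < G.m) → ∀ x, G.lo j ≤ x → x ≤ G.hi j →
      !₂[x, 0] ∈ I.disk ⟨O j, h.O_lt j hj⟩ := by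
    intro j hj x h1 h2
    obtain ⟨e1, e2, -⟩ := h.eq j hj
    rw [Scene.lo, e1, e2] at h1
    rw [Scene.hi, e1, e2] at h2
    refine I.axis_mem_disk ?_ ?_
    · simpa [input, toArray, h.O_lt j hj] using h1
    · simpa [input, toArray, h.O_lt j hj] using h2
  by_cases hm : m = 0
  · have : G.m = 0 := by
      by_contra h0
      have := h.O_lt 0 (Nat.pos_of_ne_zero h0)
      omega
    simp [this]
  have : NeZero m := ⟨hm⟩
  -- `Fin.ofNat` serves to define the map on all pairs; the indices that matter are below `m`, so
  -- nothing is reduced modulo `m`.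
  refine Finset.card_le_card_of_injOn
    (fun q => (Fin.ofNat m (min (O q.1) (O q.2)), Fin.ofNat m (max (O q.1) (O q.2))))
    (fun q hq => ?_) fun q hq q' hq' he => ?_
  · obtain ⟨h1, h2, h3⟩ := hmem q hq
    obtain ⟨g1, g2⟩ := hmemO q hq
    have hne : O q.1 ≠ O q.2 := fun he => h1.ne (h.O_inj (h1.trans h2) h2 he)
    have hx1 := hdisk q.1 (h1.trans h2) (G.lo q.2) (h.lo_le h1 h2) h3
    have hx2 := hdisk q.2 h2 (G.lo q.2) le_rfl (by
      have := h.valid.R_pos q.2 h2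
      unfold Scene.lo Scene.hi; linarith)
    have e1 : Fin.ofNat m (min (O q.1) (O q.2)) = ⟨_, g1⟩ := Fin.ext (Nat.mod_eq_of_lt g1)
    have e2 : Fin.ofNat m (max (O q.1) (O q.2)) = ⟨_, g2⟩ := Fin.ext (Nat.mod_eq_of_lt g2)
    simp only [Finset.coe_filter, Finset.mem_univ, true_and, Set.mem_ofPred_eq, e1, e2]
    refine ⟨?_, !₂[G.lo q.2, 0], ?_⟩
    · rw [Fin.mk_lt_mk]; omega
    · rcases le_total (O q.1) (O q.2) with ho | ho
      · simp only [min_eq_left ho, max_eq_right ho]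
        exact ⟨hx1, hx2⟩
      · simp only [min_eq_right ho, max_eq_left ho]
        exact ⟨hx2, hx1⟩
  · obtain ⟨h1, h2, -⟩ := hmem q hq
    obtain ⟨g1, g2⟩ := hmemO q hq
    obtain ⟨h1', h2', -⟩ := hmem q' hq'
    obtain ⟨g1', g2'⟩ := hmemO q' hq'
    simp only [Prod.mk.injEq, Fin.ext_iff, Fin.ofNat, Nat.mod_eq_of_lt g1, Nat.mod_eq_of_lt g2,
      Nat.mod_eq_of_lt g1', Nat.mod_eq_of_lt g2'] at he
    have : O q.1 = O q'.1 ∧ O q.2 = O q'.2 ∨ O q.1 = O q'.2 ∧ O q.2 = O q'.1 := by omega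
    rcases this with ⟨e1, e2⟩ | ⟨e1, e2⟩
    · have e1 := h.O_inj (h1.trans h2) (h1'.trans h2') e1
      have e2 := h.O_inj h2 h2' e2
      exact Sigma.ext e1 (heq_of_eq e2)
    · have e1 := h.O_inj (h1.trans h2) h2' e1
      have e2 := h.O_inj h2 (h1'.trans h2') e2
      omega

end LineDiskInstance

/-! ### The complete sweep program -/

namespace RealRAM

/-- The program of the plane sweep. -/
def coverProg : Prog :=
  sset 2 (.read 0 (.lit 1)) ;; sortProg diskCmp ;; compactProg ;; genProg ;;
    sset 2 (av 1) ;; sortProg evCmp ;; aset 8 (.lit 1) ;; sweepProg ;; traceProg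

theorem compactProg_writes {a : ℕ} : compactProg.WritesNat a ↔ a = 6 ∨ a = 7 := by
  simp [compactProg]; omega

theorem compactProg_writesReal {a : ℕ} : compactProg.WritesReal a ↔ a = 5 ∨ a = 6 ∨ a = 7 := by
  simp [compactProg]; omega

theorem genProg_writes {a : ℕ} : genProg.WritesNat a ↔ a = 6 ∨ a = 8 ∨ a = 9 ∨ a = 10 := by
  simp [genProg, crsLoop_writes, emitProg_writes]; omega

theorem genProg_writesReal {a : ℕ} : genProg.WritesReal a ↔ a = 8 := by
  simp [genProg, crsLoop_writesReal, emitProg_writesReal]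

/-- The time that suffices to sort `N` objects. -/
def sortTime (N : ℕ) : ℕ := 1000 * (N + 1) * (Nat.clog 2 N + 1)

theorem sortProg_runs_sortTime {α : Type*} [LinearOrder α] {cmp : BExp} {key : ℕ → α}
    {s : State} {N : ℕ} (hd : Decides cmp (fun u v => key u ≤ key v) s) (hc : cmp.cost ≤ 600) (hN : s.nat 3 2 = N) :
    Runs (sortProg cmp) s (sortTime N) fun s' =>
      (seg (s'.nat 4) 0 N).Pairwise (fun u v => key u ≤ key v) ∧ (seg (s'.nat 4) 0 N).Perm (List.range N) := by
  refine (sortProg_runs (le := fun u v => key u ≤ key v) (fun _ _ _ => le_trans)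
    (fun _ _ => le_total _ _) hd hN).mono ?_ fun _ _ h => h
  unfold sortTime
  gcongr
  omega

end RealRAM

/-- Parents are older, so strong induction unfolds a token down to the sentinel; every owner on the
way is a disk. -/
theorem Scene.Sound.subset_range {G : Scene} {d : Set Ev} {σ : Mach} {S : ℕ → Finset ℕ}
    (hS : G.Sound d σ S) {t : ℕ} (ht : t ≤ σ.cnt) : S t ⊆ Finset.range G.m := by
  induction t using Nat.strong_induction_on with
  | _ t ih =>
    rcases Nat.eq_zero_or_pos t with rfl | h0
    · simp [hS.zero]
    · have := hS.npar t h0 ht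
      rw [hS.eq t h0 ht, Finset.insert_subset_iff, Finset.mem_range]
      exact ⟨hS.owner t h0 ht, ih _ this (by omega)⟩

namespace LineDiskInstance
open RealRAM

theorem input_nat {n m : ℕ} (I : LineDiskInstance n m) {a : ℕ} (ha : a ≠ 0) (i : ℕ) :
    I.input.nat a i = 0 := by
  simp only [input]
  rcases a with - | a
  · exact absurd rfl ha
  · rfl

theorem input_real {n m : ℕ} (I : LineDiskInstance n m) {a : ℕ} (ha : 5 ≤ a) (i : ℕ) :
    I.input.real a i = 0 := by
  obtain ⟨a, rfl⟩ := Nat.exists_eq_add_of_le' ha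
  rfl

/-- The reduced scene has at most `m` disks and at most `κ` meeting pairs, so `n + 2m + κ` bounds
the number of events, and with it the second sort, the sweep and the output. -/
theorem coverProg_runs {n m : ℕ} (I : LineDiskInstance n m) (hI : I.Covers Finset.univ) :
    Runs coverProg I.input (sortTime m + sortTime (n + 2 * m + I.kappa) +
      1000 * (n + 2 * m + I.kappa) + 500) fun s => I.IsOptimal (output m s) := by
  unfold Runs coverProg
  obtain ⟨B, hB⟩ : ∃ B, B = n + 2 * m + I.kappa := ⟨_, rfl⟩
  rw [← hB]
  have hin : I.input.nat 0 0 = n := rfl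
  have him : I.input.nat 0 1 = m := rfl
  set s₀ := I.input with hs₀
  have hz : ∀ a, a ≠ 0 → ∀ i, s₀.nat a i = 0 := fun a ha => I.input_nat ha
  have hzr : ∀ a, 5 ≤ a → ∀ i, s₀.real a i = 0 := fun a ha => I.input_real ha
  clear_value s₀
  -- the disks are sorted
  simp only [wp_seq, wp_nset]
  refine ⟨by simp, ?_⟩
  obtain ⟨s, hs⟩ : ∃ s, s = s₀.setNat 3 ((NExp.lit 2).eval s₀)
    ((NExp.read 0 (.lit 1)).eval s₀) := ⟨_, rfl⟩
  rw [← hs]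
  have hsr : s.real = s₀.real := by simp [hs]
  refine (sortProg_runs_sortTime (N := m) (decides_diskCmp s) (by simp [diskCmp]) (by simp [hs, him])).wp (by simp; omega) ?_
  rintro s₁ c₁ hs₁ ⟨hsort, hperm⟩ hc₁
  simp at hc₁
  have hr₁ : s₁.real = s₀.real := by
    rw [← hsr]; funext a; exact hs₁.real a sortProg_writesReal
  have hn₁ : ∀ a, a ≠ 3 → a ≠ 4 → a ≠ 5 → s₁.nat a = s₀.nat a := by
    intro a h3 h4 h5
    rw [hs₁.nat a (by rw [sortProg_writes]; omega)]
    simp [hs, h3]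
  rw [pairwise_seg] at hsort
  -- duplicates are removed
  simp only [wp_seq]
  refine (compactProg_runs (m := m) (by simp [hn₁, him]) (by simp [hn₁, hz]) (by simp [hn₁, hz])
    fun i j hij hj => ?_).wp (by omega) ?_
  · rw [hr₁, ← hsr]
    exact hsort i j (by omega) hij hj
  rintro s₂ c₂ hs₂ ⟨hcomp, hm', h6₂⟩ hc₂
  obtain ⟨m', hm'eq⟩ : ∃ m', m' = s₂.nat 6 0 := ⟨_, rfl⟩
  rw [← hm'eq] at hcomp hm'
  have hn₂ : ∀ a, a ≠ 3 → a ≠ 4 → a ≠ 5 → a ≠ 6 → a ≠ 7 → s₂.nat a = s₀.nat a := by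
    intro a h3 h4 h5 h6 h7
    rw [hs₂.nat a (by rw [compactProg_writes]; omega), hn₁ a h3 h4 h5]
  have hr₂ : ∀ a, a ≠ 5 → a ≠ 6 → a ≠ 7 → s₂.real a = s₀.real a := by
    intro a h5 h6 h7
    rw [hs₂.real a (by rw [compactProg_writesReal]; omega), hr₁]
  obtain ⟨G, hG⟩ : ∃ G, G = scene s₂ m' n := ⟨_, rfl⟩
  have hGm : G.m = m' := by rw [hG]; rfl
  have hred : I.Reduced G (s₂.nat 7) := by
    rw [hr₁] at hcomp
    have hlt : ∀ i < m, s₁.nat 4 i < m := fun i hi =>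
      List.mem_range.1 (hperm.mem_iff.1 (mem_seg.2 ⟨i, by omega, hi, rfl⟩))
    refine ⟨by rw [hG]; rfl, ?_, ?_, ?_, ?_, ?_, ?_⟩
    · rw [hG, ← hs₀]; exact hr₂ 0 (by omega) (by omega) (by omega)
    · rw [hG, ← hs₀]; exact hr₂ 1 (by omega) (by omega) (by omega)
    · intro j hj
      obtain ⟨i, hi, hij⟩ := hcomp.mem j (hGm ▸ hj)
      rw [hij]
      exact hlt i hi
    · intro j hj
      rw [hG, ← hs₀]
      exact hcomp.eq j (hGm ▸ hj)
    · intro i j hij hj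
      rw [hG]
      exact hcomp.sorted i j hij (hGm ▸ hj)
    · intro k hk
      obtain ⟨i, -, hi, rfl⟩ := mem_seg.1 (hperm.mem_iff.2 (List.mem_range.2 hk))
      obtain ⟨j, hj, h⟩ := hcomp.exists_eq i hi
      rw [hGm, hG, ← hs₀]
      exact ⟨j, hj, h⟩
  have hpairs : G.pairs m' ≤ I.kappa := hGm ▸ hred.pairs_le
  have hv := hred.valid
  -- the events are generated
  simp only [wp_seq]
  refine (genProg_runs (m := m') (n := n) (by simp [hn₂, hin]) hm'eq.symm
    (by rw [h6₂ 1 (by omega) (by omega) (by omega)]; simp [hn₁, hz]) (by rwa [← hG])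
    (by rw [← hG]; exact fun i j hij hj => hred.lo_le hij (hGm ▸ hj))).wp
    (by rw [← hG]; omega) ?_
  rw [← hG]
  rintro s₃ c₃ hs₃ ⟨hE, hN, h6₃⟩ hc₃
  obtain ⟨N, hNeq⟩ : ∃ N, N = s₃.nat 6 1 := ⟨_, rfl⟩
  rw [← hNeq] at hN
  have hNB : N ≤ B := by omega
  have hsortB : sortTime N ≤ sortTime B := by
    unfold sortTime
    gcongr
  have hn₃ : ∀ a, a = 0 ∨ a = 1 ∨ 11 ≤ a → s₃.nat a = s₀.nat a := by
    intro a ha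
    rw [hs₃.nat a (by rw [genProg_writes]; omega), hn₂ a (by omega) (by omega) (by omega)
      (by omega) (by omega)]
  have hr₃ : ∀ a, a ≠ 8 → s₃.real a = s₂.real a := by
    intro a h8
    rw [hs₃.real a (by rw [genProg_writesReal]; omega)]
  have hO₃ : s₃.nat 7 = s₂.nat 7 := hs₃.nat 7 (by rw [genProg_writes]; omega)
  -- the events are sorted
  simp only [wp_seq, wp_nset]
  refine ⟨by simp; omega, ?_⟩
  obtain ⟨s', hs'⟩ : ∃ s', s' = s₃.setNat 3 ((NExp.lit 2).eval s₃) ((av 1).eval s₃) := ⟨_, rfl⟩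
  rw [← hs']
  have hE' : Emit G G.IsEvent s' := hE.of_eq (by simp [hs']) (by simp [hs']) (by simp [hs'])
    (by simp [hs']) (by simp [hs'])
  refine (sortProg_runs_sortTime (N := N) (decides_evCmp s') (by simp [evCmp]) (by simp [hs', hNeq])).wp (by simp; omega) ?_
  rintro s₄ c₄ hs₄ ⟨hsort', hperm'⟩ hc₄
  simp at hc₄
  have hr₄ : s₄.real = s₃.real := by
    funext a
    rw [hs₄.real a sortProg_writesReal]
    simp [hs']
  have hn₄ : ∀ a, a ≠ 3 → a ≠ 4 → a ≠ 5 → s₄.nat a = s₃.nat a := by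
    intro a h3 h4 h5
    rw [hs₄.nat a (by rw [sortProg_writes]; omega)]
    simp [hs', h3]
  -- the sweep
  simp only [wp_seq, wp_nset]
  refine ⟨by simp; omega, ?_⟩
  obtain ⟨s'', hs''⟩ : ∃ s'', s'' = s₄.setNat 6 ((NExp.lit 8).eval s₄) ((NExp.lit 1).eval s₄) :=
    ⟨_, rfl⟩
  rw [← hs'']
  have hscene : scene s'' m' n = G := by
    rw [hG]
    simp [scene, hs'', hr₄, hr₃]
  have hev : evAt s'' = evAt s' := by
    funext i
    simp [evAt, hs'', hn₄, hs']
  have hsched : G.Schedule (fun i => evAt s'' (s''.nat 4 i)) N := by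
    rw [hev, show s''.nat 4 = s₄.nat 4 by simp [hs'']]
    refine hE'.schedule ?_ (by simp [hs', hNeq]) hsort' hperm'
    rw [hG]
    simp [scene, hs', hr₃]
  have h6 : ∀ j, j ≠ 0 → j ≠ 1 → j ≠ 2 → j ≠ 3 → j ≠ 5 → s₄.nat 6 j = 0 := by
    intro j h0 h1 h2 h3 h5
    rw [hn₄ 6 (by omega) (by omega) (by omega), h6₃ j h1 h2 h3, h6₂ j h0 h2 h5,
      hn₁ 6 (by omega) (by omega) (by omega), hz 6 (by omega)]
  have hmach : mach s'' = Mach.init := by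
    have hn'' : ∀ a, 11 ≤ a → s''.nat a = fun _ => 0 := by
      intro a ha
      funext i
      rw [hs'', State.setNat_nat_ne _ _ _ (by omega), hn₄ a (by omega) (by omega) (by omega),
        hn₃ a (by omega), hz a (by omega)]
    have hr'' : s''.real 9 = fun _ => 0 := by
      funext i
      rw [hs'', State.setNat_real, hr₄, hr₃ 9 (by omega), hr₂ 9 (by omega) (by omega) (by omega),
        hzr 9 (by omega)]
    rw [mach, hn'' 11 (by omega), hn'' 12 (by omega), hn'' 13 (by omega), hn'' 14 (by omega), hr'']
    simp [Mach.init, hs'', h6]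
  refine (sweepProg_runs (m := m') (n := n) (N := N)
    (by simp [hs'', hn₄, hNeq]) (by simp [hs'', h6]) hmach (by rwa [hscene])
    (by rwa [hscene])).wp (by simp; omega) ?_
  rw [hscene]
  rintro s₅ c₅ hs₅ ⟨L, hInv, hcnt⟩ hc₅
  simp at hc₅
  have hfinal := hInv.final hv (fun e he => (hsched.isEvent_iff e).1 he) ?_
  · obtain ⟨hf, S, hS, hSc, hSo⟩ := hfinal
    have hw1 : ¬ sweepProg.WritesNat 1 ∧ ¬ sweepProg.WritesNat 7 := by
      simp [sweepProg, stepProg_writes]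
    refine (traceProg_runs hS hf fun k => ?_).wp (by omega) ?_
    · rw [hs₅.nat 1 hw1.1, hs'', State.setNat_nat_ne _ _ _ (by omega),
        hn₄ 1 (by omega) (by omega) (by omega), hn₃ 1 (by omega), hz 1 (by omega)]
    rintro s₆ c₆ - hout -
    have hO : s₅.nat 7 = s₂.nat 7 := by
      rw [hs₅.nat 7 hw1.2, hs'', State.setNat_nat_ne _ _ _ (by omega),
        hn₄ 7 (by omega) (by omega) (by omega), hO₃]
    rw [hO] at hout
    exact hred.isOptimal (hS.subset_range hf) hSc hSo hout
  · obtain ⟨T', hT', hTc', -⟩ := hred.exists_cover subset_rfl (I.coversIdx_range hI)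
    intro i hi
    obtain ⟨k, hk, hki⟩ := hTc' i hi
    exact ⟨k, hT' hk, hki⟩

end LineDiskInstance

/-! ### The second time bound -/

namespace RealRAM

theorem sortTime_le {N : ℕ} {l M : ℝ} (hN : 1 ≤ N) (hM : (N : ℝ) + 1 ≤ M)
    (hl : Real.log N ≤ l) (hl2 : Real.log 2 ≤ l) : (sortTime N : ℝ) ≤ 6000 * (M * l) := by
  have h1 := clog_succ_le hN hl hl2
  have h2 : ((N : ℝ) + 1) * (Nat.clog 2 N + 1) ≤ M * (6 * l) :=
    mul_le_mul hM h1 (by positivity) (le_trans (by positivity) hM)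
  unfold sortTime
  push_cast
  linarith

end RealRAM

namespace LineDiskInstance
open RealRAM

theorem kappa_le {n m : ℕ} (I : LineDiskInstance n m) : I.kappa ≤ m ^ 2 := by
  classical
  unfold kappa
  refine (Finset.card_filter_le _ _).trans ?_
  simp [sq]

/-- In the second term of the running time, `log (n + m)` can be replaced by `log m`. -/
theorem kappa_mul_log_le {n m : ℕ} (I : LineDiskInstance n m) (hn : 1 ≤ n) (hm : 1 ≤ m) :
    (I.kappa : ℝ) * Real.log (n + m) ≤
      (n + m) * Real.log (n + m) + 3 * (I.kappa * Real.log m) := by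
  have hκ := I.kappa_le
  have hn' : (1 : ℝ) ≤ n := by exact_mod_cast hn
  have hm' : (1 : ℝ) ≤ m := by exact_mod_cast hm
  have hl : 0 ≤ Real.log ((n : ℝ) + m) := Real.log_nonneg (by linarith)
  have hlm : 0 ≤ Real.log (m : ℝ) := Real.log_nonneg hm'
  have hk : (0 : ℝ) ≤ I.kappa := Nat.cast_nonneg _
  -- If `n < m²`, then `n + m ≤ m³` and the logarithm is at most `3 log m`. Otherwise `κ ≤ m² ≤ n`,
  -- and the first term absorbs everything.
  rcases Nat.lt_or_ge n (m ^ 2) with h | h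
  · have h2 : 2 ≤ m := by
      by_contra hc
      obtain rfl : m = 1 := by omega
      omega
    have h3 : n + m ≤ m ^ 3 := by nlinarith
    have h4 : Real.log ((n : ℝ) + m) ≤ 3 * Real.log m := by
      rw [← Real.log_rpow (by linarith)]
      refine Real.log_le_log (by linarith) ?_
      exact_mod_cast h3
    have h5 : (I.kappa : ℝ) * Real.log (n + m) ≤ I.kappa * (3 * Real.log m) := by gcongr
    have h6 : 0 ≤ ((n : ℝ) + m) * Real.log (n + m) := by positivity
    linarith
  · have h1 : (I.kappa : ℝ) ≤ n + m := by exact_mod_cast (by omega : I.kappa ≤ n + m)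
    have h2 : (I.kappa : ℝ) * Real.log (n + m) ≤ (n + m) * Real.log (n + m) := by gcongr
    have h3 : 0 ≤ 3 * ((I.kappa : ℝ) * Real.log m) := by positivity
    linarith

theorem exists_sweep : ∃ (p : RealRAM.Prog) (C : ℝ), ∀ (n m : ℕ) (I : LineDiskInstance n m),
    0 < n → I.Covers Finset.univ →
      I.SolvedWithin p (C * (((n : ℝ) + (m : ℝ)) * Real.log ((n : ℝ) + (m : ℝ)) +
        (I.kappa : ℝ) * Real.log (m : ℝ))) := by
  refine ⟨coverProg, 200000, fun n m I hn hI => ?_⟩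
  obtain ⟨s, t, he, ht, ho⟩ := I.coverProg_runs hI
  refine ⟨s, t, he, ?_, ho⟩
  have hm : 1 ≤ m := by
    obtain ⟨k, -, -⟩ := hI ⟨0, hn⟩
    have := k.2
    omega
  have hn' : (1 : ℝ) ≤ n := by exact_mod_cast hn
  have hm' : (1 : ℝ) ≤ m := by exact_mod_cast hm
  have hkl := I.kappa_mul_log_le hn hm
  have hκ : (I.kappa : ℝ) ≤ (m : ℝ) ^ 2 := by exact_mod_cast I.kappa_le
  have hk : (0 : ℝ) ≤ I.kappa := Nat.cast_nonneg _
  have hlm : 0 ≤ (I.kappa : ℝ) * Real.log m := mul_nonneg hk (Real.log_nonneg hm')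
  obtain ⟨l, hl⟩ : ∃ l, l = Real.log ((n : ℝ) + m) := ⟨_, rfl⟩
  rw [← hl] at hkl ⊢
  have hl2 : Real.log 2 ≤ l := hl ▸ Real.log_le_log (by norm_num) (by linarith)
  have hlh := half_le_log_two.trans hl2
  have h1 : (sortTime m : ℝ) ≤ 6000 * ((n + m) * l) :=
    sortTime_le hm (by linarith) (hl ▸ Real.log_le_log (by linarith) (by linarith)) hl2
  have h2 : (sortTime (n + 2 * m + I.kappa) : ℝ) ≤
      6000 * ((3 * (n + m) + I.kappa) * (2 * l)) := by
    refine sortTime_le (by omega) (by push_cast; linarith) ?_ (by linarith)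
    -- The factor `2` comes from `n + 2m + κ ≤ (n + m)²`, which uses `κ ≤ m²`.
    rw [hl, ← Real.log_rpow (by linarith)]
    refine Real.log_le_log (by push_cast; linarith) ?_
    rw [Real.rpow_ofNat]
    push_cast
    nlinarith
  have ht' : (t : ℝ) ≤ sortTime m + sortTime (n + 2 * m + I.kappa) +
      1000 * (n + 2 * m + I.kappa) + 500 := by exact_mod_cast ht
  have h3 : ((n : ℝ) + m) * (1 / 2) ≤ (n + m) * l := by gcongr
  have h4 : (I.kappa : ℝ) * (1 / 2) ≤ I.kappa * l := by gcongr
  linarith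

end LineDiskInstance

theorem mainTheorem1 :
    (∃ (p : RealRAM.Prog) (C : ℝ), ∀ (n m : ℕ) (I : LineDiskInstance n m),
      0 < n → I.Covers Finset.univ →
        I.SolvedWithin p (C * ((n : ℝ) * (m : ℝ) * Real.log ((m : ℝ) + (n : ℝ))))) ∧
    (∃ (p : RealRAM.Prog) (C : ℝ), ∀ (n m : ℕ) (I : LineDiskInstance n m),
      0 < n → I.Covers Finset.univ →
        I.SolvedWithin p (C * (((n : ℝ) + (m : ℝ)) * Real.log ((n : ℝ) + (m : ℝ)) +
          (I.kappa : ℝ) * Real.log (m : ℝ)))) :=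
  ⟨LineDiskInstance.exists_quadratic, LineDiskInstance.exists_sweep⟩
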